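/- Let $C\subset\mathbb P^2=\mathbb P^2_{\mathbb C}$ be a smooth plane curve of degree $d\ge 1$, and let $X$ be a holomorphic line field along $C$, that is, a holomorphic line subbundle $X\subset T\mathbb P^2|_C$; assume that $X\neq TC$. For $p\in C$ let $\mathrm{tang}_p(X,C)$ be the order of vanishing at $p$ of the morphism of line bundles $X\to NC=T\mathbb P^2|_C/TC$, and let $\mathrm{tang}(X,C)=\sum_{p\in C}\mathrm{tang}_p(X,C)$. Let $\phi_X:C\to\check{\mathbb P}^2$ be the map to the dual plane that sends $p$ to the projective line through $p$ with direction $X(p)$, and let $\check X=\phi_X(C)$. Then $\mathrm{tang}_p(X,C)=0$ for all but finitely many $p$; $\check X$ is an algebraic curve in $\check{\mathbb P}^2$; the map $\phi_X:C\to\check X$ has a degree $l\in\mathbb N$ (all but finitely many points of $\check X$ have exactly $l$ preimages); and, with $\deg(\check X)$ the degree of a reduced equation of $\check X$, $$\mathrm{tang}(X,C)=l\cdot\deg(\check X)+d^2-2d .$$ -/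

import Mathlib

open scoped Topology

noncomputable section

namespace PlaneCurves

/-- The vector space `ℂ³`. -/
abbrev V : Type := Fin 3 → ℂ

/-- The complex projective plane. It is also used for the dual plane: `[a]` in the dual plane is
the line of all `[x]` with `a ⬝ᵥ x = 0`. -/
abbrev P2 : Type := Projectivization ℂ V

/-- The zero locus in the projective plane of a (homogeneous) polynomial. -/
def zeroLocus (G : MvPolynomial (Fin 3) ℂ) : Set P2 :=
  {p | MvPolynomial.eval p.rep G = 0}

/-- `Z` is an algebraic curve of degree `e` in the projective plane: it is the zero locus of a
squarefree form of degree `e ≥ 1`. -/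
def IsPlaneCurveOfDegree (Z : Set P2) (e : ℕ) : Prop :=
  0 < e ∧ ∃ G : MvPolynomial (Fin 3) ℂ, G.IsHomogeneous e ∧ Squarefree G ∧ Z = zeroLocus G

/-- `f` has degree `l` as a map onto its image: all but finitely many points of the image have
exactly `l` preimages. -/
def HasDegreeOntoImage {S T : Type*} (f : S → T) (l : ℕ) : Prop :=
  {q ∈ Set.range f | (f ⁻¹' {q}).encard ≠ (l : ℕ∞)}.Finite

/-- The holomorphic tangent space `T_p ℙ² = Hom(p, ℂ³ / p)`, the point `p` being seen as a line
in `ℂ³`. -/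
abbrev TangentP2 (p : P2) : Type := p.submodule →ₗ[ℂ] (V ⧸ p.submodule)

/-- A smooth plane curve of degree `d`, given by a form `F` of degree `d` whose partial derivatives
have no common zero on the curve. -/
structure SmoothPlaneCurve (d : ℕ) where
  /-- the defining form -/
  F : MvPolynomial (Fin 3) ℂ
  homogeneous : F.IsHomogeneous d
  smooth : ∀ x : V, x ≠ 0 → MvPolynomial.eval x F = 0 →
    ∃ i, MvPolynomial.eval x (MvPolynomial.pderiv i F) ≠ 0

variable {d : ℕ}

namespace SmoothPlaneCurve

/-- The points of the curve. -/
abbrev Points (C : SmoothPlaneCurve d) : Type := zeroLocus C.F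

/-- The differential of the defining form at `x`, applied to `w`. -/
def dF (C : SmoothPlaneCurve d) (x w : V) : ℂ :=
  ∑ i, MvPolynomial.eval x (MvPolynomial.pderiv i C.F) * w i

/-- The tangent space `T_p C`, as a set of vectors of `T_p ℙ²`: those `τ : p → ℂ³ / p` for which
`τ x` is represented by vectors killed by `dF x`, for all `x` in `p`. -/
def tangentSet (C : SmoothPlaneCurve d) (p : C.Points) : Set (TangentP2 p.1) :=
  {τ | ∀ (x : p.1.submodule) (w : V), τ x = Submodule.Quotient.mk w → C.dF x w = 0}

/-- A local holomorphic frame at the point `p` of a family `L` of subspaces `L q ⊆ T_q ℙ²`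
(`q ∈ C`): `t ↦ [γ t]` is a local holomorphic parametrization (an immersion) of `C` at `p`,
and the vector of `T_[γ t] ℙ² = Hom(ℂ γ t, ℂ³ / ℂ γ t)` that sends `γ t` to the class of `v t` is a
nonzero element of `L [γ t]`, for all small `t`. -/
structure IsLocalFrame (C : SmoothPlaneCurve d) (L : ∀ q : C.Points, Submodule ℂ (TangentP2 q.1))
    (p : C.Points) (γ v : ℂ → V) : Prop where
  analytic_curve : AnalyticAt ℂ γ 0
  analytic_vector : AnalyticAt ℂ v 0
  base : γ 0 ∈ p.1.submodule
  immersed : LinearIndependent ℂ ![γ 0, deriv γ 0]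
  frame : ∀ᶠ t in 𝓝 (0 : ℂ), ∃ (q : C.Points) (h : γ t ∈ q.1.submodule) (τ : TangentP2 q.1),
    τ ∈ L q ∧ τ ⟨γ t, h⟩ = Submodule.Quotient.mk (v t) ∧ v t ∉ q.1.submodule

end SmoothPlaneCurve

/-- A holomorphic line field along `C`: a family of one-dimensional subspaces of the tangent spaces
`T_p ℙ²`, `p ∈ C`, that has a local holomorphic frame at every point of `C`. -/
structure LineField (C : SmoothPlaneCurve d) where
  /-- the line in `T_p ℙ²` -/
  line : ∀ p : C.Points, Submodule ℂ (TangentP2 p.1)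
  one_dimensional : ∀ p, ∃ τ : TangentP2 p.1, τ ≠ 0 ∧ line p = Submodule.span ℂ {τ}
  holomorphic : ∀ p, ∃ γ v : ℂ → V, C.IsLocalFrame line p γ v

/-- The plane of `ℂ³` swept out by the line `p` and the tangent vectors in `L`; its projectivization
is the projective line through `p` with direction `L`. -/
def directionPlane (p : P2) (L : Submodule ℂ (TangentP2 p)) : Submodule ℂ V :=
  (⨆ τ ∈ L, LinearMap.range τ).comap p.submodule.mkQ

open scoped Matrix in
theorem exists_dual_point (p : P2) (L : Submodule ℂ (TangentP2 p))
    (hL : ∃ τ : TangentP2 p, τ ≠ 0 ∧ L = Submodule.span ℂ {τ}) :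
    ∃ a : P2, ∀ w : V, a.rep ⬝ᵥ w = 0 ↔ w ∈ directionPlane p L := by
  obtain ⟨τ, hτ0, rfl⟩ := hL
  have hτL : τ ∈ Submodule.span ℂ {τ} := Submodule.mem_span_singleton_self _
  have hx : p.rep ∈ p.submodule := by
    rw [Projectivization.submodule_eq]; exact Submodule.mem_span_singleton_self _
  obtain ⟨w, hw⟩ := Submodule.Quotient.mk_surjective p.submodule (τ ⟨p.rep, hx⟩)
  have hmem : ∀ y : p.submodule, ∃ c : ℂ, y = c • (⟨p.rep, hx⟩ : p.submodule) := by
    rintro ⟨y, hy⟩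
    have hy' := hy
    rw [Projectivization.submodule_eq, Submodule.mem_span_singleton] at hy'
    obtain ⟨c, hc⟩ := hy'
    exact ⟨c, Subtype.ext hc.symm⟩
  have hwp : w ∉ p.submodule := by
    intro h
    apply hτ0
    have h0 : τ ⟨p.rep, hx⟩ = 0 := by
      rw [← hw]; exact (Submodule.Quotient.mk_eq_zero _).2 h
    refine LinearMap.ext fun y => ?_
    obtain ⟨c, rfl⟩ := hmem y
    rw [map_smul, h0, smul_zero, LinearMap.zero_apply]
  have hspan : ∀ u : V, u ∈ directionPlane p (Submodule.span ℂ {τ}) ↔ ∃ b c : ℂ, u = b • p.rep + c • w := by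
    have hsup : (⨆ σ ∈ Submodule.span ℂ {τ}, LinearMap.range σ) = Submodule.span ℂ {τ ⟨p.rep, hx⟩} := by
      apply le_antisymm
      · refine iSup₂_le fun σ hσ => ?_
        rintro _ ⟨y, rfl⟩
        obtain ⟨c, hc'⟩ := Submodule.mem_span_singleton.1 hσ
        obtain ⟨e, rfl⟩ := hmem y
        rw [← hc', Submodule.mem_span_singleton]
        exact ⟨c * e, by rw [LinearMap.smul_apply, map_smul, mul_smul]⟩
      · rw [Submodule.span_singleton_le_iff_mem]
        exact Submodule.mem_iSup_of_mem τ (Submodule.mem_iSup_of_mem hτL ⟨_, rfl⟩)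
    intro u
    rw [directionPlane, Submodule.mem_comap, hsup, Submodule.mem_span_singleton, ← hw]
    constructor
    · rintro ⟨c, hc⟩
      have hc' : Submodule.Quotient.mk (p := p.submodule) (c • w) = Submodule.Quotient.mk u := hc
      rw [eq_comm, Submodule.Quotient.eq] at hc'
      obtain ⟨b, hb⟩ := hmem ⟨_, hc'⟩
      have hb' : u - c • w = b • p.rep := congrArg Subtype.val hb
      exact ⟨b, c, by rw [← hb']; simp⟩
    · rintro ⟨b, c, rfl⟩
      refine ⟨c, ?_⟩
      change Submodule.Quotient.mk (p := p.submodule) (c • w) = Submodule.Quotient.mk _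
      rw [eq_comm, Submodule.Quotient.eq]
      simpa using p.submodule.smul_mem b hx
  have hli : LinearIndependent ℂ ![p.rep, w] := by
    rw [LinearIndependent.pair_iff' p.rep_nonzero]
    rintro c rfl
    exact hwp (p.submodule.smul_mem c hx)
  have ha : p.rep ⨯₃ w ≠ 0 := crossProduct_ne_zero_iff_linearIndependent.2 hli
  refine ⟨Projectivization.mk ℂ _ ha, fun u => ?_⟩
  obtain ⟨k, hk⟩ := Projectivization.exists_smul_eq_mk_rep ℂ _ ha
  have h1 : (Projectivization.mk ℂ _ ha).rep ⬝ᵥ u = 0 ↔ u ⬝ᵥ p.rep ⨯₃ w = 0 := by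
    rw [← hk, dotProduct_comm]
    change u ⬝ᵥ ((k : ℂ) • _) = 0 ↔ _
    rw [dotProduct_smul, smul_eq_mul, mul_eq_zero, or_iff_right k.ne_zero]
  rw [h1, triple_product_eq_det, hspan]
  have h2 : (∃ b c : ℂ, u = b • p.rep + c • w) ↔ u ∈ Submodule.span ℂ (Set.range ![p.rep, w]) := by
    have : Set.range ![p.rep, w] = {p.rep, w} := by simp [Set.pair_comm]
    rw [this, Submodule.mem_span_pair]
    simp only [eq_comm]
  have h3 := linearIndependent_finCons (K := ℂ) (x := u) (v := (![p.rep, w] : Fin 2 → V))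
  have h4 : LinearIndependent ℂ (![u, p.rep, w] : Fin 3 → V) ↔
      (Matrix.det ![u, p.rep, w]) ≠ 0 := by
    have h := Matrix.linearIndependent_rows_iff_isUnit (A := Matrix.of ![u, p.rep, w])
    rw [Matrix.isUnit_iff_isUnit_det, isUnit_iff_ne_zero] at h
    exact h
  rw [h2]
  have h5 : (Matrix.det ![u, p.rep, w]) ≠ 0 ↔
      u ∉ Submodule.span ℂ (Set.range ![p.rep, w]) :=
    h4.symm.trans (h3.trans ⟨fun h => h.2, fun h => ⟨hli, h⟩⟩)
  exact not_iff_not.1 h5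

namespace LineField

variable {C : SmoothPlaneCurve d}

/-- The map `φ_X` from `C` to the dual plane: `φ_X p` is the projective line through `p` with
direction `X p`. -/
def gaussMap (X : LineField C) (p : C.Points) : P2 :=
  (exists_dual_point p.1 (X.line p) (X.one_dimensional p)).choose

/-- The image of `φ_X`. -/
def dualCurve (X : LineField C) : Set P2 := Set.range X.gaussMap

/-- The order of tangency of `X` and `C` at `p`: the order of the zero at `p` of the morphism
`X → NC = Tℙ²|_C / TC`. Since `dF` is onto on `Tℙ²|_C` with kernel `TC`, it trivializes `NC`
locally, and the morphism is `t ↦ dF (γ t) (v t)` in a local frame; the order is the same for all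
frames at `p`. -/
def tangOrder (X : LineField C) (p : C.Points) : ℕ∞ :=
  ⨅ (γ : ℂ → V) (v : ℂ → V) (_ : C.IsLocalFrame X.line p γ v),
    analyticOrderAt (fun t => C.dF (γ t) (v t)) 0

/-- The total order of tangency of `X` with `C`. -/
def tang (X : LineField C) : ℕ∞ := ∑ᶠ p : C.Points, X.tangOrder p

end LineField

end PlaneCurves

end

/-! ### Local structure of a function of one variable near a zero. -/

section

open scoped Topology
open Filter Set

/-! A point `p` of `C` with its direction `X p` is encoded by a pair `(x, v)` of vectors: `x` spans
the line `p` in `ℂ³`, and the tangent vector sends `x` to the class of `v`. The pair is unique up to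
`(c x, c' v + c'' x)`, and `φ_X p` is the point `[x × v]` of the dual plane. A function `Ψ (x, v)`
that is homogeneous of bidegree `(i, j)` and does not see `v ↦ v + c'' x` is a section of a line
bundle on `C` (`IsSection`). The quotient of two sections of the same bidegree is a meromorphic
function on a compact Riemann surface, so both have equally many zeros (`LineField.secDeg_eq`, from
`RiemannAtlas.finsum_ord_eq_zero`).

Three sections give the formula. The tangency section `dF x v` has bidegree `(d - 1, 1)` and `tang
(X, C)` zeros. A linear form `x · w` has bidegree `(1, 0)` and `d` zeros, as a transversal line
shows. The form `(x × v) · u` has bidegree `(1, 1)`; let `m` be the number of its zeros. Both `dF ·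
(x · w)²` and `(x · w)^d · ((x × v) · u)` have bidegree `(d + 1, 1)`, hence `tang + 2d = d² + m`
(`HasDualDegree.secDeg_dF`). Finally `m = l · deg X̌` (`HasDualDegree.eq_mul`): a general line of
the dual plane meets the dual curve in `deg X̌` points, each with `l` preimages, and the
corresponding zeros are simple.

Zeros and poles of a meromorphic function `f` balance because the number of solutions of `f = s` is
locally constant in `s`, hence constant on `ℂ`; the same holds for `1/f`, and the two numbers agree
at `s = 1`.

A section must not vanish identically on a part of `C` only, so `C` has to be connected. This, like
the algebraicity of `X̌`, comes from interpolation (`exists_form_through`): about `n e` points can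
be put on a curve of degree `n + e` not containing a given curve of degree `e`, while zero counts
bound the number of such points. For large `n` the two collide. In the dual plane the same collision
gives a form `G` vanishing on `X̌`, and for an irreducible `G` of degree `e` shows that only
finitely many fibres of `φ_X` have more than `m / e` points. On a general line the fibres over the
`e` zeros of `G` have `m` points altogether, so each has exactly `m / e`. Hence general zeros of `G`
lie on `X̌`, and all others do because `X̌` is closed. -/

theorem Complex.ncard_setOf_pow_eq {k : ℕ} (hk : 0 < k) {s : ℂ} (hs : s ≠ 0) :
    {z : ℂ | z ^ k = s}.ncard = k := by
  have hζ := Complex.isPrimitiveRoot_exp k hk.ne'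
  obtain ⟨α, hα⟩ := IsAlgClosed.exists_pow_nat_eq s hk
  have h1 : {z : ℂ | z ^ k = s} = ((Polynomial.nthRoots k s).toFinset : Set ℂ) := by
    ext z
    simp [Polynomial.mem_nthRoots hk]
  rw [h1, Set.ncard_coe_finset, Multiset.toFinset_card_of_nodup (hζ.nthRoots_nodup hs),
    hζ.card_nthRoots, if_pos ⟨α, hα⟩]

/-- A function with a zero of order `k` is locally the `k`-th power of a local coordinate. -/
theorem exists_pow_local_coordinate {f : ℂ → ℂ} {k : ℕ} (hk : 0 < k)
    (hf : MeromorphicAt f 0) (hord : meromorphicOrderAt f 0 = (k : ℤ)) :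
    ∃ w : ℂ → ℂ, AnalyticAt ℂ w 0 ∧ w 0 = 0 ∧ deriv w 0 ≠ 0 ∧ ∀ᶠ t in 𝓝[≠] 0, f t = w t ^ k := by
  obtain ⟨u, hu, hu0, hfu⟩ := (meromorphicOrderAt_eq_int_iff hf).1 hord
  obtain ⟨c, hc⟩ := IsAlgClosed.exists_pow_nat_eq (u 0) hk
  have hc0 : c ≠ 0 := by
    rintro rfl
    rw [zero_pow hk.ne'] at hc
    exact hu0 hc.symm
  -- A holomorphic `k`-th root of `u`: division by `u 0` brings the argument of the power near `1`,
  -- away from the branch cut.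
  let v : ℂ → ℂ := fun t => c * (u t / u 0) ^ ((k : ℂ)⁻¹)
  have hv : AnalyticAt ℂ v 0 := by
    refine analyticAt_const.mul ((hu.div_const).cpow analyticAt_const ?_)
    simp [hu0]
  have hv0 : v 0 = c := by simp [v, div_self hu0]
  have hvk : ∀ t, v t ^ k = u t := fun t => by
    simp only [v]
    rw [mul_pow, Complex.cpow_nat_inv_pow _ hk.ne', hc]
    field_simp
  refine ⟨fun t => t * v t, analyticAt_id.mul hv, by simp, ?_, ?_⟩
  · have h : HasDerivAt (fun t => t * v t) (1 * v 0 + 0 * deriv v 0) 0 :=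
      (hasDerivAt_id 0).mul hv.differentiableAt.hasDerivAt
    rw [h.deriv, hv0]
    simpa using hc0
  · filter_upwards [hfu] with t ht
    rw [ht, mul_pow, hvk]
    simp

/-- Near a zero of order `k` of `f`, every small nonzero value is taken exactly `k` times, each time
with multiplicity one. -/
theorem exists_nhds_ncard_fiber {f : ℂ → ℂ} {k : ℕ} (hk : 0 < k)
    (hf : MeromorphicAt f 0) (hord : meromorphicOrderAt f 0 = (k : ℤ)) {W : Set ℂ}
    (hW : W ∈ 𝓝 0) :
    ∃ U ∈ 𝓝 (0 : ℂ), U ⊆ W ∧ ∀ᶠ s in 𝓝[≠] (0 : ℂ),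
      {t ∈ U | 0 < meromorphicOrderAt (fun z => f z - s) t}.ncard = k ∧
      ∀ t ∈ U, 0 < meromorphicOrderAt (fun z => f z - s) t →
        meromorphicOrderAt (fun z => f z - s) t = 1 := by
  obtain ⟨w, hw, hw0, hw1, hfw⟩ := exists_pow_local_coordinate hk hf hord
  have hsd : HasStrictDerivAt w (deriv w 0) 0 := hw.hasStrictDerivAt
  have hsd' := hsd.hasStrictFDerivAt_equiv hw1
  set e := hsd'.toOpenPartialHomeomorph w
  have he : ∀ t, e t = w t := fun t => rfl
  have h0s : (0 : ℂ) ∈ e.source := hsd'.mem_toOpenPartialHomeomorph_source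
  have h0t : (0 : ℂ) ∈ e.target := by
    have := e.map_source h0s
    rwa [he, hw0] at this
  have hes0 : e.symm 0 = 0 := by
    have := e.left_inv h0s
    rwa [he, hw0] at this
  have hd : ∀ᶠ t in 𝓝 (0 : ℂ), deriv w t ≠ 0 :=
    hw.deriv.continuousAt.eventually_ne hw1
  -- The value of `f` at `0` may be arbitrary. Punctured neighbourhoods suffice, as meromorphic
  -- orders do not see the value at the point.
  have hfw' : ∀ᶠ t in 𝓝 (0 : ℂ), ∀ᶠ z in 𝓝[≠] t, f z = w z ^ k := by
    rw [eventually_nhdsWithin_iff] at hfw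
    filter_upwards [hfw.eventually_nhds] with t ht
    rcases eq_or_ne t 0 with rfl | h0
    · exact eventually_nhdsWithin_iff.2 ht
    · have : ∀ᶠ z in 𝓝 t, z ≠ 0 := eventually_ne_nhds h0
      filter_upwards [(ht.and this).filter_mono nhdsWithin_le_nhds] with z hz
      exact hz.1 hz.2
  have hA : ∀ᶠ t in 𝓝 (0 : ℂ), t ∈ W ∧ deriv w t ≠ 0 ∧ AnalyticAt ℂ w t ∧
      ∀ᶠ z in 𝓝[≠] t, f z = w z ^ k := by
    filter_upwards [hW, hd, hw.eventually_analyticAt, hfw'] with t h1 h2 h3 h4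
    exact ⟨h1, h2, h3, h4⟩
  have hB : ∀ᶠ z in 𝓝 (0 : ℂ), z ∈ e.target ∧ (e.symm z ∈ W ∧ deriv w (e.symm z) ≠ 0 ∧
      AnalyticAt ℂ w (e.symm z) ∧ ∀ᶠ y in 𝓝[≠] (e.symm z), f y = w y ^ k) := by
    refine Filter.Eventually.and (e.open_target.mem_nhds h0t) ?_
    have hc : Tendsto e.symm (𝓝 0) (𝓝 0) := by
      have := e.continuousAt_symm h0t
      rwa [ContinuousAt, hes0] at this
    exact hc.eventually hA
  obtain ⟨r, hr, hrB⟩ := Metric.eventually_nhds_iff_ball.1 hB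
  have hwsymm : ∀ z ∈ Metric.ball (0 : ℂ) r, w (e.symm z) = z := fun z hz =>
    e.right_inv (hrB z hz).1
  -- The neighbourhood is a disc of radius `r` in the coordinate `w`; all `k` roots of `z ^ k = s`
  -- lie in it as soon as `‖s‖ < r ^ k`.
  refine ⟨e.symm '' Metric.ball 0 r, ?_, ?_, ?_⟩
  · have := (e.symm.image_mem_nhds (x := 0) h0t (Metric.ball_mem_nhds 0 hr))
    rwa [hes0] at this
  · rintro _ ⟨z, hz, rfl⟩
    exact (hrB z hz).2.1
  have hordt : ∀ s, ∀ z ∈ Metric.ball (0 : ℂ) r,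
      meromorphicOrderAt (fun y => f y - s) (e.symm z) =
        (analyticOrderAt (fun y => w y ^ k - s) (e.symm z)).map (fun n : ℕ => (n : ℤ)) := by
    intro s z hz
    obtain ⟨-, -, -, h3, h4⟩ := hrB z hz
    rw [← AnalyticAt.meromorphicOrderAt_eq (f := fun y => w y ^ k - s) (by fun_prop)]
    apply meromorphicOrderAt_congr
    filter_upwards [h4] with y hy
    rw [hy]
  have hone : ∀ s ≠ (0 : ℂ), ∀ z ∈ Metric.ball (0 : ℂ) r, z ^ k = s →
      meromorphicOrderAt (fun y => f y - s) (e.symm z) = 1 := by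
    intro s hs z hz hzs
    obtain ⟨-, -, h2, h3, h4⟩ := hrB z hz
    have hz0 : z ≠ 0 := by
      rintro rfl
      exact hs (by rw [← hzs, zero_pow hk.ne'])
    rw [hordt s z hz, AnalyticAt.analyticOrderAt_eq_one_of_zero_deriv_ne_zero]
    · rfl
    · exact (h3.pow k).sub analyticAt_const
    · simp [hwsymm z hz, hzs]
    · have h := ((h3.differentiableAt.hasDerivAt.pow k).sub_const s).deriv
      change deriv (fun y => w y ^ k - s) _ ≠ 0
      have h' : deriv (fun y => w y ^ k - s) (e.symm z) =
        k * w (e.symm z) ^ (k - 1) * deriv w (e.symm z) := h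
      rw [h', hwsymm z hz]
      exact mul_ne_zero (mul_ne_zero (by exact_mod_cast hk.ne') (pow_ne_zero _ hz0)) h2
  have hpos : ∀ s, ∀ z ∈ Metric.ball (0 : ℂ) r,
      0 < meromorphicOrderAt (fun y => f y - s) (e.symm z) → z ^ k = s := by
    intro s z hz h
    by_contra hne
    obtain ⟨-, -, h2, h3, h4⟩ := hrB z hz
    rw [hordt s z hz, AnalyticAt.analyticOrderAt_eq_zero (f := fun y => w y ^ k - s) (by fun_prop) |>.2] at h
    · exact lt_irrefl _ h
    · simpa [hwsymm z hz, sub_eq_zero] using hne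
  have hsm : ∀ᶠ s in 𝓝[≠] (0 : ℂ), s ≠ 0 ∧ ‖s‖ < r ^ k := by
    refine eventually_mem_nhdsWithin.and (nhdsWithin_le_nhds ?_)
    have := Metric.ball_mem_nhds (0 : ℂ) (pow_pos hr k)
    filter_upwards [this] with s hs
    simpa using hs
  filter_upwards [hsm] with s hs
  constructor
  · have : {t ∈ e.symm '' Metric.ball 0 r | 0 < meromorphicOrderAt (fun z => f z - s) t} =
        e.symm '' {z | z ^ k = s} := by
      ext t
      constructor
      · rintro ⟨⟨z, hz, rfl⟩, ht⟩
        exact ⟨z, hpos s z hz ht, rfl⟩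
      · rintro ⟨z, hz, rfl⟩
        have hzr : z ∈ Metric.ball (0 : ℂ) r := by
          rw [mem_ball_zero_iff]
          refine lt_of_pow_lt_pow_left₀ k hr.le ?_
          rw [← norm_pow, hz]
          exact hs.2
        exact ⟨⟨z, hzr, rfl⟩, by rw [hone s hs.1 z hzr hz]; exact zero_lt_one⟩
    rw [this, Set.InjOn.ncard_image, Complex.ncard_setOf_pow_eq hk hs.1]
    intro z hz z' hz' h
    have hin : ∀ z, z ^ k = s → z ∈ Metric.ball (0 : ℂ) r := fun z hz => by
      rw [mem_ball_zero_iff]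
      refine lt_of_pow_lt_pow_left₀ k hr.le ?_
      rw [← norm_pow, hz]
      exact hs.2
    rw [← hwsymm z (hin z hz), h, hwsymm z' (hin z' hz')]
  · rintro _ ⟨z, hz, rfl⟩ ht
    exact hone s hs.1 z hz (hpos s z hz ht)

end

/-! ### Riemann surfaces given by local parametrizations; orders of meromorphic functions. -/

section

open scoped Topology
open Filter Set

/-- Away from a point near which it is not constant, a meromorphic function takes all its values with
multiplicity one. -/
theorem MeromorphicAt.eventually_order_sub_le_one {g : ℂ → ℂ} (hg : MeromorphicAt g 0)
    (h : ∀ c, meromorphicOrderAt (fun z => g z - c) 0 ≠ ⊤) :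
    ∀ᶠ t in 𝓝[≠] (0 : ℂ), ∀ c, meromorphicOrderAt (fun z => g z - c) t ≤ 1 := by
  have hd : meromorphicOrderAt (deriv g) 0 ≠ ⊤ := by
    -- Subtracting a constant does not change the derivative, and a finite order `n ≠ 0` of `g - c`
    -- gives order `n - 1` for the derivative. At a pole `c = 0` works, otherwise the limit of `g`.
    have key : ∀ c, meromorphicOrderAt (fun z => g z - c) 0 ≠ 0 →
        meromorphicOrderAt (deriv g) 0 ≠ ⊤ := by
      intro c hc
      obtain ⟨n, hn⟩ := WithTop.ne_top_iff_exists.1 (h c)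
      have hn0 : n ≠ 0 := by
        rintro rfl
        exact hc hn.symm
      have h1 := meromorphicOrderAt_deriv_eq_sub_one (n := n) (by exact_mod_cast hn0) hn.symm
      have h2 : deriv (fun z => g z - c) = deriv g := by
        ext z
        exact deriv_sub_const c
      rw [h2] at h1
      rw [h1]
      exact WithTop.coe_ne_top
    by_cases h0 : meromorphicOrderAt g 0 < 0
    · apply key 0
      simpa using h0.ne
    · obtain ⟨c, hc⟩ := tendsto_nhds_of_meromorphicOrderAt_nonneg hg (not_lt.1 h0)
      apply key c
      have hm : MeromorphicAt (fun z => g z - c) 0 := hg.sub (.const c 0)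
      refine ((tendsto_zero_iff_meromorphicOrderAt_pos hm).1 ?_).ne'
      simpa using hc.sub_const c
  have h1 := (meromorphicOrderAt_ne_top_iff_eventually_ne_zero hg.deriv).1 hd
  filter_upwards [h1, hg.eventually_analyticAt] with t ht hat c
  have han : AnalyticAt ℂ (fun z => g z - c) t := by fun_prop
  rw [han.meromorphicOrderAt_eq]
  by_cases hc : g t = c
  · rw [AnalyticAt.analyticOrderAt_eq_one_of_zero_deriv_ne_zero han (by simp [hc])]
    · exact le_rfl
    · rwa [deriv_sub_const]
  · rw [han.analyticOrderAt_eq_zero.2 (by simpa [sub_eq_zero] using hc)]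
    exact zero_le_one

/-- This is the identity `1/g - s = -s (g - 1/s) / g`. -/
theorem meromorphicOrderAt_inv_sub {g : ℂ → ℂ} {x : ℂ} (hg : MeromorphicAt g x)
    (h : meromorphicOrderAt g x ≠ ⊤) {s : ℂ} (hs : s ≠ 0) :
    meromorphicOrderAt (fun z => (g z)⁻¹ - s) x =
      meromorphicOrderAt (fun z => g z - s⁻¹) x - meromorphicOrderAt g x := by
  have h1 : (fun z => (g z)⁻¹ - s) =ᶠ[𝓝[≠] x] (fun _ => -s) * ((fun z => g z - s⁻¹) / g) := by
    filter_upwards [(meromorphicOrderAt_ne_top_iff_eventually_ne_zero hg).1 h] with z hz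
    simp only [Pi.mul_apply, Pi.div_apply]
    field_simp
    ring
  rw [meromorphicOrderAt_congr h1, meromorphicOrderAt_mul_of_ne_zero analyticAt_const
    (neg_ne_zero.2 hs), meromorphicOrderAt_div (by fun_prop) hg]

theorem meromorphicOrderAt_sub_const_of_neg {g : ℂ → ℂ} {x c : ℂ}
    (h : meromorphicOrderAt g x < 0) :
    meromorphicOrderAt (fun z => g z - c) x = meromorphicOrderAt g x := by
  have h1 : (fun z => g z - c) = g + fun _ => -c := by
    ext z
    simp [sub_eq_add_neg]
  have h2 : 0 ≤ meromorphicOrderAt (fun _ : ℂ => -c) x :=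
    analyticAt_const.meromorphicOrderAt_nonneg
  rw [h1, meromorphicOrderAt_add_eq_left_of_lt (.const _ _) (h.trans_le h2)]

theorem meromorphicOrderAt_sub_const_of_pos {g : ℂ → ℂ} {x c : ℂ} (hc : c ≠ 0)
    (h : 0 < meromorphicOrderAt g x) :
    meromorphicOrderAt (fun z => g z - c) x = 0 := by
  have hg : MeromorphicAt g x := meromorphicAt_of_meromorphicOrderAt_ne_zero h.ne'
  refine (tendsto_ne_zero_iff_meromorphicOrderAt_eq_zero (f := fun z => g z - c) (by fun_prop)).1
    ⟨-c, neg_ne_zero.2 hc, ?_⟩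
  simpa using (tendsto_zero_of_meromorphicOrderAt_pos h).sub_const c

/-- `1/g` takes the value `s ≠ 0` with the multiplicity with which `g` takes the value `1/s`. -/
theorem toNat_meromorphicOrderAt_inv_sub {g : ℂ → ℂ} {x : ℂ} (hg : MeromorphicAt g x)
    (h : meromorphicOrderAt g x ≠ ⊤) {s : ℂ} (hs : s ≠ 0) :
    (meromorphicOrderAt (fun z => (g z)⁻¹ - s) x).untop₀.toNat =
      (meromorphicOrderAt (fun z => g z - s⁻¹) x).untop₀.toNat := by
  rw [meromorphicOrderAt_inv_sub hg h hs]
  -- At a pole of `g` the two orders are `0` and negative, at a zero they are negative and `0`.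
  -- `toNat` sends all of them to `0`.
  rcases lt_trichotomy (meromorphicOrderAt g x) 0 with h0 | h0 | h0
  · rw [meromorphicOrderAt_sub_const_of_neg h0]
    lift meromorphicOrderAt g x to ℤ using h with n
    have : n < 0 := by exact_mod_cast h0
    rw [← WithTop.LinearOrderedAddCommGroup.coe_sub]
    simp [Int.toNat_of_nonpos this.le]
  · rw [h0]
    simp
  · rw [meromorphicOrderAt_sub_const_of_pos (inv_ne_zero hs) h0]
    lift meromorphicOrderAt g x to ℤ using h with n
    have : 0 < n := by exact_mod_cast h0
    change ((0 : ℤ) - (n : WithTop ℤ) : WithTop ℤ).untop₀.toNat = _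
    rw [← WithTop.coe_zero, ← WithTop.LinearOrderedAddCommGroup.coe_sub]
    simp [this.le]

/-- By compactness an infinite set would have an accumulation point. All finiteness statements about
zeros and ramification rest on this. -/
theorem Set.Finite.of_eventually_notMem {S : Type*} [TopologicalSpace S] [CompactSpace S] {A : Set S}
    (h : ∀ p, ∀ᶠ q in 𝓝[≠] p, q ∉ A) : A.Finite := by
  by_contra hA
  obtain ⟨p, hp⟩ := Set.Infinite.exists_accPt_principal hA
  rw [accPt_iff_frequently_nhdsNE] at hp
  exact hp (h p)

/-- A system of local holomorphic parametrizations of a Riemann surface, one at each point. -/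
structure RiemannAtlas (S : Type*) [TopologicalSpace S] where
  /-- the local parametrization at a point -/
  param : S → ℂ → S
  param_zero : ∀ p, param p 0 = p
  map_nhds : ∀ p, map (param p) (𝓝 0) = 𝓝 p
  injOn : ∀ p, ∃ U ∈ 𝓝 (0 : ℂ), InjOn (param p) U
  transition : ∀ p, ∀ᶠ t in 𝓝 (0 : ℂ), ∃ ψ : ℂ → ℂ, AnalyticAt ℂ ψ 0 ∧ ψ 0 = t ∧ deriv ψ 0 ≠ 0 ∧
    param (param p t) =ᶠ[𝓝 0] param p ∘ ψ

namespace RiemannAtlas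

variable {S : Type*} [TopologicalSpace S] (A : RiemannAtlas S)

/-- Meromorphic functions; the values at the poles are arbitrary. -/
def IsMero (f : S → ℂ) : Prop := ∀ p, MeromorphicAt (f ∘ A.param p) 0

/-- The order of a meromorphic function at a point. -/
noncomputable def ord (f : S → ℂ) (p : S) : WithTop ℤ := meromorphicOrderAt (f ∘ A.param p) 0

/-- The multiplicity of a point as a zero. -/
noncomputable def mult (f : S → ℂ) (p : S) : ℕ := (A.ord f p).untop₀.toNat

variable {A}

theorem IsMero.sub_const {f : S → ℂ} (hf : A.IsMero f) (c : ℂ) : A.IsMero (fun p => f p - c) :=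
  fun p => (hf p).sub (.const c 0)

theorem IsMero.inv {f : S → ℂ} (hf : A.IsMero f) : A.IsMero (fun p => (f p)⁻¹) :=
  fun p => (hf p).inv

theorem eventually_nhdsNE {p : S} {P : S → Prop} (h : ∀ᶠ t in 𝓝[≠] (0 : ℂ), P (A.param p t)) :
    ∀ᶠ q in 𝓝[≠] p, P q := by
  rw [eventually_nhdsWithin_iff] at h ⊢
  rw [← A.map_nhds p, eventually_map]
  filter_upwards [h] with t ht hne
  refine ht fun h0 => hne ?_
  rw [show t = 0 from h0]
  exact A.param_zero p

/-- Transition maps have nonzero derivative and therefore preserve orders, so one parametrization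
computes the orders at all nearby points, for all functions simultaneously. -/
theorem eventually_ord_param (p : S) : ∀ᶠ t in 𝓝 (0 : ℂ), ∀ f : S → ℂ,
    A.ord f (A.param p t) = meromorphicOrderAt (f ∘ A.param p) t := by
  filter_upwards [A.transition p] with t ⟨ψ, h1, h2, h3, h4⟩ f
  have h5 : f ∘ A.param (A.param p t) =ᶠ[𝓝[≠] 0] (f ∘ A.param p) ∘ ψ :=
    (h4.fun_comp f).filter_mono nhdsWithin_le_nhds
  rw [ord, meromorphicOrderAt_congr h5, meromorphicOrderAt_comp_of_deriv_ne_zero h1 h3, h2]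

theorem eventually_ord_eq_zero {f : S → ℂ} {p : S} (hf : A.IsMero f) (h : A.ord f p ≠ ⊤) :
    ∀ᶠ q in 𝓝[≠] p, A.ord f q = 0 := by
  apply A.eventually_nhdsNE
  filter_upwards [(A.eventually_ord_param p).filter_mono nhdsWithin_le_nhds,
    (meromorphicOrderAt_ne_top_iff_eventually_ne_zero (hf p)).1 h,
    (hf p).eventually_analyticAt] with t h1 h2 h3
  rw [h1, h3.meromorphicOrderAt_eq, h3.analyticOrderAt_eq_zero.2 h2]
  rfl

theorem eventually_ord_eq_top {f : S → ℂ} {p : S} (h : A.ord f p = ⊤) :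
    ∀ᶠ q in 𝓝 p, A.ord f q = ⊤ := by
  rw [← A.map_nhds p, eventually_map]
  have h0 := meromorphicOrderAt_eq_top_iff.1 h
  rw [eventually_nhdsWithin_iff] at h0
  filter_upwards [A.eventually_ord_param p, h0.eventually_nhds] with t h1 h2
  rw [h1, meromorphicOrderAt_eq_top_iff]
  rcases eq_or_ne t 0 with rfl | ht
  · exact eventually_nhdsWithin_iff.2 h2
  · filter_upwards [(h2.and (eventually_ne_nhds ht)).filter_mono nhdsWithin_le_nhds] with z hz
    exact hz.1 hz.2

theorem eventually_ord_sub_le_one {f : S → ℂ} {p : S} (hf : A.IsMero f)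
    (h : ∀ c, A.ord (fun q => f q - c) p ≠ ⊤) :
    ∀ᶠ q in 𝓝[≠] p, ∀ c, A.ord (fun q => f q - c) q ≤ 1 := by
  apply A.eventually_nhdsNE
  filter_upwards [(A.eventually_ord_param p).filter_mono nhdsWithin_le_nhds,
    (hf p).eventually_order_sub_le_one h] with t h1 h2 c
  rw [h1]
  exact h2 c

/-- The identity principle: where the order is finite, it is `0` on a punctured neighbourhood. -/
theorem isClopen_ord_eq_top {f : S → ℂ} (hf : A.IsMero f) : IsClopen {p | A.ord f p = ⊤} := by
  constructor
  · rw [← isOpen_compl_iff, isOpen_iff_mem_nhds]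
    intro p hp
    have := eventually_nhdsWithin_iff.1 (A.eventually_ord_eq_zero hf hp)
    filter_upwards [this] with q hq
    rcases eq_or_ne q p with rfl | h
    · exact hp
    · simp [hq h]
  · rw [isOpen_iff_mem_nhds]
    exact fun p hp => A.eventually_ord_eq_top hp

/-- The set of points near which a meromorphic function is constant is open and closed. -/
theorem isClopen_locally_const {f : S → ℂ} (hf : A.IsMero f) :
    IsClopen {p | ∃ c, A.ord (fun q => f q - c) p = ⊤} := by
  constructor
  · rw [← isOpen_compl_iff, isOpen_iff_mem_nhds]
    intro p hp
    have hp' : ∀ c, A.ord (fun q => f q - c) p ≠ ⊤ := fun c hc => hp ⟨c, hc⟩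
    have := eventually_nhdsWithin_iff.1 (A.eventually_ord_sub_le_one hf hp')
    filter_upwards [this] with q hq
    rcases eq_or_ne q p with rfl | h
    · exact hp
    · rintro ⟨c, hc⟩
      have := hq h c
      rw [hc] at this
      exact absurd this (by decide)
  · have : {p | ∃ c, A.ord (fun q => f q - c) p = ⊤} =
        ⋃ c, {p | A.ord (fun q => f q - c) p = ⊤} := by
      ext
      simp
    rw [this]
    exact isOpen_iUnion fun c => (A.isClopen_ord_eq_top (hf.sub_const c)).2

theorem finite_ord_ne_zero [CompactSpace S] {f : S → ℂ} (hf : A.IsMero f) {Z : Set S}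
    (hZ : IsClopen Z) (h : ∀ p ∈ Z, A.ord f p ≠ ⊤) : {p ∈ Z | A.ord f p ≠ 0}.Finite := by
  apply Set.Finite.of_eventually_notMem
  intro p
  by_cases hp : p ∈ Z
  · filter_upwards [A.eventually_ord_eq_zero hf (h p hp)] with q hq hq'
    exact hq'.2 hq
  · filter_upwards [nhdsWithin_le_nhds (hZ.compl.2.mem_nhds hp)] with q hq hq'
    exact hq hq'.1

theorem finite_ramification [CompactSpace S] {f : S → ℂ} (hf : A.IsMero f)
    (h : ∀ p, ∀ c, A.ord (fun q => f q - c) p ≠ ⊤) :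
    {p | ∃ c, ¬ A.ord (fun q => f q - c) p ≤ 1}.Finite := by
  apply Set.Finite.of_eventually_notMem
  intro p
  filter_upwards [A.eventually_ord_sub_le_one hf (h p)] with q hq
  rintro ⟨c, hc⟩
  exact hc (hq c)

theorem ord_pos_iff_mult_pos {f : S → ℂ} {p : S} (h : A.ord f p ≠ ⊤) :
    0 < A.ord f p ↔ 0 < A.mult f p := by
  rw [mult]
  lift A.ord f p to ℤ using h with n
  simp

end RiemannAtlas

end

/-! ### A meromorphic function on a compact Riemann surface has as many zeros as poles. -/

section

open scoped Topology
open Filter Set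

namespace RiemannAtlas

variable {S : Type*} [TopologicalSpace S] {A : RiemannAtlas S}

theorem exists_nhds_fiber {f : S → ℂ} {p : S} (hf : A.IsMero f) (h : A.ord f p ≠ ⊤)
    (hpos : 0 < A.ord f p) {W : Set S} (hW : W ∈ 𝓝 p) :
    ∃ U ∈ 𝓝 p, U ⊆ W ∧ ∀ᶠ s in 𝓝[≠] (0 : ℂ),
      {q ∈ U | 0 < A.ord (fun q => f q - s) q}.ncard = A.mult f p ∧
      ∀ q ∈ U, 0 < A.ord (fun q => f q - s) q → A.ord (fun q => f q - s) q = 1 := by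
  have hk : 0 < A.mult f p := (A.ord_pos_iff_mult_pos h).1 hpos
  have hord : meromorphicOrderAt (f ∘ A.param p) 0 = ((A.mult f p : ℕ) : ℤ) := by
    change A.ord f p = _
    rw [mult] at hk ⊢
    lift A.ord f p to ℤ using h with n
    have : 0 < n := by exact_mod_cast hpos
    simp [this.le]
  obtain ⟨V, hV, hinj⟩ := A.injOn p
  have hW' : ∀ᶠ t in 𝓝 (0 : ℂ), A.param p t ∈ W := by
    rw [← A.map_nhds p] at hW
    exact hW
  obtain ⟨U, hU, hUW, hs⟩ := exists_nhds_ncard_fiber hk (hf p) hord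
    (inter_mem hV (inter_mem hW' (A.eventually_ord_param p)))
  refine ⟨A.param p '' U, ?_, ?_, ?_⟩
  · rw [← A.map_nhds p]
    exact image_mem_map hU
  · rintro _ ⟨t, ht, rfl⟩
    exact (hUW ht).2.1
  · filter_upwards [hs] with s hs
    have heq : ∀ t ∈ U, A.ord (fun q => f q - s) (A.param p t) =
        meromorphicOrderAt (fun z => (f ∘ A.param p) z - s) t := fun t ht => (hUW ht).2.2 _
    constructor
    · rw [← hs.1, ← (hinj.mono fun t ht => (hUW ht.1).1).ncard_image]
      congr 1
      ext q
      constructor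
      · rintro ⟨⟨t, ht, rfl⟩, hq⟩
        exact ⟨t, ⟨ht, by rwa [← heq t ht]⟩, rfl⟩
      · rintro ⟨t, ⟨ht, hq⟩, rfl⟩
        exact ⟨⟨t, ht, rfl⟩, by rwa [heq t ht]⟩
    · rintro _ ⟨t, ht, rfl⟩ hq
      rw [heq t ht] at hq ⊢
      exact hs.2 t ht hq

/-- Where `f` has no zero, in particular at a pole, `|f|` is bounded below by some `δ > 0` on a
punctured neighbourhood, so no value `s` with `|s| < δ` is taken nearby. Stated jointly in `s` and
the point, to be used on a compact set. -/
theorem eventually_not_ord_sub_pos {f : S → ℂ} {p : S} (hf : A.IsMero f)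
    (hpos : ¬ 0 < A.ord f p) :
    ∀ᶠ z : ℂ × S in 𝓝 ((0 : ℂ), p), ¬ 0 < A.ord (fun q => f q - z.1) z.2 := by
  obtain ⟨δ, hδ, hb⟩ : ∃ δ > 0, ∀ᶠ t in 𝓝[≠] (0 : ℂ), δ ≤ ‖f (A.param p t)‖ := by
    rcases (not_lt.1 hpos).lt_or_eq with h0 | h0
    · have := (tendsto_norm_cobounded_atTop.comp
        (tendsto_cobounded_of_meromorphicOrderAt_neg h0)).eventually_ge_atTop 1
      exact ⟨1, one_pos, this⟩
    · obtain ⟨c, hc, ht⟩ := tendsto_ne_zero_of_meromorphicOrderAt_eq_zero (hf p) h0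
      have hc' : ‖c‖ / 2 < ‖c‖ := half_lt_self (norm_pos_iff.2 hc)
      exact ⟨‖c‖ / 2, half_pos (norm_pos_iff.2 hc), (ht.norm.eventually_const_lt hc').mono
        fun _ h => h.le⟩
  have h1 : ∀ᶠ q in 𝓝 p, ∀ s : ℂ, ‖s‖ < δ → ¬ 0 < A.ord (fun q => f q - s) q := by
    rw [← A.map_nhds p, eventually_map]
    rw [eventually_nhdsWithin_iff] at hb
    filter_upwards [A.eventually_ord_param p, hb.eventually_nhds] with t h1 h2 s hs hlt
    rw [h1] at hlt
    have h3 := tendsto_zero_of_meromorphicOrderAt_pos hlt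
    have h4 : ∀ᶠ z in 𝓝[≠] t, δ ≤ ‖f (A.param p z)‖ := by
      rcases eq_or_ne t 0 with rfl | ht
      · exact eventually_nhdsWithin_iff.2 h2
      · filter_upwards [(h2.and (eventually_ne_nhds ht)).filter_mono nhdsWithin_le_nhds] with z hz
        exact hz.1 hz.2
    have h5 : Tendsto (fun z => ‖f (A.param p z)‖) (𝓝[≠] t) (𝓝 ‖s‖) := by
      have h6 : Tendsto (fun z => ((fun q => f q - s) ∘ A.param p) z + s) (𝓝[≠] t) (𝓝 (0 + s)) :=
        h3.add_const s
      simpa using h6.norm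
    exact absurd (ge_of_tendsto h5 h4) (not_le.2 hs)
  rw [nhds_prod_eq]
  filter_upwards [(eventually_norm_sub_lt (0 : ℂ) hδ).prod_mk h1] with z hz
  exact hz.2 _ (by simpa using hz.1)

/-- The number of zeros in `Z`, with multiplicities. -/
noncomputable def zeroCount (A : RiemannAtlas S) (Z : Set S) (f : S → ℂ) : ℕ :=
  ∑ᶠ p ∈ Z, A.mult f p

/-- A zero of multiplicity `k` splits into `k` simple solutions of `f = s` nearby, and by
compactness no solution appears elsewhere for small `s`. -/
theorem eventually_zeroCount_sub [CompactSpace S] [T2Space S] {f : S → ℂ} (hf : A.IsMero f)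
    {Z : Set S} (hZ : IsClopen Z) (h : ∀ p ∈ Z, ∀ c, A.ord (fun q => f q - c) p ≠ ⊤) :
    ∀ᶠ s in 𝓝[≠] (0 : ℂ), A.zeroCount Z (fun q => f q - s) = A.zeroCount Z f := by
  have h' : ∀ p ∈ Z, A.ord f p ≠ ⊤ := fun p hp => by simpa using h p hp 0
  set P : Set S := {p ∈ Z | 0 < A.ord f p}
  have hP : P.Finite := (A.finite_ord_ne_zero hf hZ h').subset fun p hp => ⟨hp.1, hp.2.ne'⟩
  obtain ⟨W, hW, hdisj⟩ := hP.t2_separation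
  have hloc : ∀ p : S, ∃ U : Set S, p ∈ P → U ∈ 𝓝 p ∧ U ⊆ W p ∩ Z ∧ ∀ᶠ s in 𝓝[≠] (0 : ℂ),
      {q ∈ U | 0 < A.ord (fun q => f q - s) q}.ncard = A.mult f p ∧
      ∀ q ∈ U, 0 < A.ord (fun q => f q - s) q → A.ord (fun q => f q - s) q = 1 := by
    intro p
    by_cases hp : p ∈ P
    · obtain ⟨U, h1, h2, h3⟩ := A.exists_nhds_fiber hf (h' p hp.1) hp.2
        (inter_mem ((hW p).2.mem_nhds (hW p).1) (hZ.2.mem_nhds hp.1))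
      exact ⟨U, fun _ => ⟨h1, h2, h3⟩⟩
    · exact ⟨∅, fun h => absurd h hp⟩
  choose U hU using hloc
  -- Interiors are removed because the neighbourhoods `U p` need not be open, and `K` has to be
  -- closed.
  set K : Set S := Z \ ⋃ p ∈ P, interior (U p)
  have hK : IsCompact K := by
    apply IsClosed.isCompact
    exact hZ.1.sdiff (isOpen_biUnion fun p _ => isOpen_interior)
  have hKs : ∀ᶠ s in 𝓝 (0 : ℂ), ∀ q ∈ K, ¬ 0 < A.ord (fun q => f q - s) q := by
    apply hK.eventually_forall_of_forall_eventually
    intro q hq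
    refine A.eventually_not_ord_sub_pos hf fun hpos => hq.2 ?_
    have hqP : q ∈ P := ⟨hq.1, hpos⟩
    exact mem_biUnion hqP (mem_interior_iff_mem_nhds.2 (hU q hqP).1)
  have hPs : ∀ᶠ s in 𝓝[≠] (0 : ℂ), ∀ p ∈ P,
      {q ∈ U p | 0 < A.ord (fun q => f q - s) q}.ncard = A.mult f p ∧
      ∀ q ∈ U p, 0 < A.ord (fun q => f q - s) q → A.ord (fun q => f q - s) q = 1 :=
    (eventually_all_finite hP).2 fun p hp => (hU p hp).2.2
  filter_upwards [hPs, hKs.filter_mono nhdsWithin_le_nhds] with s hs hsK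
  have hset : {q ∈ Z | 0 < A.ord (fun q => f q - s) q} =
      ⋃ p ∈ P, {q ∈ U p | 0 < A.ord (fun q => f q - s) q} := by
    ext q
    simp only [mem_ofPred_eq, mem_iUnion, exists_prop]
    constructor
    · rintro ⟨hqZ, hq⟩
      by_contra hcon
      refine hsK q ⟨hqZ, fun hmem => hcon ?_⟩ hq
      obtain ⟨p, hp, hpq⟩ := mem_iUnion₂.1 hmem
      exact ⟨p, hp, interior_subset hpq, hq⟩
    · rintro ⟨p, hp, hq, hpos⟩
      exact ⟨((hU p hp).2.1 hq).2, hpos⟩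
  have h1 : A.zeroCount Z (fun q => f q - s) =
      ∑ᶠ q ∈ {q ∈ Z | 0 < A.ord (fun q => f q - s) q}, A.mult (fun q => f q - s) q := by
    refine finsum_mem_inter_support_eq _ _ _ (Set.ext fun q => ?_)
    constructor
    · rintro ⟨hq, hsup⟩
      exact ⟨⟨hq, (A.ord_pos_iff_mult_pos (h q hq s)).2 (Nat.pos_of_ne_zero hsup)⟩, hsup⟩
    · rintro ⟨hq, hsup⟩
      exact ⟨hq.1, hsup⟩
  have h2 : A.zeroCount Z f = ∑ᶠ p ∈ P, A.mult f p := by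
    refine finsum_mem_inter_support_eq _ _ _ (Set.ext fun q => ?_)
    constructor
    · rintro ⟨hq, hsup⟩
      exact ⟨⟨hq, (A.ord_pos_iff_mult_pos (h' q hq)).2 (Nat.pos_of_ne_zero hsup)⟩, hsup⟩
    · rintro ⟨hq, hsup⟩
      exact ⟨hq.1, hsup⟩
  rw [h1, h2, hset, finsum_mem_biUnion _ hP]
  · refine finsum_mem_congr rfl fun p hp => ?_
    rw [← (hs p hp).1, ← finsum_one]
    refine finsum_mem_congr rfl fun q hq => ?_
    rw [mult, (hs p hp).2 q hq.1 hq.2]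
    rfl
  · intro p hp
    refine Set.finite_of_ncard_pos ?_
    rw [(hs p hp).1]
    exact (A.ord_pos_iff_mult_pos (h' p hp.1)).1 hp.2
  · intro p hp p' hp' hne
    exact (hdisj hp hp' hne).mono (fun q hq => ((hU p hp).2.1 hq.1).1)
      (fun q hq => ((hU p' hp').2.1 hq.1).1)

/-- The number of solutions of `f = s` is locally constant in `s`, and `ℂ` is connected. -/
theorem zeroCount_sub_eq [CompactSpace S] [T2Space S] {f : S → ℂ} (hf : A.IsMero f)
    {Z : Set S} (hZ : IsClopen Z) (h : ∀ p ∈ Z, ∀ c, A.ord (fun q => f q - c) p ≠ ⊤) (s : ℂ) :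
    A.zeroCount Z (fun q => f q - s) = A.zeroCount Z f := by
  have hlc : IsLocallyConstant fun s => A.zeroCount Z (fun q => f q - s) := by
    rw [IsLocallyConstant.iff_eventually_eq]
    intro s
    have := A.eventually_zeroCount_sub (hf.sub_const s) hZ fun p hp c => by
      simpa only [sub_sub] using h p hp (s + c)
    rw [eventually_nhdsWithin_iff] at this
    have ht : Tendsto (fun y => y - s) (𝓝 s) (𝓝 0) := by
      have : Tendsto (fun y => y - s) (𝓝 s) (𝓝 (s - s)) := tendsto_id.sub_const s
      rwa [sub_self] at this
    filter_upwards [ht.eventually this] with y hy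
    rcases eq_or_ne y s with rfl | hne
    · rfl
    · rw [← hy (sub_ne_zero.2 hne)]
      congr 1
      ext q
      ring
  have := hlc.apply_eq_of_preconnectedSpace s 0
  simpa using this

/-- The zeros of `1/f` are the poles of `f`. Both counts may be moved to the value `1`, where `f =
1` and `1/f = 1` have the same solutions with the same multiplicities. -/
theorem zeroCount_inv [CompactSpace S] [T2Space S] {f : S → ℂ} (hf : A.IsMero f)
    {Z : Set S} (hZ : IsClopen Z) (h : ∀ p ∈ Z, ∀ c, A.ord (fun q => f q - c) p ≠ ⊤) :
    A.zeroCount Z (fun q => (f q)⁻¹) = A.zeroCount Z f := by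
  have h' : ∀ p ∈ Z, A.ord f p ≠ ⊤ := fun p hp => by simpa using h p hp 0
  have hinv : ∀ p ∈ Z, ∀ c, A.ord (fun q => (f q)⁻¹ - c) p ≠ ⊤ := by
    intro p hp c hc
    rcases eq_or_ne c 0 with rfl | hc0
    · rw [ord, meromorphicOrderAt_eq_top_iff] at hc
      refine h' p hp (meromorphicOrderAt_eq_top_iff.2 ?_)
      filter_upwards [hc] with z hz
      simpa using hz
    · rw [ord, meromorphicOrderAt_eq_top_iff] at hc
      refine h p hp c⁻¹ (meromorphicOrderAt_eq_top_iff.2 ?_)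
      filter_upwards [hc] with z hz
      have : (f (A.param p z))⁻¹ = c := sub_eq_zero.1 hz
      simp [← this]
  have h1 := A.zeroCount_sub_eq hf hZ h 1
  have h2 := A.zeroCount_sub_eq hf.inv hZ hinv 1
  rw [← h1, ← h2]
  refine finsum_mem_congr rfl fun p hp => ?_
  have := toNat_meromorphicOrderAt_inv_sub (hf p) (h' p hp) one_ne_zero
  rw [inv_one] at this
  exact this

/-- A meromorphic function on a compact Riemann surface has as many zeros as poles. -/
theorem finsum_ord_eq_zero [CompactSpace S] [T2Space S] {f : S → ℂ} (hf : A.IsMero f)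
    {Z : Set S} (hZ : IsClopen Z) (h : ∀ p ∈ Z, A.ord f p ≠ ⊤) :
    ∑ᶠ p ∈ Z, (A.ord f p).untop₀ = 0 := by
  -- Where `f` is locally constant its values cannot be counted, but it has order `0` there and
  -- contributes nothing; what remains is still open and closed.
  set Z' : Set S := Z ∩ {p | ∃ c, A.ord (fun q => f q - c) p = ⊤}ᶜ
  have hZ' : IsClopen Z' := hZ.inter (A.isClopen_locally_const hf).compl
  have h' : ∀ p ∈ Z', ∀ c, A.ord (fun q => f q - c) p ≠ ⊤ := fun p hp c hc => hp.2 ⟨c, hc⟩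
  have h1 : ∑ᶠ p ∈ Z, (A.ord f p).untop₀ = ∑ᶠ p ∈ Z', (A.ord f p).untop₀ := by
    refine finsum_mem_inter_support_eq _ _ _ (Set.ext fun p => ?_)
    refine ⟨fun hp => ⟨⟨hp.1, ?_⟩, hp.2⟩, fun hp => ⟨hp.1.1, hp.2⟩⟩
    rintro ⟨c, hc⟩
    apply hp.2
    have hc0 : c ≠ 0 := by
      rintro rfl
      exact h p hp.1 (by simpa using hc)
    have : A.ord f p = meromorphicOrderAt (fun _ : ℂ => c) 0 := by
      rw [ord, meromorphicOrderAt_eq_top_iff] at hc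
      refine meromorphicOrderAt_congr ?_
      filter_upwards [hc] with z hz
      exact sub_eq_zero.1 hz
    change (A.ord f p).untop₀ = 0
    rw [this, analyticAt_const.meromorphicOrderAt_eq, analyticAt_const.analyticOrderAt_eq_zero.2 hc0]
    rfl
  have hfin : ∀ g : S → ℂ, A.IsMero g → (∀ p ∈ Z', A.ord g p ≠ ⊤) →
      (Z' ∩ Function.support (A.mult g)).Finite := fun g hg hgt =>
    (A.finite_ord_ne_zero hg hZ' hgt).subset fun p hp => ⟨hp.1, fun h0 => hp.2 (by simp [mult, h0])⟩
  have hft : ∀ p ∈ Z', A.ord f p ≠ ⊤ := fun p hp => h p hp.1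
  have hord : ∀ p, A.ord (fun q => (f q)⁻¹) p = - A.ord f p := fun p => meromorphicOrderAt_inv
  have hfit : ∀ p ∈ Z', A.ord (fun q => (f q)⁻¹) p ≠ ⊤ := fun p hp => by
    rw [hord]
    have := hft p hp
    lift A.ord f p to ℤ using this with n
    exact WithTop.coe_ne_top
  have h2 : ∑ᶠ p ∈ Z', (A.ord f p).untop₀ =
      ∑ᶠ p ∈ Z', ((A.mult f p : ℤ) - (A.mult (fun q => (f q)⁻¹) p : ℤ)) := by
    refine finsum_mem_congr rfl fun p hp => ?_
    rw [mult, mult, hord]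
    have := hft p hp
    lift A.ord f p to ℤ using this with n
    have hneg : (-(n : WithTop ℤ)) = ((-n : ℤ) : WithTop ℤ) := rfl
    rw [hneg]
    simp only [WithTop.untop₀_coe]
    omega
  classical
  have hZc : A.zeroCount Z' (fun q => (f q)⁻¹) = A.zeroCount Z' f := A.zeroCount_inv hf hZ' h'
  set T : Finset S := (hfin f hf hft).toFinset ∪ (hfin _ hf.inv hfit).toFinset
  have hTZ : (T : Set S) ⊆ Z' := fun p hp => by
    rcases Finset.mem_union.1 hp with hp | hp
    · exact ((Set.Finite.mem_toFinset _).1 hp).1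
    · exact ((Set.Finite.mem_toFinset _).1 hp).1
  have hT1 : Z' ∩ Function.support (A.mult f) ⊆ T := fun p hp =>
    Finset.mem_union_left _ ((Set.Finite.mem_toFinset _).2 hp)
  have hT2 : Z' ∩ Function.support (A.mult fun q => (f q)⁻¹) ⊆ T := fun p hp =>
    Finset.mem_union_right _ ((Set.Finite.mem_toFinset _).2 hp)
  rw [zeroCount, zeroCount, finsum_mem_eq_sum_of_subset _ hT1 hTZ,
    finsum_mem_eq_sum_of_subset _ hT2 hTZ] at hZc
  rw [h1, h2, finsum_mem_eq_sum_of_subset _ ?_ hTZ, Finset.sum_sub_distrib, ← Nat.cast_sum,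
    ← Nat.cast_sum, hZc, sub_self]
  rintro p ⟨hpZ, hp⟩
  by_contra hpT
  have h3 : A.mult f p = 0 := by_contra fun h0 => hpT (hT1 ⟨hpZ, h0⟩)
  have h4 : A.mult (fun q => (f q)⁻¹) p = 0 := by_contra fun h0 => hpT (hT2 ⟨hpZ, h0⟩)
  simp [h3, h4] at hp

end RiemannAtlas

end

/-! ### Factors of homogeneous polynomials; elimination of a variable. -/

section

open scoped Topology
open MvPolynomial

namespace MvPolynomial

/-- The substitution that separates the homogeneous components. -/
noncomputable def gradedSubst (σ R : Type*) [CommRing R] :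
    MvPolynomial σ R →ₐ[R] Polynomial (MvPolynomial σ R) :=
  aeval fun i => Polynomial.C (X i) * Polynomial.X

theorem coeff_gradedSubst {σ R : Type*} [CommRing R] (p : MvPolynomial σ R) (k : ℕ) :
    (gradedSubst σ R p).coeff k = homogeneousComponent k p := by
  induction p using MvPolynomial.induction_on' with
  | monomial s r =>
    have h : gradedSubst σ R (monomial s r) =
        Polynomial.C (monomial s r) * Polynomial.X ^ s.degree := by
      rw [gradedSubst, aeval_monomial, monomial_eq, Finsupp.prod, Finsupp.prod, Finsupp.degree]
      simp only [mul_pow, Finset.prod_mul_distrib, Finset.prod_pow_eq_pow_sum, map_mul, map_prod,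
        map_pow, mul_assoc]
      rfl
    rw [h, Polynomial.coeff_C_mul_X_pow]
    split_ifs with hk
    · subst hk
      exact (homogeneousComponent_eq_self (isHomogeneous_monomial r rfl)).symm
    · rw [homogeneousComponent_of_mem (isHomogeneous_monomial r rfl), if_neg hk]
  | add p q hp hq => rw [map_add, Polynomial.coeff_add, hp, hq, map_add]

/-- Factors of nonzero homogeneous polynomials are homogeneous. -/
theorem IsHomogeneous.exists_of_mul {σ R : Type*} [CommRing R] [IsDomain R]
    {p q : MvPolynomial σ R} {n : ℕ} (h : (p * q).IsHomogeneous n) (h0 : p * q ≠ 0) :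
    ∃ a b, p.IsHomogeneous a ∧ q.IsHomogeneous b ∧ a + b = n := by
  have hz : ∀ p : MvPolynomial σ R, p ≠ 0 → gradedSubst σ R p ≠ 0 := by
    intro p hp hp0
    apply hp
    rw [← sum_homogeneousComponent p]
    exact Finset.sum_eq_zero fun k _ => by rw [← coeff_gradedSubst, hp0, Polynomial.coeff_zero]
  have hhom : ∀ p : MvPolynomial σ R, (gradedSubst σ R p).natTrailingDegree =
      (gradedSubst σ R p).natDegree → p.IsHomogeneous (gradedSubst σ R p).natDegree := by
    intro p hp
    have : p = homogeneousComponent (gradedSubst σ R p).natDegree p := by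
      conv_lhs => rw [← sum_homogeneousComponent p]
      have hk : ∀ k ≠ (gradedSubst σ R p).natDegree, homogeneousComponent k p = 0 := by
        intro k hk
        rw [← coeff_gradedSubst]
        rcases lt_or_gt_of_ne hk with h | h
        · exact Polynomial.coeff_eq_zero_of_lt_natTrailingDegree (by omega)
        · exact Polynomial.coeff_eq_zero_of_natDegree_lt h
      refine Finset.sum_eq_single _ (fun k _ => hk k) fun hnot => ?_
      refine homogeneousComponent_eq_zero _ _ ?_
      simpa using hnot
    rw [this]
    convert! homogeneousComponent_isHomogeneous _ _ using 1
    rw [← this]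
  have hp0 := hz p (left_ne_zero_of_mul h0)
  have hq0 := hz q (right_ne_zero_of_mul h0)
  -- The product of the two images is a single monomial in the new variable. Degree and trailing
  -- degree are both additive, so they must agree for each factor.
  have hmul : gradedSubst σ R p * gradedSubst σ R q =
      Polynomial.C (p * q) * Polynomial.X ^ n := by
    rw [← map_mul]
    ext1 k
    rw [coeff_gradedSubst, Polynomial.coeff_C_mul_X_pow, homogeneousComponent_of_mem h]
  have h1 : (gradedSubst σ R p).natDegree + (gradedSubst σ R q).natDegree = n := by
    rw [← Polynomial.natDegree_mul hp0 hq0, hmul, Polynomial.natDegree_C_mul_X_pow _ _ h0]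
  have h2 : (gradedSubst σ R p).natTrailingDegree + (gradedSubst σ R q).natTrailingDegree = n := by
    rw [← Polynomial.natTrailingDegree_mul hp0 hq0, hmul, Polynomial.C_mul_X_pow_eq_monomial,
      Polynomial.natTrailingDegree_monomial h0]
  have h3 := (gradedSubst σ R p).natTrailingDegree_le_natDegree
  have h4 := (gradedSubst σ R q).natTrailingDegree_le_natDegree
  exact ⟨_, _, hhom p (by omega), hhom q (by omega), h1⟩

end MvPolynomial

/-- Elimination: polynomials over an integrally closed domain without common irreducible factors
combine to a nonzero constant. -/
theorem Polynomial.exists_mul_add_mul_eq_C {R : Type*} [CommRing R] [IsDomain R]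
    [IsIntegrallyClosed R] {G H : Polynomial R} (hG : IsUnit G.leadingCoeff)
    (h : ∀ D, Irreducible D → D ∣ G → ¬ D ∣ H) :
    ∃ A B : Polynomial R, ∃ r : R, r ≠ 0 ∧ A * G + B * H = Polynomial.C r := by
  obtain ⟨u, hu⟩ := hG
  set G₁ := Polynomial.C (↑u⁻¹ : R) * G
  have hG₁ : G₁.Monic := by
    rw [Polynomial.Monic, Polynomial.leadingCoeff_mul, Polynomial.leadingCoeff_C, ← hu, u.inv_mul]
  have hG₁G : G₁ ∣ G := ⟨Polynomial.C (u : R), by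
    rw [mul_comm, ← mul_assoc, ← Polynomial.C_mul, u.mul_inv, Polynomial.C_1, one_mul]⟩
  let K := FractionRing R
  have hinj := IsFractionRing.injective R K
  -- Gauss's lemma: a common factor over the fraction field is, up to a constant, a monic polynomial
  -- over `R`, since `G₁` is monic and `R` is integrally closed. The Bézout identity is then cleared
  -- of denominators.
  have hcop : IsCoprime (G₁.map (algebraMap R K)) (H.map (algebraMap R K)) := by
    refine isCoprime_of_irreducible_dvd (fun h0 => (hG₁.map (algebraMap R K)).ne_zero h0.1) ?_
    intro D hD hDG hDH
    obtain ⟨D', hD'⟩ := IsIntegrallyClosed.eq_map_mul_C_of_dvd K hG₁ hDG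
    have hlc : D.leadingCoeff ≠ 0 := Polynomial.leadingCoeff_ne_zero.2 hD.ne_zero
    have hmon : D'.Monic := by
      apply Polynomial.monic_of_injective hinj
      have := congrArg Polynomial.leadingCoeff hD'
      rw [Polynomial.leadingCoeff_mul, Polynomial.leadingCoeff_C] at this
      exact mul_right_cancel₀ hlc (this.trans (one_mul _).symm)
    have hass : Associated (D'.map (algebraMap R K)) D :=
      ⟨(Polynomial.isUnit_C.2 (isUnit_iff_ne_zero.2 hlc)).unit, hD'⟩
    refine h D' ?_ (((Polynomial.map_dvd_map _ hinj hmon).1 (hass.dvd.trans hDG)).trans hG₁G)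
      ((Polynomial.map_dvd_map _ hinj hmon).1 (hass.dvd.trans hDH))
    rw [hmon.irreducible_iff_irreducible_map_fraction_map (K := K)]
    exact hass.irreducible_iff.2 hD
  obtain ⟨a, b, hab⟩ := hcop
  obtain ⟨s, hs0, hs⟩ := IsLocalization.integerNormalization_spec (nonZeroDivisors R) a
  obtain ⟨t, ht0, ht⟩ := IsLocalization.integerNormalization_spec (nonZeroDivisors R) b
  set a' := IsLocalization.integerNormalization (nonZeroDivisors R) a
  set b' := IsLocalization.integerNormalization (nonZeroDivisors R) b
  refine ⟨Polynomial.C (t * (↑u⁻¹ : R)) * a', Polynomial.C s * b', s * t,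
    mul_ne_zero (nonZeroDivisors.ne_zero hs0) (nonZeroDivisors.ne_zero ht0), ?_⟩
  apply Polynomial.map_injective _ hinj
  have h1 : Polynomial.C (t * (↑u⁻¹ : R)) * a' * G + Polynomial.C s * b' * H =
      Polynomial.C t * a' * G₁ + Polynomial.C s * b' * H := by
    simp only [G₁, Polynomial.C_mul]
    ring
  rw [h1]
  simp only [Polynomial.map_add, Polynomial.map_mul, Polynomial.map_C, hs, ht]
  have h2 : ∀ (r : R) (p : Polynomial K), r • p = Polynomial.C (algebraMap R K r) * p := by
    intro r p
    rw [← Polynomial.smul_eq_C_mul, algebraMap_smul]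
  rw [h2, h2, map_mul, Polynomial.C_mul]
  linear_combination (Polynomial.C (algebraMap R K s) * Polynomial.C (algebraMap R K t)) * hab

end

/-! ### Forms as polynomials in the first variable; finiteness of common zeros. -/

section

open scoped Topology
open MvPolynomial PlaneCurves

namespace PlaneCurves

theorem eval_smul_of_isHomogeneous {σ : Type*} {G : MvPolynomial σ ℂ} {e : ℕ}
    (hG : G.IsHomogeneous e) (c : ℂ) (x : σ → ℂ) : eval (c • x) G = c ^ e * eval x G := by
  rw [eval_eq, eval_eq, Finset.mul_sum]
  refine Finset.sum_congr rfl fun s hs => ?_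
  have h : ∑ i ∈ s.support, s i = e := (hG.degree_eq_sum_deg_support hs).symm
  simp only [Pi.smul_apply, smul_eq_mul, mul_pow, Finset.prod_mul_distrib, Finset.prod_pow_eq_pow_sum,
    h]
  ring

/-- A form as a polynomial in the first variable. -/
noncomputable abbrev inFirst (G : MvPolynomial (Fin 3) ℂ) : Polynomial (MvPolynomial (Fin 2) ℂ) :=
  finSuccEquiv ℂ 2 G

theorem eval_cons_eq (G : MvPolynomial (Fin 3) ℂ) (T : ℂ) (v : Fin 2 → ℂ) :
    eval (Fin.cons T v : Fin 3 → ℂ) G = ((inFirst G).map (eval v)).eval T :=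
  eval_eq_eval_mv_eval' v T G

theorem natDegree_inFirst_le {G : MvPolynomial (Fin 3) ℂ} {e : ℕ} (hG : G.IsHomogeneous e) :
    (inFirst G).natDegree ≤ e := by
  rw [natDegree_finSuccEquiv]
  exact (degreeOf_le_totalDegree G 0).trans hG.totalDegree_le

/-- The coefficient of the `e`-th power is a form of degree `0`, and at `[1:0:0]` the other
coefficients, forms of positive degree, vanish. So a form not vanishing at `[1:0:0]` is monic in the
first variable up to a unit. -/
theorem coeff_inFirst {G : MvPolynomial (Fin 3) ℂ} {e : ℕ} (hG : G.IsHomogeneous e) :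
    (inFirst G).coeff e = C (eval ![1, 0, 0] G) := by
  have h0 : ((inFirst G).coeff e).IsHomogeneous 0 :=
    hG.finSuccEquiv_coeff_isHomogeneous e 0 (add_zero e)
  obtain ⟨c, hc⟩ : ∃ c, (inFirst G).coeff e = C c :=
    ⟨_, totalDegree_eq_zero_iff_eq_C.1 ((totalDegree_zero_iff_isHomogeneous _).2 h0)⟩
  have h1 : eval ![1, 0, 0] G = c := by
    have h2 : (![1, 0, 0] : Fin 3 → ℂ) = Fin.cons 1 0 := by
      ext i
      fin_cases i <;> rfl
    rw [h2, eval_cons_eq, Polynomial.eval_eq_sum_range' (n := e + 1)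
      ((Polynomial.natDegree_map_le).trans_lt (Nat.lt_succ_of_le (natDegree_inFirst_le hG))),
      Finset.sum_range_succ, Finset.sum_eq_zero]
    · simp [hc]
    · intro i hi
      have hi' : i < e := Finset.mem_range.1 hi
      have h3 : ((inFirst G).coeff i).IsHomogeneous (e - i) :=
        hG.finSuccEquiv_coeff_isHomogeneous i (e - i) (by omega)
      have h4 := eval_smul_of_isHomogeneous h3 0 0
      rw [zero_pow (by omega), zero_mul, zero_smul] at h4
      rw [Polynomial.coeff_map, h4, zero_mul]
  rw [hc, h1]

theorem natDegree_inFirst {G : MvPolynomial (Fin 3) ℂ} {e : ℕ} (hG : G.IsHomogeneous e)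
    (h : eval ![1, 0, 0] G ≠ 0) : (inFirst G).natDegree = e := by
  refine le_antisymm (natDegree_inFirst_le hG) (Polynomial.le_natDegree_of_ne_zero ?_)
  rw [coeff_inFirst hG]
  simpa using h

theorem isUnit_leadingCoeff_inFirst {G : MvPolynomial (Fin 3) ℂ} {e : ℕ} (hG : G.IsHomogeneous e)
    (h : eval ![1, 0, 0] G ≠ 0) : IsUnit (inFirst G).leadingCoeff := by
  rw [Polynomial.leadingCoeff, natDegree_inFirst hG h, coeff_inFirst hG]
  exact (isUnit_iff_ne_zero.2 h).map C

theorem natDegree_map_inFirst {G : MvPolynomial (Fin 3) ℂ} {e : ℕ} (hG : G.IsHomogeneous e)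
    (h : eval ![1, 0, 0] G ≠ 0) (v : Fin 2 → ℂ) : ((inFirst G).map (eval v)).natDegree = e := by
  rw [Polynomial.natDegree_map_of_leadingCoeff_ne_zero, natDegree_inFirst hG h]
  exact ((isUnit_leadingCoeff_inFirst hG h).map (eval v)).ne_zero

theorem cons_eq (T s r : ℂ) : (![T, s, r] : Fin 3 → ℂ) = Fin.cons T ![s, r] := rfl

/-- Two forms without common factor, one of them not vanishing at `[1:0:0]`, have common zeros on
finitely many lines through `[1:0:0]` only. -/
theorem finite_common_zeros_aux {G H : MvPolynomial (Fin 3) ℂ} {e k : ℕ} (hG : G.IsHomogeneous e)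
    (hH : H.IsHomogeneous k) (h : eval ![1, 0, 0] G ≠ 0)
    (hrel : ∀ D, Irreducible D → D ∣ G → ¬ D ∣ H) :
    {s : ℂ | ∃ T, eval ![T, s, 1] G = 0 ∧ eval ![T, s, 1] H = 0}.Finite := by
  obtain ⟨A, B, r, hr, hAB⟩ := Polynomial.exists_mul_add_mul_eq_C
    (isUnit_leadingCoeff_inFirst hG h) (H := inFirst H) (by
      intro D hD hDG hDH
      let E := finSuccEquiv ℂ 2
      refine hrel (E.symm D) ((MulEquiv.irreducible_iff E.symm).2 hD) ?_ ?_
      · rw [← E.symm_apply_apply G]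
        exact map_dvd E.symm hDG
      · rw [← E.symm_apply_apply H]
        exact map_dvd E.symm hDH)
  have hzero : ∀ v : Fin 2 → ℂ, ∀ T : ℂ, eval (Fin.cons T v : Fin 3 → ℂ) G = 0 →
      eval (Fin.cons T v : Fin 3 → ℂ) H = 0 → eval v r = 0 := by
    intro v T h1 h2
    rw [eval_cons_eq] at h1 h2
    have h3 := congrArg (fun p => (p.map (eval v)).eval T) hAB
    simpa [h1, h2] using h3.symm
  by_contra hinf
  apply hr
  -- On each line `{(l s, l)}` with fixed `l` the resultant-like `r` is a polynomial in `s` with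
  -- infinitely many roots. Homogeneity of `r` is not available, hence the factor `l`; homogeneity
  -- of `G` and `H` carries the common zeros along.
  have hzero' : ∀ l s : ℂ, eval (l • ![s, 1]) r = 0 := by
    intro l s
    let p : Polynomial ℂ := aeval (fun i => Polynomial.C (l * ![0, 1] i) +
      Polynomial.C (l * ![1, 0] i) * Polynomial.X) r
    have hp : ∀ s, p.eval s = eval (l • ![s, 1]) r := by
      intro s
      have h1 : p.eval s = Polynomial.aeval s p := by simp [Polynomial.aeval_def]
      rw [h1, ← AlgHom.comp_apply (φ₁ := Polynomial.aeval s), comp_aeval, aeval_eq_eval]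
      congr 2
      ext i
      fin_cases i <;> simp
    rw [← hp]
    have : p = 0 := by
      refine Polynomial.eq_zero_of_infinite_isRoot p (Set.Infinite.mono ?_ hinf)
      rintro s ⟨T, h1, h2⟩
      change p.eval s = 0
      rw [hp]
      have hs : (Fin.cons (l * T) (l • ![s, 1]) : Fin 3 → ℂ) = l • ![T, s, 1] := by
        ext i
        fin_cases i <;> simp
      apply hzero _ (l * T)
      · rw [hs, eval_smul_of_isHomogeneous hG, h1, mul_zero]
      · rw [hs, eval_smul_of_isHomogeneous hH, h2, mul_zero]
    rw [this, Polynomial.eval_zero]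
  -- The factor `X 1` takes care of the points whose last coordinate is `0`, which the lines above
  -- do not reach.
  have hX : r * X 1 = 0 := by
    apply MvPolynomial.funext
    intro v
    rw [map_mul, eval_X, map_zero]
    rcases eq_or_ne (v 1) 0 with h1 | h1
    · rw [h1, mul_zero]
    · have h2 : v = v 1 • ![v 0 / v 1, 1] := by
        ext i
        fin_cases i
        · simp [mul_div_cancel₀ _ h1]
        · simp
      rw [h2, hzero', zero_mul]
  exact (mul_eq_zero.1 hX).resolve_right (X_ne_zero 1)

/-- The chain rule for a polynomial along a curve. -/
theorem hasDerivAt_eval {σ : Type*} [Fintype σ] (G : MvPolynomial σ ℂ) {γ : ℂ → σ → ℂ}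
    {γ' : σ → ℂ} {t : ℂ} (h : HasDerivAt γ γ' t) :
    HasDerivAt (fun z => eval (γ z) G) (∑ i, eval (γ t) (pderiv i G) * γ' i) t := by
  classical
  rw [hasDerivAt_pi] at h
  induction G using MvPolynomial.induction_on with
  | C a => simpa using hasDerivAt_const t a
  | add p q hp hq =>
    simp only [map_add, add_mul, Finset.sum_add_distrib]
    exact hp.fun_add hq
  | mul_X p j hp =>
    simp only [map_mul, eval_X] at *
    have := hp.fun_mul (h j)
    refine this.congr_deriv (Eq.symm ?_)
    simp only [pderiv_mul, pderiv_X, map_add, map_mul, eval_X, add_mul, Finset.sum_add_distrib,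
      Finset.sum_mul]
    congr 1
    · exact Finset.sum_congr rfl fun i _ => by ring
    · rw [Finset.sum_eq_single j]
      · simp
      · intro i _ hij
        rw [Pi.single_eq_of_ne hij.symm]
        simp
      · simp

end PlaneCurves

end

/-! ### Linear coordinate changes; projection of a curve from a point off it. -/

section

open scoped Topology Matrix
open MvPolynomial PlaneCurves

namespace PlaneCurves

/-- Linear substitution. -/
noncomputable def subst (M : Matrix (Fin 3) (Fin 3) ℂ) :
    MvPolynomial (Fin 3) ℂ →ₐ[ℂ] MvPolynomial (Fin 3) ℂ :=
  aeval fun i => ∑ j, C (M j i) * X j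

theorem eval_subst (M : Matrix (Fin 3) (Fin 3) ℂ) (u : Fin 3 → ℂ) (G : MvPolynomial (Fin 3) ℂ) :
    eval u (subst M G) = eval (u ᵥ* M) G := by
  have h : (aeval u).comp (subst M) = aeval (R := ℂ) (u ᵥ* M) := by
    ext i
    simp [subst, Matrix.vecMul, dotProduct, mul_comm]
  exact DFunLike.congr_fun h G

theorem isHomogeneous_subst (M : Matrix (Fin 3) (Fin 3) ℂ) {G : MvPolynomial (Fin 3) ℂ} {e : ℕ}
    (hG : G.IsHomogeneous e) : (subst M G).IsHomogeneous e := by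
  have h := hG.aeval (fun i => ∑ j, C (M j i) * X j) (n := 1) fun i =>
    IsHomogeneous.sum _ _ _ fun j _ => isHomogeneous_C_mul_X _ _
  rwa [one_mul] at h

theorem subst_subst {M N : Matrix (Fin 3) (Fin 3) ℂ} (h : N * M = 1) (G : MvPolynomial (Fin 3) ℂ) :
    subst N (subst M G) = G := by
  apply MvPolynomial.funext
  intro u
  rw [eval_subst, eval_subst, Matrix.vecMul_vecMul, h, Matrix.vecMul_one]

theorem subst_inv_subst (M : GL (Fin 3) ℂ) (G : MvPolynomial (Fin 3) ℂ) :
    subst (M⁻¹ : GL (Fin 3) ℂ).1 (subst M.1 G) = G :=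
  subst_subst (by rw [← Units.val_mul, inv_mul_cancel, Units.val_one]) G

theorem subst_subst_inv (M : GL (Fin 3) ℂ) (G : MvPolynomial (Fin 3) ℂ) :
    subst M.1 (subst (M⁻¹ : GL (Fin 3) ℂ).1 G) = G :=
  subst_subst (by rw [← Units.val_mul, mul_inv_cancel, Units.val_one]) G

/-- Linear substitution by an invertible matrix. -/
noncomputable def substEquiv (M : GL (Fin 3) ℂ) :
    MvPolynomial (Fin 3) ℂ ≃* MvPolynomial (Fin 3) ℂ where
  toFun := subst M.1
  invFun := subst (M⁻¹ : GL (Fin 3) ℂ).1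
  left_inv := subst_inv_subst M
  right_inv := subst_subst_inv M
  map_mul' := map_mul _

theorem cons_vecMul (M : Matrix (Fin 3) (Fin 3) ℂ) (T s r : ℂ) :
    ![T, s, r] ᵥ* M = T • M 0 + s • M 1 + r • M 2 := by
  ext i
  simp [Matrix.vecMul, dotProduct, Fin.sum_univ_three]

theorem vecMul_ne_zero (M : GL (Fin 3) ℂ) {u : Fin 3 → ℂ} (hu : u ≠ 0) : u ᵥ* M.1 ≠ 0 := by
  intro h
  apply hu
  have h1 : u ᵥ* M.1 ᵥ* (M⁻¹ : GL (Fin 3) ℂ).1 = u := by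
    rw [Matrix.vecMul_vecMul, ← Units.val_mul, mul_inv_cancel, Units.val_one, Matrix.vecMul_one]
  rw [← h1, h, Matrix.zero_vecMul]

/-- Vectors are rows, so row `0` of `M` is the image of `[1:0:0]`, the centre of projection. That
the centre is off the curve becomes the normalization required of forms in the first variable. -/
theorem eval_subst_first (M : Matrix (Fin 3) (Fin 3) ℂ) (G : MvPolynomial (Fin 3) ℂ) :
    eval ![1, 0, 0] (subst M G) = eval (M 0) G := by
  rw [eval_subst, cons_vecMul]
  simp

/-- Two linearly independent vectors are the first and the last row of an invertible matrix. -/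
theorem exists_GL_rows {a b : V} (h : LinearIndependent ℂ ![a, b]) :
    ∃ M : GL (Fin 3) ℂ, M.1 0 = a ∧ M.1 2 = b := by
  have hc : b ⨯₃ a ≠ 0 := by
    rw [crossProduct_ne_zero_iff_linearIndependent]
    exact LinearIndependent.pair_symm_iff.1 h
  obtain ⟨i, hi⟩ := Function.ne_iff.1 hc
  -- Completed by the `i`-th basis vector, the determinant is the `i`-th component of `b × a`.
  have hdet : (Matrix.of ![a, Pi.single i 1, b]).det ≠ 0 := by
    have h1 := triple_product_eq_det a (Pi.single i 1) b
    have h2 : Matrix.det ![a, Pi.single i 1, b] = (b ⨯₃ a) i := by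
      rw [← h1, triple_product_permutation, single_dotProduct, one_mul]
    have h3 : (Matrix.of ![a, Pi.single i 1, b]).det = (b ⨯₃ a) i := h2
    rw [h3]
    exact hi
  exact ⟨Matrix.GeneralLinearGroup.mkOfDetNeZero _ hdet, rfl, rfl⟩

theorem exists_GL_first {a : V} (h : a ≠ 0) : ∃ M : GL (Fin 3) ℂ, M.1 0 = a := by
  obtain ⟨b, hb⟩ := exists_linearIndependent_pair_of_one_lt_finrank (R := ℂ) (M := V) (by simp) h
  obtain ⟨M, hM, -⟩ := exists_GL_rows hb
  exact ⟨M, hM⟩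

theorem exists_GL_eval_ne_zero {G : MvPolynomial (Fin 3) ℂ} (h : G ≠ 0) :
    ∃ M : GL (Fin 3) ℂ, eval (M.1 0) G ≠ 0 := by
  -- The factor `X 0` makes sure that the point found is not the origin.
  have hX : G * X 0 ≠ 0 := mul_ne_zero h (X_ne_zero 0)
  obtain ⟨x, hx⟩ : ∃ x, eval x (G * X 0) ≠ 0 := by
    by_contra! hcon
    exact hX (MvPolynomial.funext fun x => by rw [hcon, map_zero])
  rw [map_mul, eval_X] at hx
  have hx0 : x ≠ 0 := by
    rintro rfl
    exact right_ne_zero_of_mul hx rfl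
  obtain ⟨M, hM⟩ := exists_GL_first hx0
  exact ⟨M, by rw [hM]; exact left_ne_zero_of_mul hx⟩

theorem cons_one_ne_zero (T s : ℂ) : (![T, s, 1] : Fin 3 → ℂ) ≠ 0 := fun h => by
  simpa using congrFun h 2

theorem cons_one_zero_ne_zero (T : ℂ) : (![T, 1, 0] : Fin 3 → ℂ) ≠ 0 := fun h => by
  simpa using congrFun h 1

/-- The points of the plane off the line at infinity, in the coordinates given by a matrix. -/
noncomputable def finitePt (M : GL (Fin 3) ℂ) (T s : ℂ) : P2 :=
  Projectivization.mk ℂ (![T, s, 1] ᵥ* M.1) (vecMul_ne_zero M (cons_one_ne_zero T s))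

/-- The points of the line at infinity, in the coordinates given by a matrix. -/
noncomputable def infinitePt (M : GL (Fin 3) ℂ) (T : ℂ) : P2 :=
  Projectivization.mk ℂ (![T, 1, 0] ᵥ* M.1) (vecMul_ne_zero M (cons_one_zero_ne_zero T))

theorem rep_mk {x : V} (hx : x ≠ 0) :
    ∃ c : ℂ, c ≠ 0 ∧ (Projectivization.mk ℂ x hx : P2).rep = c • x := by
  obtain ⟨k, hk⟩ := Projectivization.exists_smul_eq_mk_rep ℂ x hx
  exact ⟨k, k.ne_zero, hk.symm⟩

theorem eval_rep_mk_eq_zero {G : MvPolynomial (Fin 3) ℂ} {e : ℕ} (hG : G.IsHomogeneous e) {x : V}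
    (hx : x ≠ 0) : eval (Projectivization.mk ℂ x hx : P2).rep G = 0 ↔ eval x G = 0 := by
  obtain ⟨c, hc, h⟩ := rep_mk hx
  rw [h, eval_smul_of_isHomogeneous hG, mul_eq_zero, or_iff_right (pow_ne_zero _ hc)]

theorem mk_mem_zeroLocus {G : MvPolynomial (Fin 3) ℂ} {e : ℕ} (hG : G.IsHomogeneous e) {x : V}
    (hx : x ≠ 0) : Projectivization.mk ℂ x hx ∈ zeroLocus G ↔ eval x G = 0 :=
  eval_rep_mk_eq_zero hG hx

theorem finitePt_mem_zeroLocus {G : MvPolynomial (Fin 3) ℂ} {e : ℕ} (hG : G.IsHomogeneous e)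
    (M : GL (Fin 3) ℂ) (T s : ℂ) :
    finitePt M T s ∈ zeroLocus G ↔ eval ![T, s, 1] (subst M.1 G) = 0 := by
  rw [finitePt, mk_mem_zeroLocus hG, eval_subst]

theorem infinitePt_mem_zeroLocus {G : MvPolynomial (Fin 3) ℂ} {e : ℕ} (hG : G.IsHomogeneous e)
    (M : GL (Fin 3) ℂ) (T : ℂ) :
    infinitePt M T ∈ zeroLocus G ↔ eval ![T, 1, 0] (subst M.1 G) = 0 := by
  rw [infinitePt, mk_mem_zeroLocus hG, eval_subst]

theorem finitePt_injective (M : GL (Fin 3) ℂ) {T s T' s' : ℂ}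
    (h : finitePt M T s = finitePt M T' s') : T = T' ∧ s = s' := by
  rw [finitePt, finitePt, Projectivization.mk_eq_mk_iff'] at h
  obtain ⟨c, hc⟩ := h
  have h1 : c • ![T', s', 1] - ![T, s, 1] = 0 := by
    by_contra hne
    apply vecMul_ne_zero M hne
    rw [Matrix.sub_vecMul, Matrix.smul_vecMul, hc, sub_self]
  rw [sub_eq_zero] at h1
  have h2 : c = 1 := by simpa using congrFun h1 2
  subst h2
  exact ⟨by simpa using (congrFun h1 0).symm, by simpa using (congrFun h1 1).symm⟩

/-- Every point except for the centre of projection is a finite or an infinite point. -/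
theorem exists_eq_pt (M : GL (Fin 3) ℂ) {G : MvPolynomial (Fin 3) ℂ} {e : ℕ}
    (hG : G.IsHomogeneous e) (hM : eval (M.1 0) G ≠ 0) {p : P2} (hp : p ∈ zeroLocus G) :
    (∃ T s, p = finitePt M T s) ∨ ∃ T, p = infinitePt M T := by
  induction p using Projectivization.ind with
  | h x hx =>
    set u := x ᵥ* (M⁻¹ : GL (Fin 3) ℂ).1
    have hxu : x = u ᵥ* M.1 := by
      rw [Matrix.vecMul_vecMul, ← Units.val_mul, inv_mul_cancel, Units.val_one, Matrix.vecMul_one]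
    rcases eq_or_ne (u 2) 0 with h2 | h2
    · rcases eq_or_ne (u 1) 0 with h1 | h1
      · exfalso
        have hu : u = u 0 • ![1, 0, 0] := by
          ext i
          fin_cases i <;> simp [h1, h2]
        rw [mk_mem_zeroLocus hG, hxu, hu, Matrix.smul_vecMul, eval_smul_of_isHomogeneous hG,
          cons_vecMul, mul_eq_zero] at hp
        simp only [one_smul, zero_smul, add_zero, hM, or_false] at hp
        have : u 0 = 0 := by
          by_contra hne
          exact pow_ne_zero _ hne hp
        apply hx
        rw [hxu, hu, this, zero_smul, Matrix.zero_vecMul]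
      · refine Or.inr ⟨u 0 / u 1, ?_⟩
        rw [infinitePt, Projectivization.mk_eq_mk_iff']
        refine ⟨u 1, ?_⟩
        rw [hxu, ← Matrix.smul_vecMul]
        congr 1
        ext i
        fin_cases i <;> simp [h2, mul_div_cancel₀ _ h1]
    · refine Or.inl ⟨u 0 / u 2, u 1 / u 2, ?_⟩
      rw [finitePt, Projectivization.mk_eq_mk_iff']
      refine ⟨u 2, ?_⟩
      rw [hxu, ← Matrix.smul_vecMul]
      congr 1
      ext i
      fin_cases i <;> simp [mul_div_cancel₀ _ h2]

theorem finite_roots {G : MvPolynomial (Fin 3) ℂ} {e : ℕ} (hG : G.IsHomogeneous e)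
    (h : eval ![1, 0, 0] G ≠ 0) (v : Fin 2 → ℂ) :
    {T : ℂ | eval (Fin.cons T v : Fin 3 → ℂ) G = 0}.Finite := by
  have hne : (inFirst G).map (eval v) ≠ 0 := by
    intro h0
    have h1 := (isUnit_leadingCoeff_inFirst hG h).map (eval v)
    rw [Polynomial.leadingCoeff, ← Polynomial.coeff_map, h0, Polynomial.coeff_zero] at h1
    exact not_isUnit_zero h1
  refine (Polynomial.finite_setOfPred_isRoot hne).subset fun T hT => ?_
  rw [Set.mem_ofPred_eq, eval_cons_eq] at hT
  exact hT

/-- A curve has finitely many points on the line at infinity and on finitely many other lines of a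
pencil whose centre is not on the curve. -/
theorem finite_points_on_lines (M : GL (Fin 3) ℂ) {G : MvPolynomial (Fin 3) ℂ} {e : ℕ}
    (hG : G.IsHomogeneous e) (hM : eval (M.1 0) G ≠ 0) {A : Set ℂ} (hA : A.Finite) :
    {p ∈ zeroLocus G | ∀ T s, p = finitePt M T s → s ∈ A}.Finite := by
  have hM' : eval ![1, 0, 0] (subst M.1 G) ≠ 0 := by rwa [eval_subst_first]
  have hG' := isHomogeneous_subst M.1 hG
  have h1 : (⋃ s ∈ A, (fun T => finitePt M T s) ''
      {T | eval (Fin.cons T ![s, 1] : Fin 3 → ℂ) (subst M.1 G) = 0}).Finite :=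
    hA.biUnion fun s _ => (finite_roots hG' hM' _).image _
  have h2 := (finite_roots hG' hM' ![1, 0]).image (infinitePt M)
  refine (h1.union h2).subset ?_
  rintro p ⟨hp, hs⟩
  rcases exists_eq_pt M hG hM hp with ⟨T, s, rfl⟩ | ⟨T, rfl⟩
  · refine Or.inl (Set.mem_biUnion (hs T s rfl) ⟨T, ?_, rfl⟩)
    exact (finitePt_mem_zeroLocus hG M T s).1 hp
  · exact Or.inr ⟨T, (infinitePt_mem_zeroLocus hG M T).1 hp, rfl⟩

/-- An irreducible curve and a curve that does not contain it have finitely many common points. -/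
theorem finite_common_zeros {G H : MvPolynomial (Fin 3) ℂ} {e k : ℕ} (hG : G.IsHomogeneous e)
    (hH : H.IsHomogeneous k) (hirr : Irreducible G) (hGH : ¬ G ∣ H) :
    (zeroLocus G ∩ zeroLocus H).Finite := by
  obtain ⟨M, hM⟩ := exists_GL_eval_ne_zero hirr.ne_zero
  have h1 := finite_common_zeros_aux (isHomogeneous_subst M.1 hG) (isHomogeneous_subst M.1 hH)
    (by rwa [eval_subst_first]) (by
      intro D hD hDG hDH
      have hirr' : Irreducible (subst M.1 G) := (MulEquiv.irreducible_iff (substEquiv M)).2 hirr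
      apply hGH
      have h2 : subst M.1 G ∣ subst M.1 H := (hD.dvd_symm hirr' hDG).trans hDH
      rw [← subst_inv_subst M G, ← subst_inv_subst M H]
      exact map_dvd _ h2)
  refine (finite_points_on_lines M hG hM h1).subset ?_
  rintro p ⟨hpG, hpH⟩
  refine ⟨hpG, fun T s h => ⟨T, ?_, ?_⟩⟩
  · subst h
    exact (finitePt_mem_zeroLocus hG M T s).1 hpG
  · subst h
    exact (finitePt_mem_zeroLocus hH M T s).1 hpH

theorem exists_zero_of_isHomogeneous {G : MvPolynomial (Fin 3) ℂ} {e : ℕ} (he : 0 < e)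
    (hG : G.IsHomogeneous e) : (zeroLocus G).Nonempty := by
  rcases eq_or_ne G 0 with rfl | h0
  · exact ⟨Projectivization.mk ℂ ![1, 0, 0] (fun h => by simpa using congrFun h 0), by
      simp [zeroLocus]⟩
  obtain ⟨M, hM⟩ := exists_GL_eval_ne_zero h0
  have hM' : eval ![1, 0, 0] (subst M.1 G) ≠ 0 := by rwa [eval_subst_first]
  have hG' := isHomogeneous_subst M.1 hG
  obtain ⟨T, hT⟩ := IsAlgClosed.exists_root ((inFirst (subst M.1 G)).map (eval ![0, 1])) (by
    intro hdeg
    have h1 := natDegree_map_inFirst hG' hM' ![0, 1]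
    rw [Polynomial.natDegree_eq_of_degree_eq_some hdeg] at h1
    exact he.ne h1)
  refine ⟨finitePt M T 0, (finitePt_mem_zeroLocus hG M T 0).2 ?_⟩
  rw [cons_eq, eval_cons_eq]
  exact hT

theorem pos_degree_of_not_isUnit {G : MvPolynomial (Fin 3) ℂ} {e : ℕ} (hG : G.IsHomogeneous e)
    (h0 : G ≠ 0) (h : ¬ IsUnit G) : 0 < e := by
  rcases Nat.eq_zero_or_pos e with rfl | he
  · exfalso
    obtain ⟨c, rfl⟩ : ∃ c, G = C c :=
      ⟨_, totalDegree_eq_zero_iff_eq_C.1 ((totalDegree_zero_iff_isHomogeneous _).2 hG)⟩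
    refine h ((isUnit_iff_ne_zero.2 ?_).map C)
    rintro rfl
    exact h0 C_0
  · exact he

end PlaneCurves

end

/-! ### Transversal lines of a pencil; interpolation by forms. -/

section

open scoped Topology Matrix
open MvPolynomial PlaneCurves

namespace PlaneCurves

/-- If `G = D Q` and `D` divides the derivative, then `D` divides `∂₀D · Q`. It does not divide `Q`,
as `G` is squarefree. If it divides `∂₀D`, then `∂₀D = 0` by degrees, and Euler's relation at
`[1:0:0]` gives `D (1,0,0) = 0`, against the hypothesis on `G`. -/
theorem not_dvd_pderiv_of_squarefree {G : MvPolynomial (Fin 3) ℂ} {e : ℕ} (hG : G.IsHomogeneous e)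
    (hsq : Squarefree G) (h : eval ![1, 0, 0] G ≠ 0) {D : MvPolynomial (Fin 3) ℂ}
    (hD : Irreducible D) (hDG : D ∣ G) : ¬ D ∣ pderiv 0 G := by
  intro hdvd
  obtain ⟨Q, rfl⟩ := hDG
  have hDp : Prime D := hD.prime
  have h1 : D ∣ pderiv 0 D * Q := by
    rw [pderiv_mul] at hdvd
    exact (dvd_add_left (dvd_mul_right D _)).1 hdvd
  rcases hDp.dvd_or_dvd h1 with h2 | h2
  · obtain ⟨a, b, ha, -, -⟩ := IsHomogeneous.exists_of_mul hG hsq.ne_zero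
    have ha0 : 0 < a := pos_degree_of_not_isUnit ha hD.ne_zero hD.not_isUnit
    have hz : pderiv 0 D = 0 := by
      by_contra hne
      have h3 := totalDegree_le_of_dvd_of_isDomain h2 hne
      rw [ha.totalDegree hD.ne_zero, (ha.pderiv (i := 0)).totalDegree hne] at h3
      omega
    have h4 := congrArg (eval ![1, 0, 0]) ha.sum_X_mul_pderiv
    rw [Fin.sum_univ_three, hz] at h4
    have h5 : eval ![1, 0, 0] D ≠ 0 := by
      rw [map_mul] at h
      exact left_ne_zero_of_mul h
    simp [h5, ha0.ne'] at h4
  · obtain ⟨R, rfl⟩ := h2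
    exact hD.not_isUnit (hsq D ⟨R, by ring⟩)

theorem ncard_roots_of_simple {p : Polynomial ℂ}
    (h : ∀ T, p.eval T = 0 → p.derivative.eval T ≠ 0) : {T | p.eval T = 0}.ncard = p.natDegree := by
  have hp0 : p ≠ 0 := by
    rintro rfl
    simpa using h 0
  have hnodup : p.roots.Nodup := by
    rw [Multiset.nodup_iff_count_le_one]
    intro T
    rw [Polynomial.count_roots]
    by_contra hlt
    obtain ⟨h1, h2⟩ := (Polynomial.one_lt_rootMultiplicity_iff_isRoot hp0).1 (not_le.1 hlt)
    exact h T h1 h2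
  have hset : {T | p.eval T = 0} = (p.roots.toFinset : Set ℂ) := by
    ext T
    simp [hp0]
  rw [hset, Set.ncard_coe_finset, Multiset.toFinset_card_of_nodup hnodup,
    IsAlgClosed.card_roots_eq_natDegree]

theorem eval_derivative_inFirst (G : MvPolynomial (Fin 3) ℂ) (v : Fin 2 → ℂ) (T : ℂ) :
    ((inFirst G).map (eval v)).derivative.eval T =
      eval (Fin.cons T v : Fin 3 → ℂ) (pderiv 0 G) := by
  have h1 : HasDerivAt (fun z : ℂ => (Fin.cons z v : Fin 3 → ℂ)) (Pi.single 0 1) T := by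
    rw [hasDerivAt_pi]
    intro i
    refine Fin.cases ?_ (fun j => ?_) i
    · simpa using hasDerivAt_id' T
    · simpa using hasDerivAt_const T (v j)
  have h2 := hasDerivAt_eval G h1
  simp only [eval_cons_eq G] at h2
  rw [(((inFirst G).map (eval v)).hasDerivAt T).unique h2, Fin.sum_univ_three]
  simp

/-- Both sides are the derivative of `G` at `u M` in the direction of row `0`. A multiple root in
the first variable thus means tangency to a line through the centre. -/
theorem eval_pderiv_subst (M : Matrix (Fin 3) (Fin 3) ℂ) (G : MvPolynomial (Fin 3) ℂ)
    (u : Fin 3 → ℂ) :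
    eval u (pderiv 0 (subst M G)) = ∑ i, eval (u ᵥ* M) (pderiv i G) * M 0 i := by
  have h1 : HasDerivAt (fun z : ℂ => u + z • (Pi.single 0 1 : Fin 3 → ℂ)) (Pi.single 0 1) 0 := by
    simpa using ((hasDerivAt_id (0 : ℂ)).smul_const (Pi.single 0 1 : Fin 3 → ℂ)).const_add u
  have h2 := hasDerivAt_eval (subst M G) h1
  have h3 : HasDerivAt (fun z : ℂ => u ᵥ* M + z • M 0) (M 0) 0 := by
    simpa using ((hasDerivAt_id (0 : ℂ)).smul_const (M 0)).const_add (u ᵥ* M)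
  have h4 := hasDerivAt_eval G h3
  have h5 : (fun z : ℂ => eval (u + z • (Pi.single 0 1 : Fin 3 → ℂ)) (subst M G)) =
      fun z => eval (u ᵥ* M + z • M 0) G := by
    ext z
    rw [eval_subst, Matrix.add_vecMul, Matrix.smul_vecMul, Matrix.single_one_vecMul]
    rfl
  rw [h5] at h2
  have h6 := h2.unique h4
  simp only [zero_smul, add_zero] at h6
  rw [← h6, Fin.sum_univ_three]
  simp

/-- All but finitely many lines of a pencil whose centre is not on a reduced curve of degree `e` meet
the curve transversally in `e` points. -/
theorem finite_bad_lines (M : GL (Fin 3) ℂ) {G : MvPolynomial (Fin 3) ℂ} {e : ℕ}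
    (hG : G.IsHomogeneous e) (hsq : Squarefree G) (hM : eval (M.1 0) G ≠ 0) :
    ∃ A : Set ℂ, A.Finite ∧ ∀ s ∉ A, {T | finitePt M T s ∈ zeroLocus G}.ncard = e ∧
      ∀ T, finitePt M T s ∈ zeroLocus G →
        ∑ i, eval (![T, s, 1] ᵥ* M.1) (pderiv i G) * M.1 0 i ≠ 0 := by
  have hM' : eval ![1, 0, 0] (subst M.1 G) ≠ 0 := by rwa [eval_subst_first]
  have hG' := isHomogeneous_subst M.1 hG
  have hsq' : Squarefree (subst M.1 G) := by
    intro D hD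
    have h1 : IsUnit ((substEquiv M).symm D) := hsq _ (by
      rw [← map_mul]
      have h2 := map_dvd (substEquiv M).symm hD
      rwa [show subst M.1 G = substEquiv M G from rfl, MulEquiv.symm_apply_apply] at h2)
    simpa using h1.map (substEquiv M)
  refine ⟨_, finite_common_zeros_aux hG' (hG'.pderiv (i := 0)) hM'
    fun D hD hDG => not_dvd_pderiv_of_squarefree hG' hsq' hM' hD hDG, fun s hs => ?_⟩
  have hT : ∀ T, eval ![T, s, 1] (subst M.1 G) = 0 →
      eval ![T, s, 1] (pderiv 0 (subst M.1 G)) ≠ 0 := fun T h1 h2 => hs ⟨T, h1, h2⟩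
  constructor
  · have h := ncard_roots_of_simple (p := (inFirst (subst M.1 G)).map (eval ![s, 1])) (by
      intro T h1
      rw [← eval_cons_eq] at h1
      rw [eval_derivative_inFirst]
      exact hT T h1)
    rw [natDegree_map_inFirst hG' hM'] at h
    rw [← h]
    congr 1
    ext T
    rw [Set.mem_ofPred_eq, Set.mem_ofPred_eq, finitePt_mem_zeroLocus hG, cons_eq, eval_cons_eq]
  · intro T h1
    rw [← eval_pderiv_subst]
    exact hT T ((finitePt_mem_zeroLocus hG M T s).1 h1)

/-- Fewer than `n * e` points lie on a curve of degree `n + e` that does not contain a given curve of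
degree `e`. -/
theorem exists_form_through {G : MvPolynomial (Fin 3) ℂ} {e : ℕ} (hG : G.IsHomogeneous e)
    (h0 : G ≠ 0) {n : ℕ} (B : Finset P2) (hB : B.card < n * e) :
    ∃ H : MvPolynomial (Fin 3) ℂ, H.IsHomogeneous (n + e) ∧ (∀ b ∈ B, b ∈ zeroLocus H) ∧
      ¬ G ∣ H := by
  obtain ⟨M, hM⟩ := exists_GL_eval_ne_zero h0
  have hM' : eval ![1, 0, 0] (subst M.1 G) ≠ 0 := by rwa [eval_subst_first]
  have hG' := isHomogeneous_subst M.1 hG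
  -- These are `n * e` monomials of degree `n + e`, with exponent below `e` in the first variable.
  -- In that variable the transformed `G` has degree exactly `e`, so no nonzero combination is a
  -- multiple of it.
  let m : Fin n × Fin e → (Fin 3 →₀ ℕ) := fun x =>
    Finsupp.equivFunOnFinite.symm ![x.2, x.1, n + e - x.1 - x.2]
  have hm0 : ∀ x, m x 0 = x.2 := fun x => rfl
  have hm1 : ∀ x, m x 1 = x.1 := fun x => rfl
  have hm2 : ∀ x, m x 2 = n + e - x.1 - x.2 := fun x => rfl
  have hm : Function.Injective m := by
    intro x y hxy
    have h1 : (x.2 : ℕ) = y.2 := by rw [← hm0, hxy, hm0]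
    have h2 : (x.1 : ℕ) = y.1 := by rw [← hm1, hxy, hm1]
    exact Prod.ext (Fin.ext h2) (Fin.ext h1)
  have hdeg : ∀ x, (m x).degree = n + e := by
    intro x
    rw [Finsupp.degree_eq_sum, Fin.sum_univ_three, hm0, hm1, hm2]
    have := x.1.2
    have := x.2.2
    omega
  let P : (Fin n × Fin e → ℂ) →ₗ[ℂ] MvPolynomial (Fin 3) ℂ :=
    ∑ x, (monomial (m x)).comp (LinearMap.proj x)
  have hP : ∀ c, P c = ∑ x, monomial (m x) (c x) := fun c => by simp [P, LinearMap.sum_apply]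
  let Φ : (Fin n × Fin e → ℂ) →ₗ[ℂ] (B → ℂ) :=
    LinearMap.pi fun b => (aeval (R := ℂ) (b.1.rep ᵥ* (M⁻¹ : GL (Fin 3) ℂ).1)).toLinearMap.comp P
  have hker : LinearMap.ker Φ ≠ ⊥ := by
    -- There are more coefficients than conditions, one condition for each point of `B`.
    apply LinearMap.ker_ne_bot_of_finrank_lt
    simpa using hB
  obtain ⟨c, hc, hc0⟩ := Submodule.exists_mem_ne_zero_of_ne_bot hker
  have hcoeff : ∀ x, coeff (m x) (P c) = c x := by
    intro x
    rw [hP, coeff_sum, Finset.sum_eq_single x]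
    · simp
    · intro y _ hy
      rw [coeff_monomial, if_neg (hm.ne hy)]
    · simp
  have hPc0 : P c ≠ 0 := by
    intro h
    apply hc0
    ext x
    rw [← hcoeff x, h]
    simp
  have hPhom : (P c).IsHomogeneous (n + e) := by
    rw [hP]
    exact IsHomogeneous.sum _ _ _ fun x _ => isHomogeneous_monomial _ (hdeg x)
  have he : 0 < e := by
    rcases Nat.eq_zero_or_pos e with rfl | h
    · simp at hB
    · exact h
  have hPdeg : (inFirst (P c)).natDegree < e := by
    rw [natDegree_finSuccEquiv, degreeOf_lt_iff he]
    intro k hk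
    rw [hP] at hk
    have h1 := support_sum hk
    obtain ⟨x, -, hx⟩ := Finset.mem_biUnion.1 h1
    have h2 := support_monomial_subset hx
    rw [Finset.mem_singleton.1 h2, hm0]
    exact x.2.2
  refine ⟨subst (M⁻¹ : GL (Fin 3) ℂ).1 (P c), isHomogeneous_subst _ hPhom, fun b hb => ?_, ?_⟩
  · have h1 := congrFun (LinearMap.mem_ker.1 hc) ⟨b, hb⟩
    rw [zeroLocus, Set.mem_ofPred_eq, eval_subst]
    exact h1
  · intro hdvd
    have h1 := map_dvd (subst M.1) hdvd
    rw [subst_subst_inv] at h1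
    obtain ⟨Q, hQ⟩ := h1
    have hQ0 : Q ≠ 0 := by
      rintro rfl
      rw [mul_zero] at hQ
      exact hPc0 hQ
    have h2 : inFirst (P c) = inFirst (subst M.1 G) * inFirst Q := by
      rw [hQ]
      exact map_mul _ _ _
    rw [h2, Polynomial.natDegree_mul, natDegree_inFirst hG' hM'] at hPdeg
    · omega
    · intro h
      rw [h] at h2
      rw [zero_mul] at h2
      exact hPc0 ((map_eq_zero_iff _ (finSuccEquiv ℂ 2).injective).1 h2)
    · exact fun h => hQ0 ((map_eq_zero_iff _ (finSuccEquiv ℂ 2).injective).1 h)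

end PlaneCurves

end

/-! ### The differential of the defining form and arcs on the cone. -/

section

open scoped Topology Matrix
open MvPolynomial PlaneCurves Filter

namespace PlaneCurves

namespace SmoothPlaneCurve

variable {d : ℕ} (C : SmoothPlaneCurve d)

theorem dF_add (x v w : V) : C.dF x (v + w) = C.dF x v + C.dF x w := by
  simp [dF, mul_add, Finset.sum_add_distrib]

theorem dF_smul (x : V) (c : ℂ) (v : V) : C.dF x (c • v) = c * C.dF x v := by
  simp only [dF, Finset.mul_sum, Pi.smul_apply, smul_eq_mul]
  exact Finset.sum_congr rfl fun i _ => by ring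

theorem dF_smul_left (c : ℂ) (x v : V) : C.dF (c • x) v = c ^ (d - 1) * C.dF x v := by
  simp only [dF, Finset.mul_sum]
  refine Finset.sum_congr rfl fun i _ => ?_
  rw [eval_smul_of_isHomogeneous (C.homogeneous.pderiv (i := i)), mul_assoc]

theorem dF_self (x : V) : C.dF x x = d * eval x C.F := by
  have h := congrArg (eval x) C.homogeneous.sum_X_mul_pderiv
  rw [map_sum, nsmul_eq_mul, map_mul, map_natCast] at h
  rw [← h, dF]
  refine Finset.sum_congr rfl fun i _ => ?_
  rw [map_mul, eval_X, mul_comm]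

theorem dF_self_eq_zero {x : V} (hx : eval x C.F = 0) : C.dF x x = 0 := by
  rw [dF_self, hx, mul_zero]

theorem exists_dF_ne_zero {x : V} (hx0 : x ≠ 0) (hx : eval x C.F = 0) : ∃ n, C.dF x n ≠ 0 := by
  obtain ⟨i, hi⟩ := C.smooth x hx0 hx
  exact ⟨Pi.single i 1, by simpa [dF, Pi.single_apply] using hi⟩

theorem hasDerivAt_F {γ : ℂ → V} {t : ℂ} (h : DifferentiableAt ℂ γ t) :
    HasDerivAt (fun z => eval (γ z) C.F) (C.dF (γ t) (deriv γ t)) t :=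
  hasDerivAt_eval C.F h.hasDerivAt

/-- A vector killed by `dF x` is a combination of two independent vectors killed by `dF x`. -/
theorem exists_combination {x a b w : V} (hx0 : x ≠ 0) (hx : eval x C.F = 0)
    (hab : LinearIndependent ℂ ![a, b]) (ha : C.dF x a = 0) (hb : C.dF x b = 0)
    (hw : C.dF x w = 0) : ∃ α β : ℂ, w = α • a + β • b := by
  obtain ⟨n, hn⟩ := C.exists_dF_ne_zero hx0 hx
  have hspan : ∀ u ∈ Submodule.span ℂ (Set.range ![a, b]), C.dF x u = 0 := by
    intro u hu
    rw [Matrix.range_cons, Matrix.range_cons, Matrix.range_empty, Set.union_empty,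
      Set.singleton_union, Submodule.mem_span_pair] at hu
    obtain ⟨α, β, rfl⟩ := hu
    rw [dF_add, dF_smul, dF_smul, ha, hb, mul_zero, mul_zero, add_zero]
  by_contra hcon
  have hw' : w ∉ Submodule.span ℂ (Set.range ![a, b]) := by
    intro hu
    rw [Matrix.range_cons, Matrix.range_cons, Matrix.range_empty, Set.union_empty,
      Set.singleton_union, Submodule.mem_span_pair] at hu
    obtain ⟨α, β, h⟩ := hu
    exact hcon ⟨α, β, h.symm⟩
  have hli : LinearIndependent ℂ ![w, a, b] := linearIndependent_finCons.2 ⟨hab, hw'⟩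
  have htop := hli.span_eq_top_of_card_eq_finrank (by simp)
  have hn' : n ∈ Submodule.span ℂ (Set.range ![w, a, b]) := by
    rw [htop]
    trivial
  apply hn
  rw [Matrix.range_cons, Submodule.span_union] at hn'
  obtain ⟨y, hy, z, hz, rfl⟩ := Submodule.mem_sup.1 hn'
  obtain ⟨c, rfl⟩ := Submodule.mem_span_singleton.1 hy
  rw [dF_add, dF_smul, hw, hspan z hz, mul_zero, add_zero]

/-- An immersed holomorphic arc on the cone over the curve, not tangent to the rulings. -/
structure IsArc (γ : ℂ → V) : Prop where
  analytic : AnalyticAt ℂ γ 0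
  immersed : LinearIndependent ℂ ![γ 0, deriv γ 0]
  mem : ∀ᶠ t in 𝓝 (0 : ℂ), eval (γ t) C.F = 0

variable {C}

theorem IsArc.ne_zero {γ : ℂ → V} (h : C.IsArc γ) : γ 0 ≠ 0 := h.immersed.ne_zero 0

theorem IsArc.eventually_ne_zero {γ : ℂ → V} (h : C.IsArc γ) : ∀ᶠ t in 𝓝 (0 : ℂ), γ t ≠ 0 :=
  h.analytic.continuousAt.eventually_ne h.ne_zero

theorem IsArc.dF_deriv {γ : ℂ → V} (h : C.IsArc γ) : C.dF (γ 0) (deriv γ 0) = 0 := by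
  have h1 := C.hasDerivAt_F h.analytic.differentiableAt
  have h2 : HasDerivAt (fun z => eval (γ z) C.F) 0 0 :=
    (hasDerivAt_const (0 : ℂ) (0 : ℂ)).congr_of_eventuallyEq h.mem
  exact h1.unique h2

end SmoothPlaneCurve

end PlaneCurves

end

/-! ### Straightening the cone over the curve. -/

section

open scoped Topology Matrix
open MvPolynomial PlaneCurves Filter

namespace PlaneCurves

namespace SmoothPlaneCurve

variable {d : ℕ} {C : SmoothPlaneCurve d}

/-- The coordinate change `(r, t, c) ↦ r (γ t + c n)` that straightens the cone over the curve. -/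
def coneMap (γ : ℂ → V) (n : V) (u : V) : V := u 0 • (γ (u 1) + u 2 • n)

theorem analyticAt_coneMap {γ : ℂ → V} {n u : V} (h : AnalyticAt ℂ γ (u 1)) :
    AnalyticAt ℂ (coneMap γ n) u := by
  have h1 : ∀ i, AnalyticAt ℂ (fun u : V => u i) u := fun i =>
    (ContinuousLinearMap.proj (R := ℂ) (φ := fun _ : Fin 3 => ℂ) i).analyticAt u
  have h2 : AnalyticAt ℂ (fun u : V => γ (u 1)) u := AnalyticAt.comp (g := γ) (f := fun u : V => u 1) h (h1 1)
  exact (h1 0).smul (h2.add ((h1 2).smul analyticAt_const))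

theorem fderiv_coneMap {γ : ℂ → V} {n : V} (h : AnalyticAt ℂ γ 0) (w : V) :
    fderiv ℂ (coneMap γ n) ![1, 0, 0] w = w 0 • γ 0 + w 1 • deriv γ 0 + w 2 • n := by
  have h1 : ∀ i, HasFDerivAt (fun u : V => u i)
      (ContinuousLinearMap.proj (R := ℂ) (φ := fun _ : Fin 3 => ℂ) i) ![1, 0, 0] := fun i =>
    (ContinuousLinearMap.proj (R := ℂ) (φ := fun _ : Fin 3 => ℂ) i).hasFDerivAt
  have h0 : HasDerivAt γ (deriv γ 0) ((![1, 0, 0] : V) 1) := h.differentiableAt.hasDerivAt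
  have h2 := HasFDerivAt.comp (g := γ) (f := fun u : V => u 1) _ h0.hasFDerivAt (h1 1)
  have h3 := (h1 0).smul (h2.add ((h1 2).smul_const n))
  have h4 : fderiv ℂ (coneMap γ n) ![1, 0, 0] = _ := h3.fderiv
  rw [h4]
  simp
  abel

/-- At `(1, 0, 0)` the differential sends the standard basis to `γ 0`, `γ' 0`, `n`. The first two
are independent and killed by `dF`, the third is not, so the inverse function theorem applies. -/
theorem IsArc.exists_inverse {γ : ℂ → V} (h : C.IsArc γ) {n : V} (hn : C.dF (γ 0) n ≠ 0) :
    ∃ Ψ : V → V, AnalyticAt ℂ Ψ (γ 0) ∧ Ψ (γ 0) = ![1, 0, 0] ∧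
      (∀ᶠ u in 𝓝 ![1, 0, 0], Ψ (coneMap γ n u) = u) ∧
      ∀ᶠ x in 𝓝 (γ 0), coneMap γ n (Ψ x) = x := by
  have han : AnalyticAt ℂ (coneMap γ n) ![1, 0, 0] := analyticAt_coneMap h.analytic
  have hinj : Function.Injective (fderiv ℂ (coneMap γ n) ![1, 0, 0]) := by
    rw [injective_iff_map_eq_zero]
    intro w hw
    rw [fderiv_coneMap h.analytic] at hw
    have h1 := congrArg (C.dF (γ 0)) hw
    have h0 : C.dF (γ 0) 0 = 0 := by simp [dF]
    rw [dF_add, dF_add, dF_smul, dF_smul, dF_smul, h.dF_deriv,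
      C.dF_self_eq_zero h.mem.self_of_nhds, h0] at h1
    have h2 : w 2 = 0 := by simpa [hn] using h1
    rw [h2, zero_smul, add_zero] at hw
    obtain ⟨h3, h4⟩ := LinearIndependent.pair_iff.1 h.immersed _ _ hw
    ext i
    fin_cases i
    · exact h3
    · exact h4
    · exact h2
  let L : V ≃L[ℂ] V := (LinearEquiv.ofInjectiveEndo _ hinj).toContinuousLinearEquiv
  have hL : HasStrictFDerivAt (coneMap γ n) (L : V →L[ℂ] V) ![1, 0, 0] := by
    have h1 : (L : V →L[ℂ] V) = fderiv ℂ (coneMap γ n) ![1, 0, 0] := by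
      ext1 w
      rfl
    rw [h1]
    exact han.hasStrictFDerivAt
  set e := hL.toOpenPartialHomeomorph (coneMap γ n)
  have he : ∀ u, e u = coneMap γ n u := fun u => rfl
  have hs : (![1, 0, 0] : V) ∈ e.source := hL.mem_toOpenPartialHomeomorph_source
  have hval : e ![1, 0, 0] = γ 0 := by
    rw [he]
    simp [coneMap]
  have ht : γ 0 ∈ e.target := hval ▸ e.map_source hs
  have hsymm : e.symm (γ 0) = ![1, 0, 0] := by rw [← hval, e.left_inv hs]
  refine ⟨e.symm, ?_, hsymm, e.eventually_left_inverse hs, e.eventually_right_inverse ht⟩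
  refine e.analyticAt_symm (i := L) ht ?_ ?_
  · rw [hsymm]
    exact han
  · rw [hsymm]
    exact hL.hasFDerivAt.fderiv

/-- Near a point of an arc, the cone over the curve is swept out by the arc, and the parameter is an
analytic function. -/
theorem IsArc.exists_parameter {γ : ℂ → V} (h : C.IsArc γ) :
    ∃ τ : V → ℂ, AnalyticAt ℂ τ (γ 0) ∧ τ (γ 0) = 0 ∧
      (∀ᶠ x in 𝓝 (γ 0), eval x C.F = 0 → ∃ c : ℂ, c ≠ 0 ∧ x = c • γ (τ x)) ∧
      ∀ᶠ z : ℂ × ℂ in 𝓝 (1, 0), τ (z.1 • γ z.2) = z.2 := by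
  obtain ⟨n, hn⟩ := C.exists_dF_ne_zero h.ne_zero h.mem.self_of_nhds
  obtain ⟨Ψ, hΨ, hΨ0, hl, hr⟩ := h.exists_inverse hn
  have h1 : ∀ i, AnalyticAt ℂ (fun x : V => Ψ x i) (γ 0) := fun i =>
    ((ContinuousLinearMap.proj (R := ℂ) (φ := fun _ : Fin 3 => ℂ) i).analyticAt _).comp hΨ
  refine ⟨fun x => Ψ x 1, h1 1, by simp [hΨ0], ?_, ?_⟩
  · let K : V → ℂ := fun u => eval (coneMap γ n u) C.F
    have hK : AnalyticAt ℂ K ![1, 0, 0] :=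
      AnalyticAt.aeval_mvPolynomial (fun i =>
        ((ContinuousLinearMap.proj (R := ℂ) (φ := fun _ : Fin 3 => ℂ) i).analyticAt _).comp
          (analyticAt_coneMap h.analytic)) C.F
    have hKd : fderiv ℂ K ![1, 0, 0] ![0, 0, 1] = C.dF (γ 0) n := by
      have h2 : HasDerivAt (fun c : ℂ => (![1, 0, 0] : V) + c • ![0, 0, 1]) ![0, 0, 1] 0 := by
        simpa using ((hasDerivAt_id (0 : ℂ)).smul_const (![0, 0, 1] : V)).const_add ![1, 0, 0]
      have h3 : HasFDerivAt K (fderiv ℂ K ![1, 0, 0]) ((![1, 0, 0] : V) + (0 : ℂ) • ![0, 0, 1]) := by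
        rw [zero_smul, add_zero]
        exact hK.differentiableAt.hasFDerivAt
      have h4 := h3.comp_hasDerivAt (0 : ℂ) h2
      have h5 : HasDerivAt (fun c : ℂ => γ 0 + c • n) n 0 := by
        simpa using ((hasDerivAt_id (0 : ℂ)).smul_const n).const_add (γ 0)
      have h6 := hasDerivAt_eval C.F h5
      have h7 : (K ∘ fun c : ℂ => (![1, 0, 0] : V) + c • ![0, 0, 1]) =
          fun c => eval (γ 0 + c • n) C.F := by
        ext c
        simp [K, coneMap]
      rw [h7] at h4
      rw [h4.unique h6]
      simp [dF]
    -- `K` vanishes at `Ψ x` and at its projection to `c = 0`. Strict differentiability, with error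
    -- half the size of the derivative `dF (γ 0) n` in direction `c`, then forces `c = Ψ x 2 = 0`.
    have hlo := hK.hasStrictFDerivAt.isLittleO
    have hpos : 0 < ‖C.dF (γ 0) n‖ / 2 := half_pos (norm_pos_iff.2 hn)
    have hb := hlo.bound hpos
    have hcont : Tendsto (fun x => (Ψ x, (![Ψ x 0, Ψ x 1, 0] : V))) (𝓝 (γ 0))
        (𝓝 ((![1, 0, 0] : V), (![1, 0, 0] : V))) := by
      have h2 : Tendsto Ψ (𝓝 (γ 0)) (𝓝 ![1, 0, 0]) := by
        have := hΨ.continuousAt.tendsto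
        rwa [hΨ0] at this
      refine h2.prodMk_nhds ?_
      rw [tendsto_pi_nhds] at h2 ⊢
      intro i
      fin_cases i
      · exact h2 0
      · exact h2 1
      · exact tendsto_const_nhds
    have h0 : ∀ᶠ x in 𝓝 (γ 0), Ψ x 0 ≠ 0 :=
      (h1 0).continuousAt.eventually_ne (by simp [hΨ0])
    have hmem : ∀ᶠ x in 𝓝 (γ 0), eval (γ (Ψ x 1)) C.F = 0 := by
      have h2 : Tendsto (fun x => Ψ x 1) (𝓝 (γ 0)) (𝓝 0) := by
        have := (h1 1).continuousAt.tendsto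
        simpa [hΨ0] using this
      exact h2.eventually h.mem
    filter_upwards [hr, hcont.eventually hb, h0, hmem] with x hx1 hx2 hx3 hx4 hx5
    have hK1 : K (Ψ x) = 0 := by
      change eval (coneMap γ n (Ψ x)) C.F = 0
      rw [hx1, hx5]
    have hK2 : K ![Ψ x 0, Ψ x 1, 0] = 0 := by
      change eval (coneMap γ n _) C.F = 0
      simp [coneMap, eval_smul_of_isHomogeneous C.homogeneous, hx4]
    have hdiff : Ψ x - ![Ψ x 0, Ψ x 1, 0] = Ψ x 2 • ![0, 0, 1] := by
      ext i
      fin_cases i <;> simp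
    simp only [hK1, hK2, hdiff, map_smul, hKd, sub_zero, zero_sub, norm_neg, norm_smul] at hx2
    have hnorm : ‖(![0, 0, 1] : V)‖ ≤ 1 := by
      refine (pi_norm_le_iff_of_nonneg zero_le_one).2 fun i => ?_
      fin_cases i <;> simp
    have hz : Ψ x 2 = 0 := by
      by_contra hne
      have := norm_pos_iff.2 hne
      have h2 : ‖C.dF (γ 0) n‖ / 2 * (‖Ψ x 2‖ * ‖(![0, 0, 1] : V)‖) ≤
          ‖C.dF (γ 0) n‖ / 2 * (‖Ψ x 2‖ * 1) := by gcongr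
      nlinarith
    refine ⟨Ψ x 0, hx3, ?_⟩
    conv_lhs => rw [← hx1]
    simp [coneMap, hz]
  · have hcont : Tendsto (fun z : ℂ × ℂ => (![z.1, z.2, 0] : V)) (𝓝 (1, 0)) (𝓝 ![1, 0, 0]) := by
      rw [tendsto_pi_nhds]
      intro i
      fin_cases i
      · exact (continuous_fst.tendsto _)
      · exact (continuous_snd.tendsto _)
      · exact tendsto_const_nhds
    filter_upwards [hcont.eventually hl] with z hz
    have h2 := congrFun hz 1
    simpa [coneMap] using h2

end SmoothPlaneCurve

end PlaneCurves

end

/-! ### Topology of the plane and compactness of the curve. -/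

section

open scoped Topology Matrix ComplexConjugate
open MvPolynomial PlaneCurves Filter

namespace PlaneCurves

/-- The orthogonal projection onto the line spanned by a vector, as a matrix. -/
noncomputable def hermV (x : V) : Fin 3 → Fin 3 → ℂ := fun i k =>
  x i * conj (x k) / ∑ l, x l * conj (x l)

theorem sum_mul_conj_ne_zero {x : V} (hx : x ≠ 0) : ∑ l, x l * conj (x l) ≠ 0 := by
  intro h
  apply hx
  have h1 : ∑ l, Complex.normSq (x l) = 0 := by
    have h2 : ((∑ l, Complex.normSq (x l) : ℝ) : ℂ) = 0 := by
      rw [← h, Complex.ofReal_sum]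
      exact Finset.sum_congr rfl fun l _ => (Complex.mul_conj _).symm
    exact_mod_cast h2
  ext l
  have h3 := (Finset.sum_eq_zero_iff_of_nonneg fun l _ => Complex.normSq_nonneg (x l)).1 h1 l
    (Finset.mem_univ l)
  exact Complex.normSq_eq_zero.1 h3

theorem hermV_smul {c : ℂ} (hc : c ≠ 0) (x : V) : hermV (c • x) = hermV x := by
  ext i k
  have h : ∑ l, (c • x) l * conj ((c • x) l) = (c * conj c) * ∑ l, x l * conj (x l) := by
    rw [Finset.mul_sum]
    refine Finset.sum_congr rfl fun l _ => ?_
    simp only [Pi.smul_apply, smul_eq_mul, map_mul]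
    ring
  have hcc : c * conj c ≠ 0 := mul_ne_zero hc ((map_ne_zero _).2 hc)
  have h2 := mul_div_mul_left (x i * conj (x k)) (∑ l, x l * conj (x l)) hcc
  rw [hermV, hermV, h, ← h2]
  simp only [Pi.smul_apply, smul_eq_mul, map_mul]
  congr 1
  ring

theorem continuousAt_hermV {x : V} (hx : x ≠ 0) : ContinuousAt hermV x := by
  rw [continuousAt_pi]
  intro i
  rw [continuousAt_pi]
  intro k
  refine ContinuousAt.div ?_ ?_ (sum_mul_conj_ne_zero hx)
  · exact ((continuous_apply i).mul (Complex.continuous_conj.comp (continuous_apply k))).continuousAt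
  · exact (continuous_finsetSum _ fun l _ => (continuous_apply l).mul
      (Complex.continuous_conj.comp (continuous_apply l))).continuousAt

/-- The projection of a vector to the line spanned by another one. -/
noncomputable def hermProj (A : Fin 3 → Fin 3 → ℂ) (y : V) : V := fun i => ∑ k, A i k * y k

theorem hermProj_hermV (x y : V) :
    hermProj (hermV x) y = ((∑ k, conj (x k) * y k) / ∑ l, x l * conj (x l)) • x := by
  ext i
  simp only [hermProj, hermV, Pi.smul_apply, smul_eq_mul, Finset.sum_div, Finset.sum_mul]
  exact Finset.sum_congr rfl fun k _ => by ring

theorem hermProj_hermV_self {x : V} (hx : x ≠ 0) : hermProj (hermV x) x = x := by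
  rw [hermProj_hermV]
  have h : ∑ k, conj (x k) * x k = ∑ l, x l * conj (x l) :=
    Finset.sum_congr rfl fun k _ => mul_comm _ _
  rw [h, div_self (sum_mul_conj_ne_zero hx), one_smul]

theorem continuous_hermProj (y : V) : Continuous fun A => hermProj A y := by
  unfold hermProj
  fun_prop

/-- The embedding of the projective plane into the space of matrices. -/
noncomputable def herm (p : P2) : Fin 3 → Fin 3 → ℂ := hermV p.rep

theorem herm_mk {x : V} (hx : x ≠ 0) : herm (Projectivization.mk ℂ x hx) = hermV x := by
  obtain ⟨c, hc, h⟩ := rep_mk hx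
  rw [herm, h, hermV_smul hc]

/-- A point is identified with the orthogonal projector onto its line. This makes the plane
Hausdorff at once, and the projectors also give continuous lifts to `ℂ³`. -/
noncomputable instance : TopologicalSpace P2 := TopologicalSpace.induced herm inferInstance

theorem continuous_herm : Continuous herm := continuous_induced_dom

theorem eq_mk_of_mem {p : P2} {x : V} (hx : x ≠ 0) (h : x ∈ p.submodule) :
    p = Projectivization.mk ℂ x hx := by
  induction p using Projectivization.ind with
  | h y hy =>
    rw [Projectivization.submodule_mk, Submodule.mem_span_singleton] at h
    obtain ⟨c, hc⟩ := h
    have hc0 : c ≠ 0 := by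
      rintro rfl
      exact hx (by rw [← hc, zero_smul])
    rw [Projectivization.mk_eq_mk_iff']
    exact ⟨c⁻¹, by rw [← hc, inv_smul_smul₀ hc0]⟩

theorem herm_injective : Function.Injective herm := by
  intro p q h
  have h1 := hermProj_hermV_self q.rep_nonzero
  rw [show hermV q.rep = hermV p.rep from h.symm, hermProj_hermV] at h1
  have hp : q.rep ∈ p.submodule := by
    rw [Projectivization.submodule_eq, Submodule.mem_span_singleton]
    exact ⟨_, h1⟩
  rw [eq_mk_of_mem q.rep_nonzero hp, Projectivization.mk_rep]

instance : T2Space P2 := T2Space.of_injective_continuous herm_injective continuous_herm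

theorem tendsto_mk {α : Type*} {l : Filter α} {f : α → V} {g : α → P2} {x : V} (hx : x ≠ 0)
    (hf : Tendsto f l (𝓝 x)) (hg : ∀ᶠ a in l, ∃ h : f a ≠ 0, g a = Projectivization.mk ℂ (f a) h) :
    Tendsto g l (𝓝 (Projectivization.mk ℂ x hx)) := by
  rw [nhds_induced, tendsto_comap_iff, herm_mk]
  refine ((continuousAt_hermV hx).tendsto.comp hf).congr' ?_
  filter_upwards [hg] with a ⟨h, ha⟩
  simp [ha, herm_mk]

namespace SmoothPlaneCurve

variable {d : ℕ} {C : SmoothPlaneCurve d}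

open Classical in
/-- The point of the curve with given homogeneous coordinates. -/
noncomputable def toPt (p : C.Points) (x : V) : C.Points :=
  if h : x ≠ 0 ∧ eval x C.F = 0 then
    ⟨Projectivization.mk ℂ x h.1, (mk_mem_zeroLocus C.homogeneous h.1).2 h.2⟩
  else p

theorem toPt_eq (p q : C.Points) {x : V} (hx : x ≠ 0) (h : x ∈ q.1.submodule) : toPt p x = q := by
  have hq := eq_mk_of_mem hx h
  have hF : eval x C.F = 0 := by
    have h1 := q.2
    rwa [hq, mk_mem_zeroLocus C.homogeneous hx] at h1
  rw [toPt, dif_pos ⟨hx, hF⟩]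
  exact Subtype.ext hq.symm

theorem coe_toPt (p : C.Points) {x : V} (hx : x ≠ 0) (hF : eval x C.F = 0) :
    (toPt p x).1 = Projectivization.mk ℂ x hx := by
  rw [toPt, dif_pos ⟨hx, hF⟩]

theorem eval_eq_zero_of_mem {q : C.Points} {x : V} (h : x ∈ q.1.submodule) : eval x C.F = 0 := by
  have h1 := q.2
  rw [Projectivization.submodule_eq, Submodule.mem_span_singleton] at h
  obtain ⟨c, rfl⟩ := h
  rw [eval_smul_of_isHomogeneous C.homogeneous, show eval q.1.rep C.F = 0 from h1, mul_zero]

theorem tendsto_toPt {α : Type*} {l : Filter α} {f : α → V} {x : V} (hx : x ≠ 0)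
    (hf : Tendsto f l (𝓝 x)) (hF : ∀ᶠ a in l, eval (f a) C.F = 0) (p : C.Points) {q : C.Points}
    (hq : x ∈ q.1.submodule) : Tendsto (fun a => toPt p (f a)) l (𝓝 q) := by
  rw [tendsto_subtype_rng, eq_mk_of_mem hx hq]
  refine tendsto_mk hx hf ?_
  filter_upwards [hF, hf.eventually_ne hx] with a h1 h2
  exact ⟨h2, coe_toPt p h2 h1⟩

theorem toPt_eq_toPt {p p' : C.Points} {x y : V} (hx : x ≠ 0) (hF : eval x C.F = 0) {c : ℂ}
    (hc : c ≠ 0) (h : x = c • y) : toPt p x = toPt p' y := by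
  have hy : y ≠ 0 := by
    rintro rfl
    exact hx (by rw [h, smul_zero])
  have hyF : eval y C.F = 0 := by
    rw [h, eval_smul_of_isHomogeneous C.homogeneous, mul_eq_zero] at hF
    exact hF.resolve_left (pow_ne_zero _ hc)
  apply Subtype.ext
  rw [coe_toPt p hx hF, coe_toPt p' hy hyF, Projectivization.mk_eq_mk_iff']
  exact ⟨c, h.symm⟩

theorem exists_smul_of_toPt_eq {p p' : C.Points} {x y : V} (hx : x ≠ 0) (hF : eval x C.F = 0)
    (hy : y ≠ 0) (hyF : eval y C.F = 0) (h : toPt p x = toPt p' y) : ∃ c : ℂ, x = c • y := by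
  have h1 := congrArg Subtype.val h
  rw [coe_toPt p hx hF, coe_toPt p' hy hyF, Projectivization.mk_eq_mk_iff'] at h1
  obtain ⟨c, hc⟩ := h1
  exact ⟨c, hc.symm⟩

/-- The unit vectors on the cone form a compact set that is mapped continuously onto the curve. -/
instance : CompactSpace C.Points := by
  rcases isEmpty_or_nonempty C.Points with hE | ⟨⟨p⟩⟩
  · infer_instance
  let K : Set V := {x | ‖x‖ = 1 ∧ eval x C.F = 0}
  have hcl : IsClosed K := by
    refine (isClosed_eq continuous_norm continuous_const).inter (isClosed_eq ?_ continuous_const)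
    exact MvPolynomial.continuous_eval C.F
  have hK : IsCompact K := by
    refine (isCompact_sphere (0 : V) 1).of_isClosed_subset hcl fun x hx => ?_
    simpa using hx.1
  have hcont : ContinuousOn (toPt p) K := by
    intro x hx
    have hx0 : x ≠ 0 := by
      rintro rfl
      simpa using hx.1
    refine tendsto_toPt hx0 (tendsto_id.mono_left nhdsWithin_le_nhds) ?_ p (q := toPt p x) ?_
    · filter_upwards [self_mem_nhdsWithin] with y hy using hy.2
    · rw [coe_toPt p hx0 hx.2, Projectivization.submodule_mk]
      exact Submodule.mem_span_singleton_self x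
  have himg : toPt p '' K = Set.univ := by
    rw [Set.eq_univ_iff_forall]
    intro q
    have hn : ‖q.1.rep‖ ≠ 0 := norm_ne_zero_iff.2 q.1.rep_nonzero
    have hmem : ((‖q.1.rep‖⁻¹ : ℝ) : ℂ) • q.1.rep ∈ q.1.submodule := by
      apply Submodule.smul_mem
      rw [Projectivization.submodule_eq]
      exact Submodule.mem_span_singleton_self _
    refine ⟨((‖q.1.rep‖⁻¹ : ℝ) : ℂ) • q.1.rep, ⟨?_, eval_eq_zero_of_mem hmem⟩, ?_⟩
    · rw [norm_smul, Complex.norm_real, norm_inv, norm_norm, inv_mul_cancel₀ hn]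
    · refine toPt_eq p q (smul_ne_zero ?_ q.1.rep_nonzero) hmem
      exact_mod_cast inv_ne_zero hn
  rw [← isCompact_univ_iff, ← himg]
  exact hK.image_of_continuousOn hcont

end SmoothPlaneCurve

end PlaneCurves

end

/-! ### The curve as a Riemann surface. -/

section

open scoped Topology Matrix
open MvPolynomial PlaneCurves Filter

namespace PlaneCurves

namespace SmoothPlaneCurve

variable {d : ℕ} {C : SmoothPlaneCurve d}

/-- The reparametrization is `ψ u = τ (κ γ' u)`, with `τ` the analytic parameter on the cone; the
scalar `κ` moves `γ' 0` to where `τ` is defined. If `ψ' 0 = 0`, then `γ' = λ · (γ ∘ ψ)` would have a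
derivative at `0` proportional to its value, against immersion. -/
theorem IsArc.eventually_transition {γ : ℂ → V} (h : C.IsArc γ) :
    ∀ᶠ t in 𝓝 (0 : ℂ), ∀ γ' : ℂ → V, C.IsArc γ' → ∀ κ : ℂ, κ ≠ 0 → κ • γ' 0 = γ t →
      ∃ ψ : ℂ → ℂ, AnalyticAt ℂ ψ 0 ∧ ψ 0 = t ∧ deriv ψ 0 ≠ 0 ∧
        ∀ᶠ u in 𝓝 (0 : ℂ), ∃ c : ℂ, c ≠ 0 ∧ γ' u = c • γ (ψ u) := by
  obtain ⟨τ, hτ, -, h1, h2⟩ := h.exists_parameter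
  obtain ⟨i, hi⟩ := Function.ne_iff.1 h.ne_zero
  have hc : Tendsto γ (𝓝 0) (𝓝 (γ 0)) := h.analytic.continuousAt
  have h2' : ∀ᶠ t in 𝓝 (0 : ℂ), τ (γ t) = t := by
    have h3 : Tendsto (fun t : ℂ => ((1 : ℂ), t)) (𝓝 0) (𝓝 (1, 0)) :=
      Continuous.tendsto' (by fun_prop) _ _ rfl
    filter_upwards [h3.eventually h2] with t ht
    simpa using ht
  have hi' : ∀ᶠ t in 𝓝 (0 : ℂ), γ t i ≠ 0 :=
    ((continuous_apply i).continuousAt.tendsto.comp hc).eventually_ne hi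
  filter_upwards [hc.eventually hτ.eventually_analyticAt, hc.eventually h1.eventually_nhds, h2', hi',
    h.analytic.eventually_analyticAt] with t ht1 ht2 ht3 ht4 ht5 γ' h' κ hκ hκt
  have hs : AnalyticAt ℂ (fun u => κ • γ' u) 0 := h'.analytic.fun_const_smul
  have hψ : AnalyticAt ℂ (fun u => τ (κ • γ' u)) 0 :=
    AnalyticAt.fun_comp (f := fun u => κ • γ' u) (g := τ) (by simpa only [hκt] using ht1) hs
  have hψ0 : τ (κ • γ' 0) = t := by rw [hκt, ht3]
  have hev : ∀ᶠ u in 𝓝 (0 : ℂ), ∃ c : ℂ, c ≠ 0 ∧ γ' u = c • γ (τ (κ • γ' u)) := by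
    have h3 : Tendsto (fun u => κ • γ' u) (𝓝 0) (𝓝 (γ t)) := by
      rw [← hκt]
      exact hs.continuousAt
    filter_upwards [h3.eventually ht2, h'.mem] with u hu1 hu2
    obtain ⟨c, hc, h4⟩ := hu1 (by
      rw [eval_smul_of_isHomogeneous C.homogeneous, hu2, mul_zero])
    refine ⟨κ⁻¹ * c, mul_ne_zero (inv_ne_zero hκ) hc, ?_⟩
    rw [mul_smul, ← h4, inv_smul_smul₀ hκ]
  refine ⟨fun u => τ (κ • γ' u), hψ, hψ0, fun hd => ?_, hev⟩
  have hγψ : AnalyticAt ℂ (fun u => γ (τ (κ • γ' u))) 0 :=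
    AnalyticAt.fun_comp (f := fun u => τ (κ • γ' u)) (g := γ) (by simpa only [hψ0] using ht5) hψ
  have hcoord : ∀ {f : ℂ → V}, AnalyticAt ℂ f 0 → AnalyticAt ℂ (fun u => f u i) 0 := fun hf =>
    ((ContinuousLinearMap.proj (R := ℂ) (φ := fun _ : Fin 3 => ℂ) i).analyticAt _).fun_comp hf
  have hlam : AnalyticAt ℂ (fun u => γ' u i / γ (τ (κ • γ' u)) i) 0 :=
    (hcoord h'.analytic).div (hcoord hγψ) (by simpa only [hψ0] using ht4)
  have heq : (fun u => (γ' u i / γ (τ (κ • γ' u)) i) • γ (τ (κ • γ' u))) =ᶠ[𝓝 0] γ' := by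
    have h5 : ∀ᶠ u in 𝓝 (0 : ℂ), γ (τ (κ • γ' u)) i ≠ 0 :=
      (hcoord hγψ).continuousAt.eventually_ne (by simpa only [hψ0] using ht4)
    filter_upwards [hev, h5] with u ⟨c, hc, hu⟩ hu5
    have h6 : γ' u i / γ (τ (κ • γ' u)) i = c := by
      rw [div_eq_iff hu5]
      exact congrFun hu i
    rw [h6, ← hu]
  have hd1 : HasDerivAt (fun u => γ (τ (κ • γ' u))) 0 0 := by
    have h7 : HasDerivAt γ (deriv γ t) (τ (κ • γ' 0)) := by
      rw [hψ0]
      exact ht5.differentiableAt.hasDerivAt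
    have h8 := hψ.differentiableAt.hasDerivAt
    rw [hd] at h8
    have h9 := h7.scomp (0 : ℂ) h8
    rw [zero_smul] at h9
    exact h9
  have hd2 := (hlam.differentiableAt.hasDerivAt.smul hd1).congr_of_eventuallyEq heq.symm
  have hd3 := hd2.deriv
  rw [smul_zero, zero_add, hψ0, ← hκt, smul_smul] at hd3
  have := LinearIndependent.pair_iff.1 h'.immersed
    (deriv (fun u => γ' u i / γ (τ (κ • γ' u)) i) 0 * κ) (-1) (by rw [hd3]; simp)
  simpa using this.2

/-- The proportionality factor is a ratio of coordinates, hence close to `1` near the origin; `τ`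
then recovers both parameters from the same vector. -/
theorem IsArc.eventually_injective {γ : ℂ → V} (h : C.IsArc γ) :
    ∀ᶠ z : ℂ × ℂ in 𝓝 (0, 0), ∀ c : ℂ, γ z.1 = c • γ z.2 → z.1 = z.2 := by
  obtain ⟨τ, -, -, -, h2⟩ := h.exists_parameter
  obtain ⟨i, hi⟩ := Function.ne_iff.1 h.ne_zero
  have hc : ContinuousAt γ 0 := h.analytic.continuousAt
  have hci : ContinuousAt (fun t => γ t i) 0 := (continuous_apply i).continuousAt.comp hc
  have h1 : ContinuousAt (fun z : ℂ × ℂ => γ z.1 i) (0, 0) :=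
    ContinuousAt.comp (g := fun t => γ t i) (f := Prod.fst) hci continuousAt_fst
  have h3 : ContinuousAt (fun z : ℂ × ℂ => γ z.2 i) (0, 0) :=
    ContinuousAt.comp (g := fun t => γ t i) (f := Prod.snd) hci continuousAt_snd
  have h4 : Tendsto (fun z : ℂ × ℂ => (γ z.1 i / γ z.2 i, z.2)) (𝓝 (0, 0)) (𝓝 (1, 0)) := by
    have h5 := (h1.div h3 hi).prodMk (continuousAt_snd (X := ℂ) (p := ((0 : ℂ), (0 : ℂ))))
    have h6 : γ 0 i / γ 0 i = 1 := div_self hi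
    simpa only [ContinuousAt, Pi.div_apply, h6] using h5
  have h7 : Tendsto (fun z : ℂ × ℂ => ((1 : ℂ), z.1)) (𝓝 (0, 0)) (𝓝 (1, 0)) :=
    Continuous.tendsto' (by fun_prop) _ _ rfl
  filter_upwards [h4.eventually h2, h7.eventually h2, h3.eventually_ne hi] with z hz1 hz2 hz3 c hc
  have h8 : γ z.1 i / γ z.2 i = c := by
    rw [div_eq_iff hz3]
    exact congrFun hc i
  simp only [one_smul] at hz2
  rw [h8] at hz1
  simp only [← hc, hz2] at hz1
  exact hz1

/-- Surjectivity onto a neighbourhood needs a parameter depending continuously on the point `q`: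
project `γ 0` orthogonally to the line `q` and apply `τ`. -/
theorem IsArc.map_nhds {γ : ℂ → V} (h : C.IsArc γ) {p : C.Points} (hp : γ 0 ∈ p.1.submodule) :
    map (fun t => toPt p (γ t)) (𝓝 0) = 𝓝 p := by
  apply le_antisymm
  · exact tendsto_toPt h.ne_zero h.analytic.continuousAt h.mem p hp
  · obtain ⟨τ, hτ, hτ0, h1, -⟩ := h.exists_parameter
    have hx : Tendsto (fun q : C.Points => hermProj (herm q.1) (γ 0)) (𝓝 p) (𝓝 (γ 0)) := by
      have h2 : hermProj (herm p.1) (γ 0) = γ 0 := by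
        rw [eq_mk_of_mem h.ne_zero hp, herm_mk, hermProj_hermV_self h.ne_zero]
      have h3 : Continuous fun q : C.Points => hermProj (herm q.1) (γ 0) :=
        (continuous_hermProj _).comp (continuous_herm.comp continuous_subtype_val)
      exact h3.tendsto' _ _ h2
    have hτx : Tendsto (fun q : C.Points => τ (hermProj (herm q.1) (γ 0))) (𝓝 p) (𝓝 0) := by
      have h4 : Tendsto τ (𝓝 (γ 0)) (𝓝 0) := by
        simpa only [ContinuousAt, hτ0] using hτ.continuousAt
      exact h4.comp hx
    have hev : ∀ᶠ q in 𝓝 p, toPt p (γ (τ (hermProj (herm q.1) (γ 0)))) = q := by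
      filter_upwards [hx.eventually h1, hx.eventually_ne h.ne_zero] with q hq1 hq2
      have hm : hermProj (herm q.1) (γ 0) ∈ q.1.submodule := by
        rw [herm, hermProj_hermV, Projectivization.submodule_eq]
        exact Submodule.smul_mem _ _ (Submodule.mem_span_singleton_self _)
      obtain ⟨c, hc, h5⟩ := hq1 (eval_eq_zero_of_mem hm)
      rw [← toPt_eq_toPt hq2 (eval_eq_zero_of_mem hm) hc h5]
      exact toPt_eq p q hq2 hm
    intro s hs
    filter_upwards [hτx.eventually (mem_map.1 hs), hev] with q hq1 hq2
    rw [← hq2]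
    exact hq1

/-- The atlas of a smooth plane curve given by a family of immersed arcs. -/
noncomputable def atlas (γ : C.Points → ℂ → V) (hγ : ∀ p, C.IsArc (γ p)) (hp : ∀ p, γ p 0 ∈ p.1.submodule) :
    RiemannAtlas C.Points where
  param p t := toPt p (γ p t)
  param_zero p := toPt_eq p p (hγ p).ne_zero (hp p)
  map_nhds p := (hγ p).map_nhds (hp p)
  injOn p := by
    have h := (hγ p).eventually_injective
    rw [nhds_prod_eq] at h
    obtain ⟨U, hU, h⟩ := (eventually_prod_self_iff
      (r := fun t u => ∀ c : ℂ, γ p t = c • γ p u → t = u)).1 h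
    have hV := (hγ p).mem.and (hγ p).eventually_ne_zero
    refine ⟨U ∩ {t | eval (γ p t) C.F = 0 ∧ γ p t ≠ 0}, inter_mem hU hV, ?_⟩
    rintro t ⟨ht1, ht2, ht3⟩ u ⟨hu1, hu2, hu3⟩ htu
    obtain ⟨c, hc⟩ := exists_smul_of_toPt_eq ht3 ht2 hu3 hu2 htu
    exact h t ht1 u hu1 c hc
  transition p := by
    filter_upwards [(hγ p).eventually_transition, (hγ p).mem, (hγ p).eventually_ne_zero]
      with t h h1 h2
    set q := toPt p (γ p t) with hq
    have hm : γ p t ∈ q.1.submodule := by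
      rw [hq, coe_toPt p h2 h1, Projectivization.submodule_mk]
      exact Submodule.mem_span_singleton_self _
    have hq2 := hp q
    rw [eq_mk_of_mem (hγ q).ne_zero (hp q), Projectivization.submodule_mk,
      Submodule.mem_span_singleton] at hm
    obtain ⟨κ, hκ⟩ := hm
    have hκ0 : κ ≠ 0 := by
      rintro rfl
      exact h2 (by rw [← hκ, zero_smul])
    obtain ⟨ψ, h3, h4, h5, h6⟩ := h (γ q) (hγ q) κ hκ0 hκ
    refine ⟨ψ, h3, h4, h5, ?_⟩
    filter_upwards [h6, (hγ q).mem, (hγ q).eventually_ne_zero] with u ⟨c, hc, hu⟩ hu1 hu2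
    exact toPt_eq_toPt hu2 hu1 hc hu

end SmoothPlaneCurve

end PlaneCurves

end

/-! ### Pairs of vectors representing a line field. -/

section

open scoped Topology Matrix
open MvPolynomial PlaneCurves Filter

namespace PlaneCurves

/-- A vector orthogonal to two independent vectors is a multiple of their cross product. -/
theorem exists_eq_smul_cross {a x v : V} (h : LinearIndependent ℂ ![x, v]) (hx : a ⬝ᵥ x = 0)
    (hv : a ⬝ᵥ v = 0) : ∃ c : ℂ, a = c • (x ⨯₃ v) := by
  have h0 : x ⨯₃ v ≠ 0 := crossProduct_ne_zero_iff_linearIndependent.2 h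
  have h1 : (x ⨯₃ v) ⨯₃ a = 0 := by
    rw [cross_cross_eq_smul_sub_smul, dotProduct_comm x a, dotProduct_comm v a, hx, hv]
    simp
  have h2 : ¬ LinearIndependent ℂ ![x ⨯₃ v, a] := fun h3 =>
    crossProduct_ne_zero_iff_linearIndependent.2 h3 h1
  rw [LinearIndependent.pair_iff' h0] at h2
  push Not at h2
  obtain ⟨c, hc⟩ := h2
  exact ⟨c, hc.symm⟩

namespace LineField

variable {d : ℕ} {C : SmoothPlaneCurve d} (X : LineField C)

/-- The vector of `T_q ℙ²` that sends `x` to the class of `v` spans the line of `X` at `q`. -/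
def IsRep (q : C.Points) (x v : V) : Prop :=
  ∃ h : x ∈ q.1.submodule, ∃ τ : TangentP2 q.1, τ ∈ X.line q ∧
    τ ⟨x, h⟩ = Submodule.Quotient.mk v ∧ v ∉ q.1.submodule

variable {X} {q : C.Points} {x v x' v' : V}

theorem IsRep.ne_zero (h : X.IsRep q x v) : x ≠ 0 := by
  obtain ⟨hx, τ, -, h1, h2⟩ := h
  rintro rfl
  apply h2
  have h3 : (⟨0, hx⟩ : q.1.submodule) = 0 := rfl
  rw [h3, map_zero] at h1
  exact (Submodule.Quotient.mk_eq_zero _).1 h1.symm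

theorem IsRep.mem (h : X.IsRep q x v) : x ∈ q.1.submodule := h.1

theorem IsRep.submodule_eq (h : X.IsRep q x v) : q.1.submodule = Submodule.span ℂ {x} := by
  rw [eq_mk_of_mem h.ne_zero h.mem, Projectivization.submodule_mk]

theorem IsRep.eval_eq_zero (h : X.IsRep q x v) : eval x C.F = 0 :=
  SmoothPlaneCurve.eval_eq_zero_of_mem h.mem

theorem IsRep.exists_smul (h : X.IsRep q x v) {y : V} (hy : y ∈ q.1.submodule) :
    ∃ c : ℂ, y = c • x := by
  rw [h.submodule_eq, Submodule.mem_span_singleton] at hy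
  obtain ⟨c, hc⟩ := hy
  exact ⟨c, hc.symm⟩

theorem IsRep.linearIndependent (h : X.IsRep q x v) : LinearIndependent ℂ ![x, v] := by
  rw [LinearIndependent.pair_iff' h.ne_zero]
  rintro c rfl
  obtain ⟨hx, τ, -, -, h2⟩ := h
  exact h2 (q.1.submodule.smul_mem c hx)

theorem IsRep.cross_ne_zero (h : X.IsRep q x v) : x ⨯₃ v ≠ 0 :=
  crossProduct_ne_zero_iff_linearIndependent.2 h.linearIndependent

theorem IsRep.line_eq (h : X.IsRep q x v) :
    ∃ τ : TangentP2 q.1, X.line q = Submodule.span ℂ {τ} ∧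
      ∀ c : ℂ, ∀ y : q.1.submodule, (y : V) = c • x → τ y = Submodule.Quotient.mk (c • v) := by
  obtain ⟨hx, τ, hτ, h1, h2⟩ := h
  obtain ⟨σ, -, hl⟩ := X.one_dimensional q
  rw [hl, Submodule.mem_span_singleton] at hτ
  obtain ⟨a, rfl⟩ := hτ
  have ha : a ≠ 0 := by
    rintro rfl
    apply h2
    rw [zero_smul, LinearMap.zero_apply] at h1
    exact (Submodule.Quotient.mk_eq_zero _).1 h1.symm
  refine ⟨a • σ, ?_, fun c y hy => ?_⟩
  · rw [hl, Submodule.span_singleton_smul_eq (isUnit_iff_ne_zero.2 ha)]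
  · have h3 : y = c • (⟨x, hx⟩ : q.1.submodule) := Subtype.ext hy
    rw [h3, map_smul, h1]
    rfl

/-- The tangent vector scales with `x` and is determined up to a factor, and `v` only matters modulo
`x`. These are the changes under which sections have to transform. -/
theorem IsRep.exists_scale (h : X.IsRep q x v) (h' : X.IsRep q x' v') :
    ∃ c c' c'' : ℂ, c ≠ 0 ∧ c' ≠ 0 ∧ x' = c • x ∧ v' = c' • v + c'' • x := by
  obtain ⟨c, hc⟩ := h.exists_smul h'.mem
  obtain ⟨τ, hl, hτ⟩ := h.line_eq
  obtain ⟨hx', τ', hτ', h1, h2⟩ := id h'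
  rw [hl, Submodule.mem_span_singleton] at hτ'
  obtain ⟨a, rfl⟩ := hτ'
  have h3 : Submodule.Quotient.mk (p := q.1.submodule) v' =
      Submodule.Quotient.mk (a • c • v) := by
    rw [← h1, LinearMap.smul_apply, hτ c ⟨x', hx'⟩ hc]
    rfl
  rw [Submodule.Quotient.eq] at h3
  obtain ⟨c'', hc''⟩ := h.exists_smul h3
  have h4 : v' = (a * c) • v + c'' • x := by
    rw [← hc'', mul_smul]
    abel
  refine ⟨c, a * c, c'', ?_, ?_, hc, h4⟩
  · rintro rfl
    exact h'.ne_zero (by rw [hc, zero_smul])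
  · intro h5
    rw [h5, zero_smul, zero_add] at h4
    exact h2 (by rw [h4]; exact q.1.submodule.smul_mem _ h.mem)

theorem IsRep.mem_directionPlane (h : X.IsRep q x v) :
    x ∈ directionPlane q.1 (X.line q) ∧ v ∈ directionPlane q.1 (X.line q) := by
  obtain ⟨hx, τ, hτ, h1, h2⟩ := h
  constructor
  · rw [directionPlane, Submodule.mem_comap, Submodule.mkQ_apply,
      (Submodule.Quotient.mk_eq_zero _).2 hx]
    exact Submodule.zero_mem _
  · rw [directionPlane, Submodule.mem_comap, Submodule.mkQ_apply, ← h1]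
    exact Submodule.mem_iSup_of_mem τ (Submodule.mem_iSup_of_mem hτ ⟨_, rfl⟩)

/-- The line through `[x]` with direction `v` is spanned by `x` and `v`, and only multiples of `x ×
v` are orthogonal to both. -/
theorem IsRep.gaussMap_eq (h : X.IsRep q x v) :
    X.gaussMap q = Projectivization.mk ℂ (x ⨯₃ v) h.cross_ne_zero := by
  have hs := (exists_dual_point q.1 (X.line q) (X.one_dimensional q)).choose_spec
  change ∀ w : V, (X.gaussMap q).rep ⬝ᵥ w = 0 ↔ _ at hs
  obtain ⟨h1, h2⟩ := h.mem_directionPlane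
  obtain ⟨c, hc⟩ := exists_eq_smul_cross h.linearIndependent ((hs x).2 h1) ((hs v).2 h2)
  rw [← (X.gaussMap q).mk_rep, Projectivization.mk_eq_mk_iff']
  exact ⟨c, hc.symm⟩

/-- If `dF x v = 0`, then `x` and `v` span the kernel of `dF x`, so modulo `x` the line field
coincides with the tangent line of the curve. -/
theorem IsRep.dF_ne_zero (h : X.IsRep q x v)
    (hq : (X.line q : Set (TangentP2 q.1)) ≠ C.tangentSet q) : C.dF x v ≠ 0 := by
  intro h0
  apply hq
  have hxx := C.dF_self_eq_zero h.eval_eq_zero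
  obtain ⟨τ, hl, hτ⟩ := h.line_eq
  ext σ
  rw [hl, SetLike.mem_coe, Submodule.mem_span_singleton]
  constructor
  · rintro ⟨a, rfl⟩ y w hyw
    obtain ⟨b, hb⟩ := h.exists_smul y.2
    rw [LinearMap.smul_apply, hτ b y hb] at hyw
    have h1 : Submodule.Quotient.mk (p := q.1.submodule) w =
      Submodule.Quotient.mk (a • b • v) := hyw.symm
    rw [Submodule.Quotient.eq] at h1
    obtain ⟨c, hc⟩ := h.exists_smul h1
    rw [sub_eq_iff_eq_add] at hc
    rw [hb, hc, SmoothPlaneCurve.dF_smul_left, SmoothPlaneCurve.dF_add, SmoothPlaneCurve.dF_smul,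
      SmoothPlaneCurve.dF_smul, SmoothPlaneCurve.dF_smul, h0, hxx]
    simp
  · intro hσ
    obtain ⟨w, hw⟩ := Submodule.Quotient.mk_surjective q.1.submodule (σ ⟨x, h.mem⟩)
    have h1 : C.dF x w = 0 := hσ ⟨x, h.mem⟩ w hw.symm
    obtain ⟨α, β, hab⟩ := C.exists_combination h.ne_zero h.eval_eq_zero h.linearIndependent hxx h0 h1
    refine ⟨β, LinearMap.ext fun y => ?_⟩
    obtain ⟨b, hb⟩ := h.exists_smul y.2
    have h2 : y = b • (⟨x, h.mem⟩ : q.1.submodule) := Subtype.ext hb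
    rw [LinearMap.smul_apply, h2, map_smul, map_smul, ← hw, hτ 1 ⟨x, h.mem⟩ (one_smul _ _).symm]
    change Submodule.Quotient.mk (p := q.1.submodule) (β • b • (1 : ℂ) • v) =
      Submodule.Quotient.mk (b • w)
    rw [eq_comm, Submodule.Quotient.eq, hab]
    have h3 : b • (α • x + β • v) - β • b • (1 : ℂ) • v = (b * α) • x := by
      module
    rw [h3]
    exact q.1.submodule.smul_mem _ h.mem

end LineField

end PlaneCurves

end

/-! ### Sections of line bundles as bihomogeneous functions. -/

section

open scoped Topology Matrix
open MvPolynomial PlaneCurves Filter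

namespace PlaneCurves

theorem analyticAt_coord {f : ℂ → V} {t : ℂ} (hf : AnalyticAt ℂ f t) (i : Fin 3) :
    AnalyticAt ℂ (fun u => f u i) t :=
  ((ContinuousLinearMap.proj (R := ℂ) (φ := fun _ : Fin 3 => ℂ) i).analyticAt _).fun_comp hf

theorem analyticAt_of_coord {f : ℂ → V} {t : ℂ} (h : ∀ i, AnalyticAt ℂ (fun u => f u i) t) :
    AnalyticAt ℂ f t :=
  AnalyticAt.pi h

/-- The ratio of two proportional nowhere vanishing holomorphic vectors is holomorphic. -/
theorem exists_analytic_ratio {f g : ℂ → V} (hf : AnalyticAt ℂ f 0) (hg : AnalyticAt ℂ g 0)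
    (hf0 : f 0 ≠ 0) (hg0 : g 0 ≠ 0) (h : ∀ᶠ u in 𝓝 (0 : ℂ), ∃ c : ℂ, f u = c • g u) :
    ∃ μ : ℂ → ℂ, AnalyticAt ℂ μ 0 ∧ μ 0 ≠ 0 ∧ ∀ᶠ u in 𝓝 (0 : ℂ), f u = μ u • g u := by
  obtain ⟨i, hi⟩ := Function.ne_iff.1 hg0
  have heq : ∀ᶠ u in 𝓝 (0 : ℂ), f u = (f u i / g u i) • g u := by
    have h1 : ∀ᶠ u in 𝓝 (0 : ℂ), g u i ≠ 0 := (analyticAt_coord hg i).continuousAt.eventually_ne hi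
    filter_upwards [h, h1] with u ⟨c, hu⟩ hu1
    have h6 : f u i / g u i = c := by
      rw [div_eq_iff hu1]
      exact congrFun hu i
    rw [h6, ← hu]
  refine ⟨fun u => f u i / g u i, (analyticAt_coord hf i).div (analyticAt_coord hg i) hi,
    fun h0 => hf0 ?_, heq⟩
  have h2 := heq.self_of_nhds
  simp only at h0
  rw [h2, h0, zero_smul]

theorem AnalyticAt.cross {f g : ℂ → V} {t : ℂ} (hf : AnalyticAt ℂ f t) (hg : AnalyticAt ℂ g t) :
    AnalyticAt ℂ (fun u => f u ⨯₃ g u) t := by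
  have h := analyticAt_coord hf
  have h' := analyticAt_coord hg
  refine analyticAt_of_coord fun i => ?_
  simp only [cross_apply]
  fin_cases i
  · exact ((h 1).mul (h' 2)).sub ((h 2).mul (h' 1))
  · exact ((h 2).mul (h' 0)).sub ((h 0).mul (h' 2))
  · exact ((h 0).mul (h' 1)).sub ((h 1).mul (h' 0))

theorem AnalyticAt.dotProduct_const {f : ℂ → V} {t : ℂ} (hf : AnalyticAt ℂ f t) (w : V) :
    AnalyticAt ℂ (fun u => f u ⬝ᵥ w) t :=
  Finset.analyticAt_fun_sum _ fun i _ => (analyticAt_coord hf i).mul analyticAt_const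

theorem AnalyticAt.eval_mvPolynomial {f : ℂ → V} {t : ℂ} (hf : AnalyticAt ℂ f t)
    (G : MvPolynomial (Fin 3) ℂ) : AnalyticAt ℂ (fun u => eval (f u) G) t := by
  induction G using MvPolynomial.induction_on with
  | C a =>
    simp only [eval_C]
    exact analyticAt_const
  | add p q hp hq =>
    simp only [map_add]
    exact hp.add hq
  | mul_X p i hp =>
    simp only [map_mul, eval_X]
    exact hp.mul (analyticAt_coord hf i)

theorem crossProduct_smul_add (x v : V) (c c' c'' : ℂ) :
    (c • x) ⨯₃ (c' • v + c'' • x) = (c * c') • (x ⨯₃ v) := by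
  rw [map_add, map_smul, map_smul, map_smul, LinearMap.smul_apply, LinearMap.smul_apply, cross_self,
    smul_zero, smul_zero, add_zero, smul_smul, mul_comm c']

/-- A holomorphic function on pairs `(x, v)` that is homogeneous of degree `i` in `x` and of degree
`j` in `v`, and invariant under `v ↦ v + c x`: a section of a power of the tautological bundle
times a power of the line field. -/
structure IsSection {d : ℕ} (C : SmoothPlaneCurve d) (Ψ : V → V → ℂ) (i j : ℕ) : Prop where
  map_smul : ∀ (x v : V) (c c' c'' : ℂ), eval x C.F = 0 →
    Ψ (c • x) (c' • v + c'' • x) = c ^ i * c' ^ j * Ψ x v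
  analytic : ∀ γ v : ℂ → V, AnalyticAt ℂ γ 0 → AnalyticAt ℂ v 0 →
    AnalyticAt ℂ (fun t => Ψ (γ t) (v t)) 0

namespace IsSection

variable {d : ℕ} {C : SmoothPlaneCurve d}

theorem mul {Ψ Φ : V → V → ℂ} {i j k l : ℕ} (h : IsSection C Ψ i j) (h' : IsSection C Φ k l) :
    IsSection C (fun x v => Ψ x v * Φ x v) (i + k) (j + l) where
  map_smul x v c c' c'' hx := by
    rw [h.map_smul x v c c' c'' hx, h'.map_smul x v c c' c'' hx, pow_add, pow_add]
    ring
  analytic γ v hγ hv := (h.analytic γ v hγ hv).mul (h'.analytic γ v hγ hv)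

theorem pow {Ψ : V → V → ℂ} {i j : ℕ} (h : IsSection C Ψ i j) (n : ℕ) :
    IsSection C (fun x v => Ψ x v ^ n) (i * n) (j * n) where
  map_smul x v c c' c'' hx := by
    rw [h.map_smul x v c c' c'' hx, pow_mul, pow_mul]
    ring
  analytic γ v hγ hv := (h.analytic γ v hγ hv).pow n

theorem form {H : MvPolynomial (Fin 3) ℂ} {k : ℕ} (hH : H.IsHomogeneous k) :
    IsSection C (fun x _ => eval x H) k 0 where
  map_smul x v c c' c'' _ := by
    rw [eval_smul_of_isHomogeneous hH, pow_zero, mul_one]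
  analytic γ v hγ _ := AnalyticAt.eval_mvPolynomial hγ H

theorem dualForm {H : MvPolynomial (Fin 3) ℂ} {k : ℕ} (hH : H.IsHomogeneous k) :
    IsSection C (fun x v => eval (x ⨯₃ v) H) k k where
  map_smul x v c c' c'' _ := by
    rw [crossProduct_smul_add, eval_smul_of_isHomogeneous hH, mul_pow]
  analytic γ v hγ hv := AnalyticAt.eval_mvPolynomial (AnalyticAt.cross hγ hv) H

theorem linear (w : V) : IsSection C (fun x _ => x ⬝ᵥ w) 1 0 where
  map_smul x v c c' c'' _ := by
    rw [smul_dotProduct, smul_eq_mul, pow_one, pow_zero, mul_one]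
  analytic γ v hγ _ := AnalyticAt.dotProduct_const hγ w

theorem dualLinear (w : V) : IsSection C (fun x v => (x ⨯₃ v) ⬝ᵥ w) 1 1 where
  map_smul x v c c' c'' _ := by
    rw [crossProduct_smul_add, smul_dotProduct, smul_eq_mul, pow_one, pow_one]
  analytic γ v hγ hv := AnalyticAt.dotProduct_const (AnalyticAt.cross hγ hv) w

/-- Insensitivity to `v ↦ v + c'' x` is Euler's relation and needs `F x = 0`; this is why
homogeneity is only demanded on the cone. -/
theorem dF : IsSection C C.dF (d - 1) 1 where
  map_smul x v c c' c'' hx := by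
    rw [SmoothPlaneCurve.dF_smul_left, SmoothPlaneCurve.dF_add, SmoothPlaneCurve.dF_smul,
      SmoothPlaneCurve.dF_smul, C.dF_self_eq_zero hx]
    ring
  analytic γ v hγ hv := Finset.analyticAt_fun_sum _ fun i _ =>
    (AnalyticAt.eval_mvPolynomial hγ _).mul (analyticAt_coord hv i)

end IsSection

end PlaneCurves

end

/-! ### Orders and numbers of zeros of sections. -/

section

open scoped Topology Matrix
open MvPolynomial PlaneCurves Filter

namespace PlaneCurves

namespace SmoothPlaneCurve.IsLocalFrame

variable {d : ℕ} {C : SmoothPlaneCurve d} {X : LineField C} {p : C.Points} {γ v : ℂ → V}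

theorem isArc (h : C.IsLocalFrame X.line p γ v) : C.IsArc γ where
  analytic := h.analytic_curve
  immersed := h.immersed
  mem := by
    filter_upwards [h.frame] with t ⟨q, hq, _⟩
    exact eval_eq_zero_of_mem hq

theorem eventually_isRep (h : C.IsLocalFrame X.line p γ v) :
    ∀ᶠ t in 𝓝 (0 : ℂ), X.IsRep (toPt p (γ t)) (γ t) (v t) := by
  filter_upwards [h.frame] with t ⟨q, hq, τ, h1, h2, h3⟩
  have h4 : X.IsRep q (γ t) (v t) := ⟨hq, τ, h1, h2, h3⟩
  rwa [toPt_eq p q h4.ne_zero hq]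

theorem isRep (h : C.IsLocalFrame X.line p γ v) : X.IsRep p (γ 0) (v 0) := by
  have h1 := h.eventually_isRep.self_of_nhds
  rwa [toPt_eq p p h1.ne_zero h.base] at h1

end SmoothPlaneCurve.IsLocalFrame

namespace LineField

open SmoothPlaneCurve

variable {d : ℕ} {C : SmoothPlaneCurve d} (X : LineField C)

/-- A chosen arc at a point. -/
noncomputable def arc (p : C.Points) : ℂ → V := (X.holomorphic p).choose

/-- A chosen local frame along the chosen arc. -/
noncomputable def vec (p : C.Points) : ℂ → V := (X.holomorphic p).choose_spec.choose

theorem isLocalFrame (p : C.Points) : C.IsLocalFrame X.line p (X.arc p) (X.vec p) :=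
  (X.holomorphic p).choose_spec.choose_spec

theorem isRep (p : C.Points) : X.IsRep p (X.arc p 0) (X.vec p 0) := (X.isLocalFrame p).isRep

/-- The atlas of the chosen arcs. -/
noncomputable def atlas : RiemannAtlas C.Points :=
  SmoothPlaneCurve.atlas X.arc (fun p => (X.isLocalFrame p).isArc) fun p => (X.isLocalFrame p).base

theorem eventually_isRep_param (p : C.Points) :
    ∀ᶠ t in 𝓝 (0 : ℂ), X.IsRep (X.atlas.param p t) (X.arc p t) (X.vec p t) :=
  (X.isLocalFrame p).eventually_isRep

/-- The value of a section at a point, in the chosen frame. -/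
noncomputable def val (Ψ : V → V → ℂ) (p : C.Points) : ℂ := Ψ (X.arc p 0) (X.vec p 0)

/-- The order of vanishing of a section at a point. -/
noncomputable def secOrd (Ψ : V → V → ℂ) (p : C.Points) : ℕ∞ :=
  analyticOrderAt (fun t => Ψ (X.arc p t) (X.vec p t)) 0

/-- The number of zeros of a section, with multiplicities. -/
noncomputable def secDeg (Ψ : V → V → ℂ) (Z : Set C.Points) : ℕ :=
  ∑ᶠ p ∈ Z, (X.secOrd Ψ p).toNat

variable {X} {Ψ Φ : V → V → ℂ} {i j : ℕ} {p : C.Points}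

theorem IsRep.exists_mul {x v x' v' : V} (h : X.IsRep p x v) (h' : X.IsRep p x' v') :
    ∃ c c' : ℂ, c ≠ 0 ∧ c' ≠ 0 ∧ x' = c • x ∧ x' ⨯₃ v' = (c * c') • (x ⨯₃ v) ∧
      ∀ {Ψ : V → V → ℂ} {i j : ℕ}, IsSection C Ψ i j → Ψ x' v' = c ^ i * c' ^ j * Ψ x v := by
  obtain ⟨c, c', c'', hc, hc', rfl, rfl⟩ := h.exists_scale h'
  exact ⟨c, c', hc, hc', rfl, crossProduct_smul_add x v c c' c'',
    fun hΨ => hΨ.map_smul x v c c' c'' h.eval_eq_zero⟩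

/-- The number `val` depends on the chosen frame, but its vanishing does not. -/
theorem val_eq_zero_iff (hΨ : IsSection C Ψ i j) {x v : V} (h : X.IsRep p x v) :
    X.val Ψ p = 0 ↔ Ψ x v = 0 := by
  obtain ⟨c, c', hc, hc', -, -, h1⟩ := h.exists_mul (X.isRep p)
  rw [val, h1 hΨ]
  simp [hc, hc']

theorem analyticAt_sec (hΨ : IsSection C Ψ i j) (p : C.Points) :
    AnalyticAt ℂ (fun t => Ψ (X.arc p t) (X.vec p t)) 0 :=
  hΨ.analytic _ _ (X.isLocalFrame p).analytic_curve (X.isLocalFrame p).analytic_vector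

/-- The order of a section does not depend on the frame. -/
theorem secOrd_eq (hΨ : IsSection C Ψ i j) {γ v : ℂ → V} (h : C.IsLocalFrame X.line p γ v) :
    analyticOrderAt (fun t => Ψ (γ t) (v t)) 0 = X.secOrd Ψ p := by
  have h0 := X.isLocalFrame p
  obtain ⟨κ, κ', hκ, -, h1, -⟩ := h.isRep.exists_mul h0.isRep
  obtain ⟨ψ, hψ, hψ0, hψ', h2⟩ := h0.isArc.eventually_transition.self_of_nhds γ h.isArc κ hκ h1.symm
  have hψt : Tendsto ψ (𝓝 0) (𝓝 0) := by simpa only [ContinuousAt, hψ0] using hψ.continuousAt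
  have hA : AnalyticAt ℂ (fun u => X.arc p (ψ u)) 0 :=
    AnalyticAt.fun_comp (f := ψ) (by rw [hψ0]; exact h0.analytic_curve) hψ
  have hB : AnalyticAt ℂ (fun u => X.vec p (ψ u)) 0 :=
    AnalyticAt.fun_comp (f := ψ) (by rw [hψ0]; exact h0.analytic_vector) hψ
  have hev : ∀ᶠ u in 𝓝 (0 : ℂ), X.IsRep (toPt p (γ u)) (γ u) (v u) ∧
      X.IsRep (toPt p (γ u)) (X.arc p (ψ u)) (X.vec p (ψ u)) := by
    filter_upwards [h2, h.eventually_isRep, hψt.eventually h0.eventually_isRep] with u ⟨c, hc, hu⟩ h3 h4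
    refine ⟨h3, ?_⟩
    rwa [toPt_eq_toPt h3.ne_zero h3.eval_eq_zero hc hu]
  have hr := hev.self_of_nhds
  obtain ⟨μ, hμ, hμ0, h5⟩ := exists_analytic_ratio h.analytic_curve hA hr.1.ne_zero hr.2.ne_zero (by
    filter_upwards [h2] with u ⟨c, _, hu⟩ using ⟨c, hu⟩)
  -- Since `v` only matters modulo `x`, its factor `c'` is not a ratio of coordinates. It is
  -- obtained as `ν / μ`, where `ν` compares the cross products and `μ` the points; this shows that
  -- it is holomorphic.
  obtain ⟨ν, hν, hν0, h6⟩ := exists_analytic_ratio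
    (AnalyticAt.cross h.analytic_curve h.analytic_vector) (AnalyticAt.cross hA hB)
    hr.1.cross_ne_zero hr.2.cross_ne_zero (by
      filter_upwards [hev] with u hu
      obtain ⟨c, c', -, -, -, h7, -⟩ := hu.2.exists_mul hu.1
      exact ⟨_, h7⟩)
  have heq : (fun t => Ψ (γ t) (v t)) =ᶠ[𝓝 0]
      (fun t => μ t ^ i * (ν t / μ t) ^ j) * ((fun t => Ψ (X.arc p t) (X.vec p t)) ∘ ψ) := by
    filter_upwards [hev, h5, h6, hμ.continuousAt.eventually_ne hμ0] with u hu h7 h8 h9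
    obtain ⟨c, c', hc, hc', h10, h11, h12⟩ := hu.2.exists_mul hu.1
    have h13 : c = μ u := by
      rw [h7] at h10
      exact (smul_left_injective ℂ hu.2.ne_zero h10).symm
    have h14 : c * c' = ν u := by
      rw [h8] at h11
      exact (smul_left_injective ℂ hu.2.cross_ne_zero h11).symm
    have h15 : c' = ν u / μ u := by
      rw [← h14, ← h13, mul_div_cancel_left₀ _ hc]
    rw [h12 hΨ, h15, h13]
    rfl
  have hfac : AnalyticAt ℂ (fun t => μ t ^ i * (ν t / μ t) ^ j) 0 :=
    (hμ.pow i).mul ((hν.div hμ hμ0).pow j)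
  have hcomp : AnalyticAt ℂ ((fun t => Ψ (X.arc p t) (X.vec p t)) ∘ ψ) 0 :=
    hΨ.analytic _ _ hA hB
  rw [analyticOrderAt_congr heq, analyticOrderAt_mul hfac hcomp,
    hfac.analyticOrderAt_eq_zero.2 (mul_ne_zero (pow_ne_zero _ hμ0)
      (pow_ne_zero _ (div_ne_zero hν0 hμ0))), zero_add,
    analyticOrderAt_comp_of_deriv_ne_zero hψ hψ', hψ0]
  rfl

theorem secOrd_eq_zero_iff (hΨ : IsSection C Ψ i j) : X.secOrd Ψ p = 0 ↔ X.val Ψ p ≠ 0 :=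
  (analyticAt_sec hΨ p).analyticOrderAt_eq_zero

theorem eventually_val_iff (hΨ : IsSection C Ψ i j) (p : C.Points) :
    ∀ᶠ t in 𝓝 (0 : ℂ), X.val Ψ (X.atlas.param p t) = 0 ↔ Ψ (X.arc p t) (X.vec p t) = 0 := by
  filter_upwards [X.eventually_isRep_param p] with t ht
  exact val_eq_zero_iff hΨ ht

theorem secOrd_eq_top_iff (hΨ : IsSection C Ψ i j) :
    X.secOrd Ψ p = ⊤ ↔ ∀ᶠ q in 𝓝 p, X.val Ψ q = 0 := by
  rw [secOrd, analyticOrderAt_eq_top, ← X.atlas.map_nhds p, eventually_map]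
  exact eventually_congr ((eventually_val_iff hΨ p).mono fun t ht => ht.symm)

theorem eventually_val_param_ne_zero (hΨ : IsSection C Ψ i j) (h : X.secOrd Ψ p ≠ ⊤) :
    ∀ᶠ t in 𝓝[≠] (0 : ℂ), X.val Ψ (X.atlas.param p t) ≠ 0 := by
  have h1 := ((analyticAt_sec hΨ p).eventually_eq_zero_or_eventually_ne_zero).resolve_left
    fun h2 => h (analyticOrderAt_eq_top.2 h2)
  filter_upwards [h1, (eventually_val_iff hΨ p).filter_mono nhdsWithin_le_nhds] with t h2 h3
  exact fun h4 => h2 (h3.1 h4)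

theorem eventually_val_ne_zero (hΨ : IsSection C Ψ i j) (h : X.secOrd Ψ p ≠ ⊤) :
    ∀ᶠ q in 𝓝[≠] p, X.val Ψ q ≠ 0 :=
  X.atlas.eventually_nhdsNE (eventually_val_param_ne_zero hΨ h)

theorem isClopen_secOrd_eq_top (hΨ : IsSection C Ψ i j) : IsClopen {p | X.secOrd Ψ p = ⊤} := by
  constructor
  · rw [← isOpen_compl_iff, isOpen_iff_eventually]
    intro p hp
    filter_upwards [eventually_nhdsWithin_iff.1 (eventually_val_ne_zero hΨ hp)] with q hq
    by_cases hqp : q = p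
    · rwa [hqp]
    · intro h
      have h1 := (secOrd_eq_zero_iff hΨ).2 (hq hqp)
      rw [show X.secOrd Ψ q = ⊤ from h] at h1
      exact ENat.top_ne_zero h1
  · rw [isOpen_iff_eventually]
    intro p hp
    filter_upwards [((secOrd_eq_top_iff hΨ).1 hp).eventually_nhds] with q hq
    exact (secOrd_eq_top_iff hΨ).2 hq

theorem finite_zeros (hΨ : IsSection C Ψ i j) {Z : Set C.Points} (hZ : IsClopen Z)
    (h : ∀ p ∈ Z, X.secOrd Ψ p ≠ ⊤) : {p ∈ Z | X.val Ψ p = 0}.Finite := by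
  apply Set.Finite.of_eventually_notMem
  intro p
  by_cases hp : p ∈ Z
  · filter_upwards [eventually_val_ne_zero hΨ (h p hp)] with q hq hq'
    exact hq hq'.2
  · filter_upwards [nhdsWithin_le_nhds (hZ.1.isOpen_compl.mem_nhds hp)] with q hq hq'
    exact hq hq'.1

theorem finite_support_secOrd (hΨ : IsSection C Ψ i j) {Z : Set C.Points} (hZ : IsClopen Z)
    (h : ∀ p ∈ Z, X.secOrd Ψ p ≠ ⊤) :
    (Z ∩ Function.support fun p => (X.secOrd Ψ p).toNat).Finite := by
  refine (finite_zeros hΨ hZ h).subset ?_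
  rintro p ⟨hp, hp'⟩
  refine ⟨hp, ?_⟩
  by_contra h0
  apply hp'
  simp [(secOrd_eq_zero_iff hΨ).2 h0]

theorem secOrd_mul (hΨ : IsSection C Ψ i j) {k l : ℕ} (hΦ : IsSection C Φ k l) (p : C.Points) :
    X.secOrd (fun x v => Ψ x v * Φ x v) p = X.secOrd Ψ p + X.secOrd Φ p :=
  analyticOrderAt_mul (analyticAt_sec hΨ p) (analyticAt_sec hΦ p)

theorem secOrd_pow (hΨ : IsSection C Ψ i j) (n : ℕ) (p : C.Points) :
    X.secOrd (fun x v => Ψ x v ^ n) p = n • X.secOrd Ψ p :=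
  analyticOrderAt_pow (analyticAt_sec hΨ p) n

theorem secDeg_mul (hΨ : IsSection C Ψ i j) {k l : ℕ} (hΦ : IsSection C Φ k l) {Z : Set C.Points}
    (hZ : IsClopen Z) (h : ∀ p ∈ Z, X.secOrd Ψ p ≠ ⊤) (h' : ∀ p ∈ Z, X.secOrd Φ p ≠ ⊤) :
    X.secDeg (fun x v => Ψ x v * Φ x v) Z = X.secDeg Ψ Z + X.secDeg Φ Z := by
  rw [secDeg, secDeg, secDeg, ← finsum_mem_add_distrib' (finite_support_secOrd hΨ hZ h)
    (finite_support_secOrd hΦ hZ h')]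
  refine finsum_mem_congr rfl fun p hp => ?_
  rw [secOrd_mul hΨ hΦ, ENat.toNat_add (h p hp) (h' p hp)]

theorem secOrd_pow_ne_top (hΨ : IsSection C Ψ i j) (n : ℕ) (h : X.secOrd Ψ p ≠ ⊤) :
    X.secOrd (fun x v => Ψ x v ^ n) p ≠ ⊤ := by
  rw [secOrd_pow hΨ]
  obtain ⟨m, hm⟩ := ENat.ne_top_iff_exists.1 h
  rw [← hm, nsmul_eq_mul]
  exact_mod_cast ENat.natCast_ne_top (n * m)

theorem secDeg_pow (hΨ : IsSection C Ψ i j) (n : ℕ) (Z : Set C.Points)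
    (h : ∀ p ∈ Z, X.secOrd Ψ p ≠ ⊤) :
    X.secDeg (fun x v => Ψ x v ^ n) Z = n * X.secDeg Ψ Z := by
  rw [secDeg, secDeg, mul_finsum_mem]
  refine finsum_mem_congr rfl fun p hp => ?_
  obtain ⟨m, hm⟩ := ENat.ne_top_iff_exists.1 (h p hp)
  rw [secOrd_pow hΨ, ← hm, nsmul_eq_mul]
  exact_mod_cast ENat.toNat_natCast (n * m)

/-- `val` at a nearby point uses the frame chosen there, the right side uses the frame at `p`. The
change of frame multiplies both sections by the same factor, which cancels. -/
theorem ratio_comp_param (hΨ : IsSection C Ψ i j) (hΦ : IsSection C Φ i j) (p : C.Points) :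
    (fun q => X.val Ψ q / X.val Φ q) ∘ X.atlas.param p =ᶠ[𝓝 0]
      (fun t => Ψ (X.arc p t) (X.vec p t)) / fun t => Φ (X.arc p t) (X.vec p t) := by
  filter_upwards [X.eventually_isRep_param p] with t ht
  obtain ⟨c, c', hc, hc', -, -, h1⟩ := ht.exists_mul (X.isRep _)
  simp only [Function.comp_apply, Pi.div_apply, val]
  rw [h1 hΨ, h1 hΦ, mul_div_mul_left _ _ (mul_ne_zero (pow_ne_zero _ hc) (pow_ne_zero _ hc'))]

theorem isMero_ratio (hΨ : IsSection C Ψ i j) (hΦ : IsSection C Φ i j) :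
    X.atlas.IsMero fun q => X.val Ψ q / X.val Φ q := fun p =>
  ((analyticAt_sec hΨ p).meromorphicAt.div (analyticAt_sec hΦ p).meromorphicAt).congr
    ((ratio_comp_param hΨ hΦ p).symm.filter_mono nhdsWithin_le_nhds)

theorem ord_ratio (hΨ : IsSection C Ψ i j) (hΦ : IsSection C Φ i j) (h : X.secOrd Ψ p ≠ ⊤)
    (h' : X.secOrd Φ p ≠ ⊤) : X.atlas.ord (fun q => X.val Ψ q / X.val Φ q) p =
      (((X.secOrd Ψ p).toNat - (X.secOrd Φ p).toNat : ℤ) : WithTop ℤ) := by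
  have hn : ∀ n : ℕ∞, n ≠ ⊤ → n.map (Nat.cast : ℕ → ℤ) = ((n.toNat : ℤ) : WithTop ℤ) := by
    intro n hn
    obtain ⟨m, rfl⟩ := ENat.ne_top_iff_exists.1 hn
    rfl
  rw [RiemannAtlas.ord,
    meromorphicOrderAt_congr ((ratio_comp_param hΨ hΦ p).filter_mono nhdsWithin_le_nhds),
    meromorphicOrderAt_div (analyticAt_sec hΨ p).meromorphicAt (analyticAt_sec hΦ p).meromorphicAt,
    (analyticAt_sec hΨ p).meromorphicOrderAt_eq, (analyticAt_sec hΦ p).meromorphicOrderAt_eq]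
  change (X.secOrd Ψ p).map _ - (X.secOrd Φ p).map _ = _
  rw [hn _ h, hn _ h']
  rfl

/-- Two sections of the same line bundle have equally many zeros. -/
theorem secDeg_eq (hΨ : IsSection C Ψ i j) (hΦ : IsSection C Φ i j) {Z : Set C.Points}
    (hZ : IsClopen Z) (h : ∀ p ∈ Z, X.secOrd Ψ p ≠ ⊤) (h' : ∀ p ∈ Z, X.secOrd Φ p ≠ ⊤) :
    X.secDeg Ψ Z = X.secDeg Φ Z := by
  have hord := fun p hp => ord_ratio hΨ hΦ (h p hp) (h' p hp)
  have h0 := RiemannAtlas.finsum_ord_eq_zero (isMero_ratio (X := X) hΨ hΦ) hZ fun p hp => by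
    rw [hord p hp]
    exact WithTop.coe_ne_top
  have hs := finite_support_secOrd hΨ hZ h
  have hs' := finite_support_secOrd hΦ hZ h'
  have hcast : ∀ {Ψ : V → V → ℂ}, (Z ∩ Function.support fun p => (X.secOrd Ψ p).toNat).Finite →
      ((X.secDeg Ψ Z : ℕ) : ℤ) = ∑ᶠ p ∈ Z, ((X.secOrd Ψ p).toNat : ℤ) ∧
      (Z ∩ Function.support fun p => ((X.secOrd Ψ p).toNat : ℤ)).Finite := by
    intro Ψ hs
    refine ⟨(Nat.castAddMonoidHom ℤ).map_finsum_mem' hs, hs.subset ?_⟩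
    rintro p ⟨hp, hp'⟩
    refine ⟨hp, fun h0 => hp' ?_⟩
    simp only at h0
    simp [h0]
  obtain ⟨h1, h2⟩ := hcast hs
  obtain ⟨h3, h4⟩ := hcast hs'
  have h5 : ((X.secDeg Ψ Z : ℕ) : ℤ) = X.secDeg Φ Z := by
    rw [h1, h3]
    have h6 : ∑ᶠ p ∈ Z, (((X.secOrd Ψ p).toNat : ℤ) - (X.secOrd Φ p).toNat) = 0 := by
      rw [← h0]
      refine finsum_mem_congr rfl fun p hp => ?_
      rw [hord p hp]
      rfl
    have h7 : (Z ∩ Function.support fun p =>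
        ((X.secOrd Ψ p).toNat : ℤ) - (X.secOrd Φ p).toNat).Finite := by
      refine (h2.union h4).subset ?_
      rintro p ⟨hp, hp'⟩
      by_contra hcon
      simp only [Set.mem_union, Set.mem_inter_iff, Function.mem_support, hp, true_and, not_or,
        not_not] at hcon
      exact hp' (by simp only [hcon.1, hcon.2, sub_self])
    have h8 := finsum_mem_add_distrib' h7 h4
    rw [h6, zero_add] at h8
    rw [← h8]
    exact finsum_mem_congr rfl fun p _ => by ring
  exact_mod_cast h5

theorem secDeg_eq_sum (hΨ : IsSection C Ψ i j) {Z : Set C.Points} (hZ : IsClopen Z)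
    (h : ∀ p ∈ Z, X.secOrd Ψ p ≠ ⊤) :
    X.secDeg Ψ Z = ∑ p ∈ (finite_zeros hΨ hZ h).toFinset, (X.secOrd Ψ p).toNat := by
  rw [secDeg, ← finsum_mem_eq_finite_toFinset_sum]
  refine finsum_mem_inter_support_eq' _ _ _ fun p hp => ⟨fun hZ' => ⟨hZ', ?_⟩, fun h' => h'.1⟩
  by_contra h0
  apply hp
  simp [(secOrd_eq_zero_iff hΨ).2 h0]

theorem card_le_secDeg (hΨ : IsSection C Ψ i j) {Z : Set C.Points} (hZ : IsClopen Z)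
    (h : ∀ p ∈ Z, X.secOrd Ψ p ≠ ⊤) {T : Set C.Points} (hT : ∀ p ∈ T, p ∈ Z ∧ X.val Ψ p = 0) :
    T.ncard ≤ X.secDeg Ψ Z := by
  have hf := finite_zeros hΨ hZ h
  rw [secDeg_eq_sum hΨ hZ h]
  have hTs : T ⊆ {p ∈ Z | X.val Ψ p = 0} := hT
  refine (Set.ncard_le_ncard hTs hf).trans ?_
  rw [Set.ncard_eq_toFinset_card _ hf, Finset.card_eq_sum_ones]
  refine Finset.sum_le_sum fun p hp => Nat.one_le_iff_ne_zero.2 fun h0 => ?_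
  obtain ⟨hp1, hp2⟩ := hf.mem_toFinset.1 hp
  rcases ENat.toNat_eq_zero.1 h0 with h1 | h1
  · exact (secOrd_eq_zero_iff hΨ).1 h1 hp2
  · exact h p hp1 h1

theorem ncard_eq_secDeg (hΨ : IsSection C Ψ i j) {Z : Set C.Points} (hZ : IsClopen Z)
    (h : ∀ p ∈ Z, X.secOrd Ψ p ≠ ⊤) (h1 : ∀ p ∈ Z, X.val Ψ p = 0 → X.secOrd Ψ p = 1) :
    {p ∈ Z | X.val Ψ p = 0}.ncard = X.secDeg Ψ Z := by
  have hf := finite_zeros hΨ hZ h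
  rw [secDeg_eq_sum hΨ hZ h, Set.ncard_eq_toFinset_card _ hf, Finset.card_eq_sum_ones]
  refine Finset.sum_congr rfl fun p hp => ?_
  obtain ⟨hp1, hp2⟩ := hf.mem_toFinset.1 hp
  rw [h1 p hp1 hp2]
  rfl

end LineField

end PlaneCurves

end

/-! ### Pencils of lines. -/

section

open scoped Topology Matrix
open MvPolynomial PlaneCurves Filter

namespace PlaneCurves

theorem exists_combination_of_dot_cross {u v x : V} (h : LinearIndependent ℂ ![u, v])
    (hx : x ⬝ᵥ (u ⨯₃ v) = 0) : ∃ a b : ℂ, x = a • u + b • v := by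
  by_contra hcon
  have hx' : x ∉ Submodule.span ℂ (Set.range ![u, v]) := by
    intro hu
    rw [Matrix.range_cons, Matrix.range_cons, Matrix.range_empty, Set.union_empty,
      Set.singleton_union, Submodule.mem_span_pair] at hu
    obtain ⟨α, β, h⟩ := hu
    exact hcon ⟨α, β, h.symm⟩
  have hli : LinearIndependent ℂ (Matrix.of ![x, u, v]).row := linearIndependent_finCons.2 ⟨h, hx'⟩
  rw [Matrix.linearIndependent_rows_iff_isUnit, Matrix.isUnit_iff_isUnit_det, isUnit_iff_ne_zero] at hli
  rw [triple_product_eq_det] at hx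
  exact hli hx

/-- The lines through the first row of a matrix. -/
noncomputable def pencil (M : GL (Fin 3) ℂ) (s : ℂ) : V := M.1 0 ⨯₃ (s • M.1 1 + M.1 2)

theorem pencil_eq (M : GL (Fin 3) ℂ) (s : ℂ) :
    pencil M s = s • (M.1 0 ⨯₃ M.1 1) + M.1 0 ⨯₃ M.1 2 := by
  rw [pencil, map_add, map_smul]

theorem linearIndependent_pencil (M : GL (Fin 3) ℂ) (s : ℂ) :
    LinearIndependent ℂ ![M.1 0, s • M.1 1 + M.1 2] := by
  rw [LinearIndependent.pair_iff]
  intro a b h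
  have h1 : ![a, b * s, b] ᵥ* M.1 = 0 := by
    rw [cons_vecMul, ← h]
    module
  have h2 : ![a, b * s, b] = 0 := by
    by_contra hne
    exact vecMul_ne_zero M hne h1
  exact ⟨congrFun h2 0, congrFun h2 2⟩

theorem pencil_ne_zero (M : GL (Fin 3) ℂ) (s : ℂ) : pencil M s ≠ 0 :=
  crossProduct_ne_zero_iff_linearIndependent.2 (linearIndependent_pencil M s)

theorem first_dot_pencil (M : GL (Fin 3) ℂ) (s : ℂ) : M.1 0 ⬝ᵥ pencil M s = 0 := dot_self_cross _ _

variable {M : GL (Fin 3) ℂ} {G : MvPolynomial (Fin 3) ℂ} {e : ℕ}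

/-- The vector `pencil M s` is the equation of the line joining row `0` to `s • M 1 + M 2`. The
points of that line other than the centre are the `finitePt M T s`, and the centre is not on the
curve. -/
theorem dot_pencil_eq_zero_iff (hG : G.IsHomogeneous e) (he : 0 < e) (hM : eval (M.1 0) G ≠ 0)
    {y : V} (hy : y ≠ 0) (hyG : eval y G = 0) (s : ℂ) :
    y ⬝ᵥ pencil M s = 0 ↔ ∃ T, Projectivization.mk ℂ y hy = finitePt M T s := by
  constructor
  · intro h
    obtain ⟨a, b, hab⟩ := exists_combination_of_dot_cross (linearIndependent_pencil M s) h
    have hb : b ≠ 0 := by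
      rintro rfl
      rw [zero_smul, add_zero] at hab
      rw [hab, eval_smul_of_isHomogeneous hG, mul_eq_zero, or_iff_left hM] at hyG
      rw [pow_eq_zero_iff he.ne'] at hyG
      exact hy (by rw [hab, hyG, zero_smul])
    refine ⟨a / b, ?_⟩
    rw [finitePt, Projectivization.mk_eq_mk_iff']
    refine ⟨b, ?_⟩
    rw [cons_vecMul, one_smul, hab, smul_add, smul_add, smul_smul, mul_div_cancel₀ _ hb, smul_add,
      add_assoc]
  · rintro ⟨T, hT⟩
    rw [finitePt, Projectivization.mk_eq_mk_iff'] at hT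
    obtain ⟨c, hc⟩ := hT
    rw [← hc, smul_dotProduct, cons_vecMul, one_smul, add_assoc, add_dotProduct, smul_dotProduct,
      first_dot_pencil, pencil, dot_cross_self]
    simp

theorem rep_dot_pencil_iff (hG : G.IsHomogeneous e) (he : 0 < e) (hM : eval (M.1 0) G ≠ 0)
    {p : P2} (hp : p ∈ zeroLocus G) (s : ℂ) :
    p.rep ⬝ᵥ pencil M s = 0 ↔ ∃ T, p = finitePt M T s := by
  rw [dot_pencil_eq_zero_iff hG he hM p.rep_nonzero hp, Projectivization.mk_rep]

theorem ncard_zeroLocus_pencil (hG : G.IsHomogeneous e) (he : 0 < e) (hM : eval (M.1 0) G ≠ 0)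
    (s : ℂ) : {p ∈ zeroLocus G | p.rep ⬝ᵥ pencil M s = 0}.ncard =
      {T | finitePt M T s ∈ zeroLocus G}.ncard := by
  rw [← Set.ncard_image_of_injective _ (f := fun T => finitePt M T s)
    fun T T' h => (finitePt_injective M h).1]
  congr 1
  ext p
  constructor
  · rintro ⟨h1, h2⟩
    obtain ⟨T, rfl⟩ := (rep_dot_pencil_iff hG he hM h1 s).1 h2
    exact ⟨T, h1, rfl⟩
  · rintro ⟨T, h1, rfl⟩
    exact ⟨h1, (rep_dot_pencil_iff hG he hM h1 s).2 ⟨T, rfl⟩⟩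

theorem finite_zeroLocus_pencil (hG : G.IsHomogeneous e) (he : 0 < e) (hM : eval (M.1 0) G ≠ 0)
    (s : ℂ) : {p ∈ zeroLocus G | p.rep ⬝ᵥ pencil M s = 0}.Finite := by
  have h := (finite_roots (isHomogeneous_subst M.1 hG) (by rwa [eval_subst_first]) ![s, 1]).image
    fun T => finitePt M T s
  refine h.subset ?_
  rintro p ⟨h1, h2⟩
  obtain ⟨T, rfl⟩ := (rep_dot_pencil_iff hG he hM h1 s).1 h2
  exact ⟨T, (finitePt_mem_zeroLocus hG M T s).1 h1, rfl⟩

/-- A finite set of points meets finitely many lines of a pencil only. -/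
theorem finite_lines_meeting (hG : G.IsHomogeneous e) (he : 0 < e) (hM : eval (M.1 0) G ≠ 0)
    {B : Set P2} (hB : B.Finite) (hBG : B ⊆ zeroLocus G) :
    {s | ∃ b ∈ B, b.rep ⬝ᵥ pencil M s = 0}.Finite := by
  have h : {s | ∃ b ∈ B, b.rep ⬝ᵥ pencil M s = 0} =
      ⋃ b ∈ B, {s | b.rep ⬝ᵥ pencil M s = 0} := by
    ext s
    simp
  rw [h]
  refine hB.biUnion fun b hb => Set.Subsingleton.finite ?_
  intro s hs s' hs'
  obtain ⟨T, hT⟩ := (rep_dot_pencil_iff hG he hM (hBG hb) s).1 hs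
  obtain ⟨T', hT'⟩ := (rep_dot_pencil_iff hG he hM (hBG hb) s').1 hs'
  exact (finitePt_injective M (hT.symm.trans hT')).2

/-- The points of a curve on the lines of a pencil near a given point of the curve. -/
theorem eventually_exists_root (hG : G.IsHomogeneous e) (hM : eval (M.1 0) G ≠ 0)
    (h2 : eval (M.1 2) G = 0) {ε : ℝ} (hε : 0 < ε) :
    ∀ᶠ s in 𝓝 (0 : ℂ), ∃ T : ℂ, ‖T‖ < ε ∧ eval (![T, s, 1] ᵥ* M.1) G = 0 := by
  have hG' := isHomogeneous_subst M.1 hG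
  have hM' : eval ![1, 0, 0] (subst M.1 G) ≠ 0 := by rwa [eval_subst_first]
  have hcont : Continuous fun s : ℂ => eval (s • M.1 1 + M.1 2) G := by
    have h3 : Continuous fun x : V => eval x G := MvPolynomial.continuous_eval G
    exact h3.comp (by fun_prop)
  have hlim : Tendsto (fun s : ℂ => ‖eval (s • M.1 1 + M.1 2) G‖) (𝓝 0) (𝓝 0) := by
    refine hcont.norm.tendsto' _ _ ?_
    rw [zero_smul, zero_add, h2, norm_zero]
  have hpos : 0 < ‖eval (M.1 0) G‖ * ε ^ e := mul_pos (norm_pos_iff.2 hM) (pow_pos hε e)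
  filter_upwards [hlim.eventually_lt_const hpos] with s hs
  set p := (inFirst (subst M.1 G)).map (eval ![s, 1]) with hp
  have hdeg : p.natDegree = e := natDegree_map_inFirst hG' hM' ![s, 1]
  have hroot : ∀ T, p.eval T = eval (![T, s, 1] ᵥ* M.1) G := fun T => by
    rw [hp, ← eval_cons_eq, ← eval_subst]
    rfl
  have hlead : p.leadingCoeff = eval (M.1 0) G := by
    rw [Polynomial.leadingCoeff, hdeg, hp, Polynomial.coeff_map, coeff_inFirst hG', eval_C,
      eval_subst_first]
  have hspl : p.Splits := IsAlgClosed.splits p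
  -- Up to sign the constant coefficient is the leading coefficient times the product of the roots.
  -- The former tends to `0` with `s` and the latter coefficient is fixed, so not all `e` roots can
  -- stay outside the disc of radius `ε`.
  have h0 := hspl.coeff_zero_eq_leadingCoeff_mul_prod_roots
  rw [Polynomial.coeff_zero_eq_eval_zero, hroot, cons_vecMul, zero_smul, zero_add, one_smul, hlead,
    hdeg] at h0
  by_contra! hcon
  have hge : ∀ m : Multiset ℂ, (∀ T ∈ m, ε ≤ ‖T‖) → ε ^ m.card ≤ ‖m.prod‖ := by
    intro m
    induction m using Multiset.induction_on with
    | empty => simp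
    | cons a m ih =>
      intro h
      rw [Multiset.card_cons, Multiset.prod_cons, norm_mul, pow_succ, mul_comm]
      exact mul_le_mul (h a (Multiset.mem_cons_self a m))
        (ih fun T hT => h T (Multiset.mem_cons_of_mem hT)) (by positivity) (norm_nonneg _)
  have h3 := hge p.roots fun T hT => by
    by_contra! h4
    exact hcon T h4 (by rw [← hroot]; exact (Polynomial.mem_roots'.1 hT).2)
  rw [← hspl.natDegree_eq_card_roots, hdeg] at h3
  rw [h0] at hs
  simp only [norm_mul, norm_pow, norm_neg, norm_one, one_pow, one_mul] at hs
  exact absurd hs (not_lt.2 (mul_le_mul_of_nonneg_left h3 (norm_nonneg _)))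

end PlaneCurves

end

/-! ### Irreducibility and connectedness of a smooth plane curve. -/

section

open scoped Topology Matrix
open MvPolynomial PlaneCurves Filter

namespace PlaneCurves

theorem RiemannAtlas.infinite_of_mem_nhds {S : Type*} [TopologicalSpace S] (A : RiemannAtlas S)
    {p : S} {U : Set S} (hU : U ∈ 𝓝 p) : U.Infinite := by
  obtain ⟨W, hW, hinj⟩ := A.injOn p
  rw [← A.map_nhds p, mem_map] at hU
  have h1 : (W ∩ A.param p ⁻¹' U).Infinite := _root_.infinite_of_mem_nhds (0 : ℂ) (inter_mem hW hU)
  have h2 := h1.image (hinj.mono Set.inter_subset_left)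
  refine h2.mono ?_
  rintro _ ⟨t, ht, rfl⟩
  exact ht.2

namespace SmoothPlaneCurve

variable {d : ℕ} (C : SmoothPlaneCurve d)

theorem F_ne_zero : C.F ≠ 0 := by
  intro h
  obtain ⟨i, hi⟩ := C.smooth ![1, 0, 0] (fun h => by simpa using congrFun h 0) (by rw [h, map_zero])
  apply hi
  rw [h, map_zero, map_zero]

/-- By the product rule all partial derivatives of `P Q` vanish at a common zero, against
smoothness. -/
theorem not_common_zero {P Q : MvPolynomial (Fin 3) ℂ} (h : C.F = P * Q) {x : V} (hx : x ≠ 0)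
    (hP : eval x P = 0) : eval x Q ≠ 0 := by
  intro hQ
  obtain ⟨i, hi⟩ := C.smooth x hx (by rw [h, map_mul, hP, zero_mul])
  apply hi
  rw [h, Derivation.leibniz, smul_eq_mul, smul_eq_mul, map_add, map_mul, map_mul, hP, hQ, zero_mul,
    zero_mul, add_zero]

theorem squarefree_F : Squarefree C.F := by
  rintro P ⟨Q, hQ⟩
  by_contra hP
  have hne : P * (P * Q) ≠ 0 := by
    rw [← mul_assoc, ← hQ]
    exact C.F_ne_zero
  have hhom : (P * (P * Q)).IsHomogeneous d := by
    rw [← mul_assoc, ← hQ]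
    exact C.homogeneous
  obtain ⟨a, b, ha, -, -⟩ := IsHomogeneous.exists_of_mul hhom hne
  have ha0 := pos_degree_of_not_isUnit ha (left_ne_zero_of_mul hne) hP
  obtain ⟨p, hp⟩ := exists_zero_of_isHomogeneous ha0 ha
  refine C.not_common_zero (P := P) (Q := P * Q) (by rw [hQ, mul_assoc]) p.rep_nonzero hp ?_
  rw [map_mul, show eval p.rep P = 0 from hp, zero_mul]

end SmoothPlaneCurve

namespace LineField

open SmoothPlaneCurve

variable {d : ℕ} {C : SmoothPlaneCurve d} {X : LineField C} {Ψ Φ : V → V → ℂ} {i j : ℕ}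
  {p : C.Points}

theorem secOrd_ne_top_of_finite (hΨ : IsSection C Ψ i j) {Z : Set C.Points} (hZ : IsOpen Z)
    (h : {p ∈ Z | X.val Ψ p = 0}.Finite) : ∀ p ∈ Z, X.secOrd Ψ p ≠ ⊤ := by
  intro p hp htop
  have h1 := (secOrd_eq_top_iff hΨ).1 htop
  exact X.atlas.infinite_of_mem_nhds (inter_mem (hZ.mem_nhds hp) h1) h

theorem isOpen_val_ne_zero (hΨ : IsSection C Ψ i j) : IsOpen {p | X.val Ψ p ≠ 0} := by
  rw [isOpen_iff_eventually]
  intro p hp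
  have h1 := eventually_val_ne_zero hΨ (p := p) (by
    rw [(secOrd_eq_zero_iff hΨ).2 hp]
    exact ENat.zero_ne_top)
  filter_upwards [eventually_nhdsWithin_iff.1 h1] with q hq
  by_cases hqp : q = p
  · rwa [hqp]
  · exact hq hqp

theorem val_form_eq_zero_iff {H : MvPolynomial (Fin 3) ℂ} {k : ℕ} (hH : H.IsHomogeneous k) :
    X.val (fun x _ => eval x H) p = 0 ↔ p.1 ∈ zeroLocus H := by
  rw [eq_mk_of_mem (X.isRep p).ne_zero (X.isRep p).mem, mk_mem_zeroLocus hH]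
  rfl

theorem val_linear_eq_zero_iff (w : V) :
    X.val (fun x _ => x ⬝ᵥ w) p = 0 ↔ p.1.rep ⬝ᵥ w = 0 := by
  have h := eq_mk_of_mem (X.isRep p).ne_zero (X.isRep p).mem
  obtain ⟨c, hc, h1⟩ := rep_mk (X.isRep p).ne_zero
  rw [h, h1, smul_dotProduct, smul_eq_mul, mul_eq_zero, or_iff_right hc]
  rfl

/-- A line that is not tangent to the curve at a point meets the curve with multiplicity one. -/
theorem secOrd_linear_eq_one {u w : V} (hw : w ≠ 0) (huw : u ⬝ᵥ w = 0)
    (h0 : X.val (fun x _ => x ⬝ᵥ w) p = 0) (hu : C.dF (X.arc p 0) u ≠ 0) :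
    X.secOrd (fun x _ => x ⬝ᵥ w) p = 1 := by
  have hγ := (X.isLocalFrame p).isArc
  have hder : HasDerivAt (fun t => X.arc p t ⬝ᵥ w) (deriv (X.arc p) 0 ⬝ᵥ w) 0 := by
    have h1 := hasDerivAt_pi.1 hγ.analytic.differentiableAt.hasDerivAt
    exact HasDerivAt.fun_sum fun i _ => (h1 i).mul_const (w i)
  refine AnalyticAt.analyticOrderAt_eq_one_of_zero_deriv_ne_zero
    (analyticAt_sec (IsSection.linear w) p) h0 ?_
  rw [hder.deriv]
  intro h1
  -- A vanishing derivative would make `w` a multiple of `γ × γ'`. As `u` is on the line `w`, it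
  -- would be a combination of `γ` and `γ'` and be killed by `dF`.
  obtain ⟨c, hc⟩ := exists_eq_smul_cross (a := w) hγ.immersed (by rw [dotProduct_comm]; exact h0)
    (by rw [dotProduct_comm]; exact h1)
  have hc0 : c ≠ 0 := by
    rintro rfl
    exact hw (by rw [hc, zero_smul])
  rw [hc, dotProduct_smul, smul_eq_mul, mul_eq_zero, or_iff_right hc0] at huw
  obtain ⟨a, b, hab⟩ := exists_combination_of_dot_cross hγ.immersed huw
  apply hu
  rw [hab, dF_add, dF_smul, dF_smul, hγ.dF_deriv, C.dF_self_eq_zero (X.isRep p).eval_eq_zero]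
  simp

/-- There is a line in general position that meets a given infinite set of points of the curve. -/
theorem exists_good_line (X : LineField C) (hd : 0 < d) {W : Set C.Points} (hW : W.Infinite) :
    ∃ w : V, (∀ p, X.secOrd (fun x _ => x ⬝ᵥ w) p ≠ ⊤) ∧
      X.secDeg (fun x _ => x ⬝ᵥ w) Set.univ = d ∧ ∃ p ∈ W, X.val (fun x _ => x ⬝ᵥ w) p = 0 := by
  obtain ⟨M, hM⟩ := exists_GL_eval_ne_zero C.F_ne_zero
  obtain ⟨A, hA, hgood⟩ := finite_bad_lines M C.homogeneous C.squarefree_F hM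
  have hfin := finite_points_on_lines M C.homogeneous hM hA
  obtain ⟨p, hpW, hp⟩ : ∃ p ∈ W, ∃ T s, p.1 = finitePt M T s ∧ s ∉ A := by
    by_contra! hcon
    refine hW (Set.Finite.of_finite_image (f := Subtype.val) (hfin.subset ?_)
      Subtype.val_injective.injOn)
    rintro _ ⟨p, hp, rfl⟩
    exact ⟨p.2, fun T s h => by_contra fun h' => h' (hcon p hp T s h)⟩
  obtain ⟨T, s, hpT, hs⟩ := hp
  obtain ⟨hcard, htrans⟩ := hgood s hs
  have hzero : {p ∈ (Set.univ : Set C.Points) | X.val (fun x _ => x ⬝ᵥ pencil M s) p = 0} =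
      Subtype.val ⁻¹' {p ∈ zeroLocus C.F | p.rep ⬝ᵥ pencil M s = 0} := by
    ext q
    simp only [Set.mem_univ, true_and, Set.mem_ofPred_eq, Set.mem_preimage, val_linear_eq_zero_iff]
    exact ⟨fun h => ⟨q.2, h⟩, fun h => h.2⟩
  have hfin' : {p ∈ (Set.univ : Set C.Points) | X.val (fun x _ => x ⬝ᵥ pencil M s) p = 0}.Finite := by
    rw [hzero]
    exact (finite_zeroLocus_pencil C.homogeneous hd hM s).preimage Subtype.val_injective.injOn
  have hord := secOrd_ne_top_of_finite (X := X) (IsSection.linear _) isOpen_univ hfin'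
  refine ⟨pencil M s, fun p => hord p trivial, ?_, p, hpW, ?_⟩
  · rw [← ncard_eq_secDeg (IsSection.linear _) isClopen_univ hord, hzero,
      Set.ncard_preimage_of_injective_subset_range Subtype.val_injective,
      ncard_zeroLocus_pencil C.homogeneous hd hM, hcard]
    · rw [Subtype.range_coe]
      exact fun q hq => hq.1
    · intro q _ hq
      refine secOrd_linear_eq_one (pencil_ne_zero M s) (first_dot_pencil M s) hq ?_
      have hq1 := (dot_pencil_eq_zero_iff C.homogeneous hd hM (X.isRep q).ne_zero
        (X.isRep q).eval_eq_zero s).1 hq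
      obtain ⟨T, hT⟩ := hq1
      have hq2 := htrans T (by
        rw [← hT, mk_mem_zeroLocus C.homogeneous]
        exact (X.isRep q).eval_eq_zero)
      rw [finitePt, Projectivization.mk_eq_mk_iff'] at hT
      obtain ⟨c, hc⟩ := hT
      rw [← hc, dF_smul_left]
      refine mul_ne_zero (pow_ne_zero _ ?_) hq2
      rintro rfl
      exact (X.isRep q).ne_zero (by rw [← hc, zero_smul])
  · rw [val_linear_eq_zero_iff, rep_dot_pencil_iff C.homogeneous hd hM p.2]
    exact ⟨T, hpT⟩

theorem secDeg_pos {Z : Set C.Points} (hZ : IsClopen Z) (hΨ : IsSection C Ψ i j)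
    (h : ∀ p ∈ Z, X.secOrd Ψ p ≠ ⊤) (hp : p ∈ Z) (h0 : X.val Ψ p = 0) : 0 < X.secDeg Ψ Z := by
  have h1 := card_le_secDeg hΨ hZ h (T := {p}) (by
    rintro q rfl
    exact ⟨hp, h0⟩)
  rwa [Set.ncard_singleton] at h1

theorem secDeg_add_compl {Z : Set C.Points} (hZ : IsClopen Z) (hΨ : IsSection C Ψ i j)
    (h : ∀ p, X.secOrd Ψ p ≠ ⊤) : X.secDeg Ψ Z + X.secDeg Ψ Zᶜ = X.secDeg Ψ Set.univ := by
  rw [secDeg, secDeg, secDeg, ← Set.union_compl_self Z]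
  exact (finsum_mem_union' disjoint_compl_right (finite_support_secOrd hΨ hZ fun p _ => h p)
    (finite_support_secOrd hΨ hZ.compl fun p _ => h p)).symm

/-- If `F = P Q`, smoothness separates the zeros of `P` from those of `Q`, so the zeros of `P` form
an open and closed part `Z`. On `Z` the section `Q` of degree `b` has no zeros, whereas `(x · w) ^
b` has some for a line `w` meeting `Z`. -/
theorem irreducible_F (X : LineField C) (hd : 0 < d) : Irreducible C.F := by
  refine ⟨fun hu => ?_, fun P Q hPQ => ?_⟩
  · obtain ⟨p, hp⟩ := exists_zero_of_isHomogeneous hd C.homogeneous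
    have h1 := hu.map (eval p.rep)
    rw [show eval p.rep C.F = 0 from hp] at h1
    exact not_isUnit_zero h1
  by_contra! hcon
  have hne : P * Q ≠ 0 := by
    rw [← hPQ]
    exact C.F_ne_zero
  have hhom : (P * Q).IsHomogeneous d := by
    rw [← hPQ]
    exact C.homogeneous
  obtain ⟨a, b, ha, hb, -⟩ := IsHomogeneous.exists_of_mul hhom hne
  have ha0 := pos_degree_of_not_isUnit ha (left_ne_zero_of_mul hne) hcon.1
  have hb0 := pos_degree_of_not_isUnit hb (right_ne_zero_of_mul hne) hcon.2
  set Z : Set C.Points := {p | X.val (fun x _ => eval x P) p = 0}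
  have hQ : ∀ p ∈ Z, X.val (fun x _ => eval x Q) p ≠ 0 := fun p hp =>
    C.not_common_zero hPQ (X.isRep p).ne_zero hp
  have hZ : IsClopen Z := by
    constructor
    · rw [← isOpen_compl_iff]
      exact isOpen_val_ne_zero (IsSection.form ha)
    · have h1 : Z = {p | X.val (fun x _ => eval x Q) p ≠ 0} := by
        ext p
        refine ⟨hQ p, fun hp => ?_⟩
        have h2 := (X.isRep p).eval_eq_zero
        rw [hPQ, map_mul, mul_eq_zero] at h2
        exact h2.resolve_right hp
      rw [h1]
      exact isOpen_val_ne_zero (IsSection.form hb)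
  obtain ⟨p, hp⟩ := exists_zero_of_isHomogeneous ha0 ha
  have hpF : p ∈ zeroLocus C.F := by
    change eval p.rep C.F = 0
    rw [hPQ, map_mul, show eval p.rep P = 0 from hp, zero_mul]
  have hpZ : (⟨p, hpF⟩ : C.Points) ∈ Z := (val_form_eq_zero_iff ha).2 hp
  obtain ⟨w, hw, -, q, hq, hqw⟩ := X.exists_good_line hd
    (X.atlas.infinite_of_mem_nhds (hZ.2.mem_nhds hpZ))
  have hQord : ∀ p ∈ Z, X.secOrd (fun x _ => eval x Q) p = 0 := fun p hp =>
    (secOrd_eq_zero_iff (IsSection.form hb)).2 (hQ p hp)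
  have hl := (IsSection.linear (C := C) w).pow b
  rw [one_mul, zero_mul] at hl
  have h1 := secDeg_eq hl (IsSection.form hb) hZ
    (fun p _ => secOrd_pow_ne_top (IsSection.linear w) b (hw p)) fun p hp => by
      rw [hQord p hp]
      exact ENat.zero_ne_top
  rw [secDeg_pow (IsSection.linear w) b Z fun p _ => hw p] at h1
  have h2 : X.secDeg (fun x _ => eval x Q) Z = 0 := by
    rw [secDeg]
    refine finsum_mem_eq_zero_of_forall_eq_zero fun p hp => ?_
    rw [hQord p hp]
    rfl
  rw [h2] at h1
  have h3 := secDeg_pos hZ (IsSection.linear w) (fun p _ => hw p) hq hqw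
  exact (Nat.mul_pos hb0 h3).ne' h1

/-- If `Z` and its complement were nonempty and open, some line would have `D < d` intersections
with the curve in `Z`, so a form of degree `k` not divisible by `F` would have `k D` zeros in `Z`.
Interpolation produces too many. -/
theorem preconnectedSpace (X : LineField C) (hd : 0 < d) : PreconnectedSpace C.Points := by
  rw [preconnectedSpace_iff_clopen]
  intro Z hZ
  by_contra! hcon
  obtain ⟨p, hp⟩ := hcon.1
  obtain ⟨p', hp'⟩ : Zᶜ.Nonempty := by
    rw [Set.nonempty_compl]
    exact hcon.2
  obtain ⟨w, hw, hwd, q, hq, hqw⟩ := X.exists_good_line hd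
    (X.atlas.infinite_of_mem_nhds (hZ.compl.2.mem_nhds hp'))
  have hlin := IsSection.linear (C := C) w
  have h1 := secDeg_add_compl hZ hlin hw
  have h2 := secDeg_pos hZ.compl hlin (fun p _ => hw p) hq hqw
  have hinf := X.atlas.infinite_of_mem_nhds (hZ.2.mem_nhds hp)
  have hinf' : (Subtype.val '' Z : Set P2).Infinite := hinf.image Subtype.val_injective.injOn
  -- With `n = d² + 2`, a form of degree `n + d` passes through `n d - 1` points of `Z`, but has at
  -- most `(n + d)(d - 1) = n d - d - 2` zeros there.
  obtain ⟨B, hB, hBcard⟩ := hinf'.exists_subset_card_eq ((d ^ 2 + 2) * d - 1)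
  have hpos : 0 < (d ^ 2 + 2) * d := by positivity
  obtain ⟨H, hH, hHB, hdvd⟩ := exists_form_through C.homogeneous C.F_ne_zero (n := d ^ 2 + 2) B
    (by omega)
  have hfin := finite_common_zeros C.homogeneous hH (X.irreducible_F hd) hdvd
  have hHord : ∀ p ∈ Z, X.secOrd (fun x _ => eval x H) p ≠ ⊤ := by
    refine secOrd_ne_top_of_finite (IsSection.form hH) hZ.2 ?_
    refine Set.Finite.of_finite_image (f := Subtype.val) (hfin.subset ?_)
      Subtype.val_injective.injOn
    rintro _ ⟨q, ⟨-, hq⟩, rfl⟩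
    exact ⟨q.2, (val_form_eq_zero_iff hH).1 hq⟩
  have hl := hlin.pow (d ^ 2 + 2 + d)
  rw [one_mul, zero_mul] at hl
  have h3 := secDeg_eq hl (IsSection.form hH) hZ
    (fun p _ => secOrd_pow_ne_top hlin _ (hw p)) hHord
  rw [secDeg_pow hlin _ Z fun p _ => hw p] at h3
  have h4 := card_le_secDeg (IsSection.form hH) hZ hHord (T := Subtype.val ⁻¹' (B : Set P2)) (by
    intro q hq
    obtain ⟨q', hq', hqq⟩ := hB hq
    rw [Subtype.val_injective hqq] at hq'
    exact ⟨hq', (val_form_eq_zero_iff hH).2 (hHB _ hq)⟩)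
  rw [Set.ncard_preimage_of_injective_subset_range Subtype.val_injective, Set.ncard_coe_finset,
    hBcard, ← h3] at h4
  · obtain ⟨D, hD⟩ : ∃ D, X.secDeg (fun x _ => x ⬝ᵥ w) Z = D := ⟨_, rfl⟩
    rw [hD] at h1 h4
    obtain ⟨m, rfl⟩ : ∃ m, d = D + m := ⟨d - D, by omega⟩
    have hm : 0 < m := by omega
    have h5 : ((D + m) ^ 2 + 2) * (D + m) ≤ ((D + m) ^ 2 + 2 + (D + m)) * D + 1 := by omega
    nlinarith [Nat.mul_le_mul_left ((D + m) ^ 2 + 2) (show 1 ≤ m from hm), Nat.zero_le (D * m), Nat.zero_le (m ^ 2)]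
  · rw [Subtype.range_coe]
    intro b hb
    obtain ⟨q, -, rfl⟩ := hB hb
    exact q.2

/-- The identity principle for sections on a connected curve. -/
theorem dichotomy (X : LineField C) (hd : 0 < d) (hΨ : IsSection C Ψ i j) :
    (∀ p, X.val Ψ p = 0) ∨ ∀ p, X.secOrd Ψ p ≠ ⊤ := by
  have := X.preconnectedSpace hd
  rcases isClopen_iff.1 (isClopen_secOrd_eq_top (X := X) hΨ) with h | h
  · right
    intro p hp
    have : p ∈ (∅ : Set C.Points) := by
      rw [← h]
      exact hp
    exact this
  · left
    intro p
    have hp : X.secOrd Ψ p = ⊤ := by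
      have : p ∈ {p | X.secOrd Ψ p = ⊤} := by
        rw [h]
        trivial
      exact this
    exact ((secOrd_eq_top_iff hΨ).1 hp).self_of_nhds

end LineField

end PlaneCurves

end

/-! ### The Gauss map, its finite fibres, and the tangency formula in terms of `m`. -/

section

open scoped Topology Matrix
open MvPolynomial PlaneCurves Filter

namespace PlaneCurves

namespace LineField

open SmoothPlaneCurve

variable {d : ℕ} {C : SmoothPlaneCurve d} {X : LineField C} {Ψ Φ : V → V → ℂ} {i j : ℕ}
  {p : C.Points}

theorem gaussMap_mem_zeroLocus_iff {H : MvPolynomial (Fin 3) ℂ} {k : ℕ} (hH : H.IsHomogeneous k) :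
    X.gaussMap p ∈ zeroLocus H ↔ X.val (fun x v => eval (x ⨯₃ v) H) p = 0 := by
  rw [(X.isRep p).gaussMap_eq, mk_mem_zeroLocus hH]
  rfl

theorem gaussMap_dot_iff (w : V) :
    (X.gaussMap p).rep ⬝ᵥ w = 0 ↔ X.val (fun x v => (x ⨯₃ v) ⬝ᵥ w) p = 0 := by
  obtain ⟨c, hc, h1⟩ := rep_mk (X.isRep p).cross_ne_zero
  rw [(X.isRep p).gaussMap_eq, h1, smul_dotProduct, smul_eq_mul, mul_eq_zero, or_iff_right hc]
  rfl

theorem continuous_gaussMap (X : LineField C) : Continuous X.gaussMap := by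
  rw [continuous_iff_continuousAt]
  intro p
  rw [ContinuousAt, ← X.atlas.map_nhds p, tendsto_map'_iff, (X.isRep p).gaussMap_eq]
  refine tendsto_mk (f := fun t => X.arc p t ⨯₃ X.vec p t) (X.isRep p).cross_ne_zero
    (AnalyticAt.cross (X.isLocalFrame p).analytic_curve
      (X.isLocalFrame p).analytic_vector).continuousAt ?_
  filter_upwards [X.eventually_isRep_param p] with t ht
  exact ⟨ht.cross_ne_zero, ht.gaussMap_eq⟩

theorem isClosed_dualCurve (X : LineField C) : IsClosed X.dualCurve :=
  (isCompact_range X.continuous_gaussMap).isClosed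

theorem nonempty_points (C : SmoothPlaneCurve d) (hd : 0 < d) : Nonempty C.Points :=
  (exists_zero_of_isHomogeneous hd C.homogeneous).to_subtype

theorem infinite_points (X : LineField C) (hd : 0 < d) : Infinite C.Points := by
  obtain ⟨p⟩ := nonempty_points C hd
  exact Set.infinite_univ_iff.1 (X.atlas.infinite_of_mem_nhds (p := p) univ_mem)

theorem val_eq_zero_of_infinite (hd : 0 < d) (hΨ : IsSection C Ψ i j) {T : Set C.Points}
    (hT : T.Infinite) (h : ∀ p ∈ T, X.val Ψ p = 0) (p : C.Points) : X.val Ψ p = 0 := by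
  rcases X.dichotomy hd hΨ with h1 | h1
  · exact h1 p
  · exfalso
    refine hT ((finite_zeros hΨ isClopen_univ fun p _ => h1 p).subset fun p hp => ⟨trivial, h p hp⟩)

theorem secOrd_dF_ne_top (hd : 0 < d)
    (hX : ∃ p : C.Points, (X.line p : Set (TangentP2 p.1)) ≠ C.tangentSet p) (p : C.Points) :
    X.secOrd C.dF p ≠ ⊤ := by
  obtain ⟨q, hq⟩ := hX
  exact (X.dichotomy hd IsSection.dF).resolve_left (fun h => (X.isRep q).dF_ne_zero hq (h q)) p

/-- A vector field whose directions all lie on one line is tangent to the curve. -/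
theorem val_dF_eq_zero {b : V} (hb : b ≠ 0) (h1 : ∀ p, X.val (fun x _ => x ⬝ᵥ b) p = 0)
    (h2 : b ⬝ᵥ X.vec p 0 = 0) : X.val C.dF p = 0 := by
  have hγ := (X.isLocalFrame p).isArc
  have hev : ∀ᶠ t in 𝓝 (0 : ℂ), X.arc p t ⬝ᵥ b = 0 := by
    filter_upwards [eventually_val_iff (IsSection.linear b) p] with t ht
    exact ht.1 (h1 _)
  have hder : HasDerivAt (fun t => X.arc p t ⬝ᵥ b) (deriv (X.arc p) 0 ⬝ᵥ b) 0 := by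
    have h1 := hasDerivAt_pi.1 hγ.analytic.differentiableAt.hasDerivAt
    exact HasDerivAt.fun_sum fun i _ => (h1 i).mul_const (b i)
  have h0 := hder.unique ((hasDerivAt_const (0 : ℂ) (0 : ℂ)).congr_of_eventuallyEq hev)
  obtain ⟨c, hc⟩ := exists_eq_smul_cross (a := b) hγ.immersed
    (by rw [dotProduct_comm]; exact hev.self_of_nhds) (by rw [dotProduct_comm]; exact h0)
  have hc0 : c ≠ 0 := by
    rintro rfl
    exact hb (by rw [hc, zero_smul])
  rw [dotProduct_comm, hc, dotProduct_smul, smul_eq_mul, mul_eq_zero, or_iff_right hc0] at h2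
  obtain ⟨α, β, hab⟩ := exists_combination_of_dot_cross hγ.immersed h2
  rw [val, hab, dF_add, dF_smul, dF_smul, hγ.dF_deriv, C.dF_self_eq_zero (X.isRep p).eval_eq_zero]
  simp

/-- If `φ_X` took the value `b` infinitely often, it would be constant by the identity principle.
All points of the curve and all directions would then lie on the line `b`, which makes `X` tangent
to the curve everywhere. -/
theorem finite_fibre (hd : 0 < d)
    (hX : ∃ p : C.Points, (X.line p : Set (TangentP2 p.1)) ≠ C.tangentSet p) (b : P2) :
    (X.gaussMap ⁻¹' {b}).Finite := by
  by_contra hinf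
  have h1 : ∀ y : V, b.rep ⬝ᵥ y = 0 → ∀ p, X.val (fun x v => (x ⨯₃ v) ⬝ᵥ y) p = 0 := by
    intro y hy
    refine val_eq_zero_of_infinite hd (IsSection.dualLinear y) hinf fun q hq => ?_
    rw [← gaussMap_dot_iff, show X.gaussMap q = b from hq, hy]
  have h2 : ∀ p : C.Points, ∃ c : ℂ, b.rep = c • (X.arc p 0 ⨯₃ X.vec p 0) := by
    intro p
    have h3 : (X.arc p 0 ⨯₃ X.vec p 0) ⨯₃ b.rep = 0 := by
      ext i
      -- The vectors `b × eᵢ` are points of the line `b`, and pairing `x × v` with them gives the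
      -- components of `(x × v) × b`.
      have h4 := h1 (b.rep ⨯₃ Pi.single i 1) (dot_self_cross _ _) p
      rw [val, triple_product_permutation, triple_product_permutation, single_dotProduct] at h4
      simpa using h4
    have h5 : ¬ LinearIndependent ℂ ![X.arc p 0 ⨯₃ X.vec p 0, b.rep] := fun h =>
      crossProduct_ne_zero_iff_linearIndependent.2 h h3
    rw [LinearIndependent.pair_iff' (X.isRep p).cross_ne_zero] at h5
    push Not at h5
    obtain ⟨c, hc⟩ := h5
    exact ⟨c, hc.symm⟩
  obtain ⟨q, hq⟩ := hX
  refine (X.isRep q).dF_ne_zero hq (val_dF_eq_zero (p := q) b.rep_nonzero (fun p => ?_) ?_)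
  · obtain ⟨c, hc⟩ := h2 p
    change X.arc p 0 ⬝ᵥ b.rep = 0
    rw [hc, dotProduct_smul, dot_self_cross, smul_zero]
  · obtain ⟨c, hc⟩ := h2 q
    rw [hc, smul_dotProduct, dotProduct_comm, dot_cross_self, smul_zero]

theorem infinite_dualCurve (hd : 0 < d)
    (hX : ∃ p : C.Points, (X.line p : Set (TangentP2 p.1)) ≠ C.tangentSet p) :
    X.dualCurve.Infinite := by
  have := X.infinite_points hd
  intro hfin
  have h1 : (Set.univ : Set C.Points) = ⋃ b ∈ X.dualCurve, X.gaussMap ⁻¹' {b} := by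
    rw [Set.biUnion_preimage_singleton, dualCurve, Set.preimage_range]
  exact Set.infinite_univ (α := C.Points) (h1 ▸ hfin.biUnion fun b _ => finite_fibre hd hX b)

/-- The number of tangent lines `φ_X p` through a general point of the plane is `m`. -/
def HasDualDegree (X : LineField C) (m : ℕ) : Prop :=
  ∀ w : V, (∀ p, X.secOrd (fun x v => (x ⨯₃ v) ⬝ᵥ w) p ≠ ⊤) →
    X.secDeg (fun x v => (x ⨯₃ v) ⬝ᵥ w) Set.univ = m

theorem exists_dual_line (X : LineField C) (hd : 0 < d) :
    ∃ w : V, ∀ p, X.secOrd (fun x v => (x ⨯₃ v) ⬝ᵥ w) p ≠ ⊤ := by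
  obtain ⟨p⟩ := nonempty_points C hd
  obtain ⟨i, hi⟩ := Function.ne_iff.1 (X.isRep p).cross_ne_zero
  refine ⟨Pi.single i 1, (X.dichotomy hd (IsSection.dualLinear _)).resolve_left fun h => hi ?_⟩
  have h1 := h p
  rw [val, dotProduct_single, mul_one] at h1
  exact h1

theorem exists_hasDualDegree (X : LineField C) (hd : 0 < d) : ∃ m, X.HasDualDegree m := by
  obtain ⟨w, hw⟩ := X.exists_dual_line hd
  exact ⟨_, fun w' hw' => secDeg_eq (IsSection.dualLinear w') (IsSection.dualLinear w) isClopen_univ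
    (fun p _ => hw' p) fun p _ => hw p⟩

/-- `H (x × v)` has the same bidegree `(k, k)` as the `k`-th power of `(x × v) · w`. -/
theorem HasDualDegree.secDeg_dualForm {m : ℕ} (hm : X.HasDualDegree m) (hd : 0 < d)
    {H : MvPolynomial (Fin 3) ℂ} {k : ℕ} (hH : H.IsHomogeneous k)
    (h : ∀ p, X.secOrd (fun x v => eval (x ⨯₃ v) H) p ≠ ⊤) :
    X.secDeg (fun x v => eval (x ⨯₃ v) H) Set.univ = k * m := by
  obtain ⟨w, hw⟩ := X.exists_dual_line hd
  have hl := (IsSection.dualLinear (C := C) w).pow k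
  rw [one_mul] at hl
  rw [secDeg_eq (IsSection.dualForm hH) hl isClopen_univ (fun p _ => h p) fun p _ =>
    secOrd_pow_ne_top (IsSection.dualLinear w) k (hw p),
    secDeg_pow (IsSection.dualLinear w) k _ fun p _ => hw p, hm w hw]

/-- The degree of the normal bundle, computed with the tangency section. -/
theorem HasDualDegree.secDeg_dF {m : ℕ} (hm : X.HasDualDegree m) (hd : 0 < d)
    (hX : ∃ p : C.Points, (X.line p : Set (TangentP2 p.1)) ≠ C.tangentSet p) :
    X.secDeg C.dF Set.univ + 2 * d = d * d + m := by
  have := X.infinite_points hd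
  obtain ⟨w, hw, hwd, -⟩ := X.exists_good_line hd (Set.infinite_univ (α := C.Points))
  obtain ⟨u, hu⟩ := X.exists_dual_line hd
  have hl := IsSection.linear (C := C) w
  have hdF := secOrd_dF_ne_top hd hX
  -- Both products have bidegree `(d + 1, 1)`; `d > 0` is what makes the truncated `d - 1` harmless.
  have h1 := (IsSection.dF (C := C)).mul (hl.pow 2)
  have h2 := (hl.pow d).mul (IsSection.dualLinear (C := C) u)
  rw [show d - 1 + 1 * 2 = d + 1 by omega, show 1 + 0 * 2 = 1 by rfl] at h1
  rw [show 1 * d + 1 = d + 1 by omega, show 0 * d + 1 = 1 by omega] at h2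
  have h3 := fun n {p} h => secOrd_pow_ne_top (X := X) (p := p) hl n h
  have h4 := secDeg_eq h1 h2 isClopen_univ (X := X)
    (fun p _ => by
      rw [secOrd_mul IsSection.dF (hl.pow 2)]
      exact WithTop.add_ne_top.2 ⟨hdF p, h3 2 (hw p)⟩)
    (fun p _ => by
      rw [secOrd_mul (hl.pow d) (IsSection.dualLinear u)]
      exact WithTop.add_ne_top.2 ⟨h3 d (hw p), hu p⟩)
  rwa [secDeg_mul IsSection.dF (hl.pow 2) isClopen_univ (fun p _ => hdF p) fun p _ => h3 2 (hw p),
    secDeg_mul (hl.pow d) (IsSection.dualLinear u) isClopen_univ (fun p _ => h3 d (hw p))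
      fun p _ => hu p, secDeg_pow hl _ _ fun p _ => hw p, secDeg_pow hl _ _ fun p _ => hw p, hm u hu,
    hwd] at h4

theorem tangOrder_eq (X : LineField C) (p : C.Points) : X.tangOrder p = X.secOrd C.dF p := by
  refine le_antisymm ?_ ?_
  · exact iInf_le_of_le (X.arc p) (iInf_le_of_le (X.vec p) (iInf_le_of_le (X.isLocalFrame p) le_rfl))
  · exact le_iInf fun γ => le_iInf fun v => le_iInf fun h => (secOrd_eq IsSection.dF h).ge

theorem finite_tangOrder_ne_zero (hd : 0 < d)
    (hX : ∃ p : C.Points, (X.line p : Set (TangentP2 p.1)) ≠ C.tangentSet p) :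
    {p : C.Points | X.tangOrder p ≠ 0}.Finite := by
  refine (finite_zeros (X := X) IsSection.dF isClopen_univ fun p _ =>
    secOrd_dF_ne_top hd hX p).subset fun p hp => ⟨trivial, ?_⟩
  rw [Set.mem_ofPred_eq, tangOrder_eq] at hp
  by_contra h0
  exact hp ((secOrd_eq_zero_iff IsSection.dF).2 h0)

theorem tang_eq (hd : 0 < d)
    (hX : ∃ p : C.Points, (X.line p : Set (TangentP2 p.1)) ≠ C.tangentSet p) :
    X.tang = (X.secDeg C.dF Set.univ : ℕ) := by
  have hord := secOrd_dF_ne_top hd hX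
  have hcast : ((X.secDeg C.dF Set.univ : ℕ) : ℕ∞) =
      ∑ᶠ p ∈ (Set.univ : Set C.Points), ((X.secOrd C.dF p).toNat : ℕ∞) :=
    (Nat.castAddMonoidHom ℕ∞).map_finsum_mem'
      (finite_support_secOrd IsSection.dF isClopen_univ fun p _ => hord p)
  rw [hcast, finsum_mem_univ]
  refine finsum_congr fun p => ?_
  rw [tangOrder_eq, ENat.natCast_toNat (hord p)]

end LineField

end PlaneCurves

end

/-! ### Counting on a general line of the dual plane. -/

section

open scoped Topology Matrix
open MvPolynomial PlaneCurves Filter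

theorem Set.ncard_preimage_eq_sum {α β : Type*} (f : α → β) (E : Finset β)
    (h : ∀ b ∈ E, (f ⁻¹' {b}).Finite) : (f ⁻¹' (E : Set β)).ncard = ∑ b ∈ E, (f ⁻¹' {b}).ncard := by
  classical
  have key : (f ⁻¹' (E : Set β)).Finite ∧
      (f ⁻¹' (E : Set β)).ncard = ∑ b ∈ E, (f ⁻¹' {b}).ncard := by
    induction E using Finset.induction_on with
    | empty => simp
    | insert a s ha ih =>
      obtain ⟨h1, h2⟩ := ih fun b hb => h b (Finset.mem_insert_of_mem hb)
      have h3 := h a (Finset.mem_insert_self a s)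
      rw [Finset.coe_insert, Set.insert_eq, Set.preimage_union, Finset.sum_insert ha, ← h2]
      refine ⟨h3.union h1, Set.ncard_union_eq ?_ h3 h1⟩
      rw [Set.disjoint_left]
      rintro x hx hx'
      rw [Set.mem_preimage, Set.mem_singleton_iff] at hx
      rw [Set.mem_preimage, hx] at hx'
      exact ha hx'
  exact key.2

namespace PlaneCurves

namespace LineField

open SmoothPlaneCurve

variable {d : ℕ} {C : SmoothPlaneCurve d} {X : LineField C} {G : MvPolynomial (Fin 3) ℂ} {e : ℕ}
  {M : GL (Fin 3) ℂ}

/-- Otherwise the infinite dual curve would lie in the intersection of the zero locus of `G` with a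
line not contained in it, which is finite. -/
theorem secOrd_pencil_ne_top (hd : 0 < d)
    (hX : ∃ p : C.Points, (X.line p : Set (TangentP2 p.1)) ≠ C.tangentSet p)
    (hG : G.IsHomogeneous e) (he : 0 < e) (hdual : X.dualCurve ⊆ zeroLocus G)
    (hM : eval (M.1 0) G ≠ 0) (s : ℂ) (p : C.Points) :
    X.secOrd (fun x v => (x ⨯₃ v) ⬝ᵥ pencil M s) p ≠ ⊤ := by
  refine (X.dichotomy hd (IsSection.dualLinear _)).resolve_left (fun h => ?_) p
  refine infinite_dualCurve hd hX ((finite_zeroLocus_pencil hG he hM s).subset ?_)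
  rintro _ ⟨q, rfl⟩
  exact ⟨hdual ⟨q, rfl⟩, (gaussMap_dot_iff _).2 (h q)⟩

/-- The sections of the pencil are `s Q + R`, so their zeros are the points where `f = R / Q` takes
the value `-s`, with the same multiplicities. Only finitely many points are ramification points of
`f`. -/
theorem finite_multiple_zeros (hd : 0 < d)
    (hX : ∃ p : C.Points, (X.line p : Set (TangentP2 p.1)) ≠ C.tangentSet p)
    (hG : G.IsHomogeneous e) (he : 0 < e) (hdual : X.dualCurve ⊆ zeroLocus G)
    (hM : eval (M.1 0) G ≠ 0) :
    ∃ A : Set ℂ, A.Finite ∧ ∀ s ∉ A, ∀ p, X.val (fun x v => (x ⨯₃ v) ⬝ᵥ pencil M s) p = 0 →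
      X.secOrd (fun x v => (x ⨯₃ v) ⬝ᵥ pencil M s) p = 1 := by
  have hsec := fun w => IsSection.dualLinear (C := C) w
  have hne := fun s p => secOrd_pencil_ne_top hd hX hG he hdual hM s p
  have hQ : ∀ p, X.secOrd (fun x v => (x ⨯₃ v) ⬝ᵥ (M.1 0 ⨯₃ M.1 1)) p ≠ ⊤ := by
    have hli : LinearIndependent ℂ ![M.1 0, M.1 1] := by
      rw [LinearIndependent.pair_iff]
      intro a b h
      have h1 : ![a, b, 0] ᵥ* M.1 = 0 := by
        rw [cons_vecMul, ← h]
        module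
      have h2 : ![a, b, 0] = 0 := by
        by_contra hne
        exact vecMul_ne_zero M hne h1
      exact ⟨congrFun h2 0, congrFun h2 1⟩
    -- The line at infinity of the pencil is the line `s = 0` of another pencil with the same
    -- centre.
    obtain ⟨N, hN0, hN2⟩ := exists_GL_rows hli
    have h := fun p => secOrd_pencil_ne_top hd hX hG he hdual (M := N) (by rwa [hN0]) 0 p
    rwa [pencil, hN0, hN2, zero_smul, zero_add] at h
  set f : C.Points → ℂ := fun q => X.val (fun x v => (x ⨯₃ v) ⬝ᵥ (M.1 0 ⨯₃ M.1 2)) q /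
    X.val (fun x v => (x ⨯₃ v) ⬝ᵥ (M.1 0 ⨯₃ M.1 1)) q with hf
  have hval : ∀ s q, X.val (fun x v => (x ⨯₃ v) ⬝ᵥ pencil M s) q =
      s * X.val (fun x v => (x ⨯₃ v) ⬝ᵥ (M.1 0 ⨯₃ M.1 1)) q +
        X.val (fun x v => (x ⨯₃ v) ⬝ᵥ (M.1 0 ⨯₃ M.1 2)) q := by
    intro s q
    simp only [val, pencil_eq, dotProduct_add, dotProduct_smul, smul_eq_mul]
  have hmero : X.atlas.IsMero f := isMero_ratio (hsec _) (hsec _)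
  have hord : ∀ c p, X.atlas.ord (fun q => f q - c) p =
      (((X.secOrd (fun x v => (x ⨯₃ v) ⬝ᵥ pencil M (-c)) p).toNat -
        (X.secOrd (fun x v => (x ⨯₃ v) ⬝ᵥ (M.1 0 ⨯₃ M.1 1)) p).toNat : ℤ) : WithTop ℤ) := by
    intro c p
    rw [← ord_ratio (hsec _) (hsec _) (hne (-c) p) (hQ p)]
    refine meromorphicOrderAt_congr ?_
    filter_upwards [eventually_val_param_ne_zero (hsec _) (hQ p)] with t ht
    simp only [Function.comp_apply, hf, hval]
    field_simp
    ring
  have hram := RiemannAtlas.finite_ramification hmero fun p c => by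
    rw [hord]
    exact WithTop.coe_ne_top
  refine ⟨(fun q => -f q) '' {p | ∃ c, ¬ X.atlas.ord (fun q => f q - c) p ≤ 1},
    hram.image _, fun s hs p hp => ?_⟩
  -- Otherwise `φ_X p` would be on all lines of the pencil, hence be the centre, which is not a zero
  -- of `G`.
  have hQp : X.val (fun x v => (x ⨯₃ v) ⬝ᵥ (M.1 0 ⨯₃ M.1 1)) p ≠ 0 := by
    intro h0
    have h2 : X.val (fun x v => (x ⨯₃ v) ⬝ᵥ (M.1 0 ⨯₃ M.1 2)) p = 0 := by
      have h3 := hval s p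
      rwa [hp, h0, mul_zero, zero_add, eq_comm] at h3
    have h4 : ∀ c, ∃ T, X.gaussMap p = finitePt M T c := fun c => by
      rw [← rep_dot_pencil_iff hG he hM (hdual ⟨p, rfl⟩), gaussMap_dot_iff, hval, h0, h2]
      ring
    obtain ⟨T, hT⟩ := h4 0
    obtain ⟨T', hT'⟩ := h4 1
    exact zero_ne_one (finitePt_injective M (hT.symm.trans hT')).2
  have hsf : s = -f p := by
    have h3 := hval s p
    rw [hp] at h3
    rw [hf]
    field_simp
    linear_combination -h3
  have h5 : X.atlas.ord (fun q => f q - (-s)) p ≤ 1 := by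
    by_contra h6
    exact hs ⟨p, ⟨_, h6⟩, hsf.symm⟩
  rw [hord, neg_neg, (secOrd_eq_zero_iff (hsec _)).2 hQp] at h5
  have h7 : X.secOrd (fun x v => (x ⨯₃ v) ⬝ᵥ pencil M s) p ≠ 0 := fun h8 =>
    (secOrd_eq_zero_iff (hsec _)).1 h8 hp
  obtain ⟨n, hn⟩ := ENat.ne_top_iff_exists.1 (hne s p)
  rw [← hn] at h5 h7 ⊢
  have h9 : (n : ℤ) ≤ 1 := by
    have h10 := WithTop.coe_le_coe.1 h5
    simpa using h10
  have h11 : n ≠ 0 := by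
    rintro rfl
    exact h7 rfl
  have h12 : n = 1 := by omega
  rw [h12]
  rfl

/-- On a general line of a pencil, the fibres of the Gauss map have `m` points in total. -/
theorem HasDualDegree.exists_count {m : ℕ} (hm : X.HasDualDegree m) (hd : 0 < d)
    (hX : ∃ p : C.Points, (X.line p : Set (TangentP2 p.1)) ≠ C.tangentSet p)
    (hG : G.IsHomogeneous e) (he : 0 < e) (hsq : Squarefree G) (hdual : X.dualCurve ⊆ zeroLocus G)
    (hM : eval (M.1 0) G ≠ 0) :
    ∃ A : Set ℂ, A.Finite ∧ ∀ s ∉ A, ∃ E : Finset P2, E.card = e ∧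
      (E : Set P2) = {p ∈ zeroLocus G | p.rep ⬝ᵥ pencil M s = 0} ∧
      ∑ b ∈ E, (X.gaussMap ⁻¹' {b}).ncard = m := by
  obtain ⟨A, hA, h1⟩ := finite_multiple_zeros hd hX hG he hdual hM
  obtain ⟨A', hA', h2⟩ := finite_bad_lines M hG hsq hM
  refine ⟨A ∪ A', hA.union hA', fun s hs => ?_⟩
  rw [Set.mem_union, not_or] at hs
  have hfin := finite_zeroLocus_pencil hG he hM s
  refine ⟨hfin.toFinset, ?_, hfin.coe_toFinset, ?_⟩
  · rw [← Set.ncard_eq_toFinset_card _ hfin, ncard_zeroLocus_pencil hG he hM, (h2 s hs.2).1]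
  · have hne := secOrd_pencil_ne_top hd hX hG he hdual hM s
    have h3 := ncard_eq_secDeg (IsSection.dualLinear (C := C) (pencil M s)) isClopen_univ
      (fun p _ => hne p) fun p _ hp => h1 s hs.1 p hp
    rw [hm _ hne] at h3
    rw [← Set.ncard_preimage_eq_sum _ _ fun b _ => finite_fibre hd hX b, ← h3, hfin.coe_toFinset]
    congr 1
    ext p
    simp only [Set.mem_preimage, Set.mem_ofPred_eq, Set.mem_univ, true_and, gaussMap_dot_iff]
    exact and_iff_right (hdual ⟨p, rfl⟩)

/-- The formula for the number of tangent lines through a general point. -/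
theorem HasDualDegree.eq_mul {m : ℕ} (hm : X.HasDualDegree m) (hd : 0 < d)
    (hX : ∃ p : C.Points, (X.line p : Set (TangentP2 p.1)) ≠ C.tangentSet p)
    {l : ℕ} (he : IsPlaneCurveOfDegree X.dualCurve e) (hl : HasDegreeOntoImage X.gaussMap l) :
    m = l * e := by
  obtain ⟨he0, G, hG, hsq, hGd⟩ := he
  obtain ⟨M, hM⟩ := exists_GL_eval_ne_zero hsq.ne_zero
  obtain ⟨A, hA, h1⟩ := hm.exists_count hd hX hG he0 hsq hGd.le hM
  have hbad : {q ∈ Set.range X.gaussMap | (X.gaussMap ⁻¹' {q}).encard ≠ (l : ℕ∞)} ⊆ zeroLocus G :=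
    fun q hq => hGd.le hq.1
  -- The finitely many points with an exceptional fibre lie on finitely many lines, which are
  -- avoided.
  have hA' := finite_lines_meeting hG he0 hM hl hbad
  obtain ⟨s, hs⟩ := (hA.union hA').infinite_compl.nonempty
  rw [Set.mem_compl_iff, Set.mem_union, not_or] at hs
  obtain ⟨E, hE, hEs, hsum⟩ := h1 s hs.1
  rw [← hsum, Finset.sum_const_nat (m := l), hE, mul_comm]
  intro b hb
  have hb' : b ∈ {p ∈ zeroLocus G | p.rep ⬝ᵥ pencil M s = 0} := by
    rw [← hEs]
    exact hb
  have h2 : (X.gaussMap ⁻¹' {b}).encard = l := by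
    by_contra hne
    exact hs.2 ⟨b, ⟨hGd.ge hb'.1, hne⟩, hb'.2⟩
  rw [Set.ncard, h2]
  rfl

end LineField

end PlaneCurves

end

/-! ### The dual curve is algebraic, and the Gauss map has a degree. -/

section

open scoped Topology Matrix
open MvPolynomial PlaneCurves Filter

namespace PlaneCurves

namespace LineField

open SmoothPlaneCurve

variable {d : ℕ} {C : SmoothPlaneCurve d} {X : LineField C} {G : MvPolynomial (Fin 3) ℂ} {e : ℕ}
  {M : GL (Fin 3) ℂ} {m : ℕ}

/-- A form that vanishes at too many points of the dual curve vanishes on it. -/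
theorem HasDualDegree.subset_zeroLocus (hm : X.HasDualDegree m) (hd : 0 < d)
    (hX : ∃ p : C.Points, (X.line p : Set (TangentP2 p.1)) ≠ C.tangentSet p)
    {H : MvPolynomial (Fin 3) ℂ} {k : ℕ} (hH : H.IsHomogeneous k) {c : ℕ} (B : Finset P2)
    (hB : ∀ b ∈ B, b ∈ zeroLocus H ∧ c ≤ (X.gaussMap ⁻¹' {b}).ncard) (hcard : k * m < B.card * c) :
    X.dualCurve ⊆ zeroLocus H := by
  rcases X.dichotomy hd (IsSection.dualForm hH) with h | h
  · rintro _ ⟨p, rfl⟩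
    exact (gaussMap_mem_zeroLocus_iff hH).2 (h p)
  · exfalso
    have h1 := card_le_secDeg (IsSection.dualForm hH) isClopen_univ (fun p _ => h p)
      (T := X.gaussMap ⁻¹' (B : Set P2)) fun p hp =>
        ⟨trivial, (gaussMap_mem_zeroLocus_iff hH).1 (hB _ hp).1⟩
    rw [hm.secDeg_dualForm hd hH h, Set.ncard_preimage_eq_sum _ _ fun b _ => finite_fibre hd hX b] at h1
    have h2 : B.card * c ≤ ∑ b ∈ B, (X.gaussMap ⁻¹' {b}).ncard := by
      rw [← smul_eq_mul]
      exact Finset.card_nsmul_le_sum _ _ _ fun b hb => (hB b hb).2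
    omega

theorem one_le_ncard_fibre (hd : 0 < d)
    (hX : ∃ p : C.Points, (X.line p : Set (TangentP2 p.1)) ≠ C.tangentSet p) {b : P2}
    (hb : b ∈ X.dualCurve) : 1 ≤ (X.gaussMap ⁻¹' {b}).ncard := by
  obtain ⟨p, hp⟩ := hb
  exact (Set.ncard_pos (finite_fibre hd hX b)).2 ⟨p, hp⟩

/-- The number of points through which a form of degree `k` can be forced grows quadratically in
`k`, while `k m + 1` points of the dual curve suffice to make it vanish on all of it. -/
theorem exists_form_vanishing (X : LineField C) (hd : 0 < d)
    (hX : ∃ p : C.Points, (X.line p : Set (TangentP2 p.1)) ≠ C.tangentSet p) :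
    ∃ e, ∃ G : MvPolynomial (Fin 3) ℂ, G.IsHomogeneous e ∧ G ≠ 0 ∧ X.dualCurve ⊆ zeroLocus G := by
  obtain ⟨m, hm⟩ := X.exists_hasDualDegree hd
  obtain ⟨B, hB, hBcard⟩ := (infinite_dualCurve hd hX).exists_subset_card_eq (4 * m ^ 2 + 4 * m + 1)
  have hP : ((MvPolynomial.X 0 : MvPolynomial (Fin 3) ℂ) ^ (2 * m + 2)).IsHomogeneous (2 * m + 2) := by
    simpa using (isHomogeneous_X ℂ (0 : Fin 3)).pow (2 * m + 2)
  -- The degree is `4m + 4`, so more than `4m² + 4m` points are required, and `(2m + 2)² > 4m² + 4m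
  -- + 1` permits them. The power of a variable only serves to ensure `H ≠ 0`.
  obtain ⟨H, hH, hHB, hdvd⟩ := exists_form_through hP (pow_ne_zero _ (X_ne_zero 0))
    (n := 2 * m + 2) B (by rw [hBcard]; nlinarith)
  refine ⟨_, H, hH, fun h0 => hdvd (by rw [h0]; exact dvd_zero _), ?_⟩
  exact hm.subset_zeroLocus hd hX hH (c := 1) B
    (fun b hb => ⟨hHB b hb, one_le_ncard_fibre hd hX (hB hb)⟩) (by rw [hBcard]; nlinarith)

/-- A form of least degree is irreducible: if it factors, one factor vanishes at `φ_X q` for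
infinitely many `q`, hence for all `q`. -/
theorem exists_irreducible_form (X : LineField C) (hd : 0 < d)
    (hX : ∃ p : C.Points, (X.line p : Set (TangentP2 p.1)) ≠ C.tangentSet p) :
    ∃ e, 0 < e ∧ ∃ G : MvPolynomial (Fin 3) ℂ, G.IsHomogeneous e ∧ Irreducible G ∧
      X.dualCurve ⊆ zeroLocus G := by
  classical
  have hex := X.exists_form_vanishing hd hX
  obtain ⟨G, hG, hG0, hdual⟩ := Nat.find_spec hex
  have hmin : ∀ {P : MvPolynomial (Fin 3) ℂ} {a b : ℕ}, P.IsHomogeneous a → P ≠ 0 →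
      a + b = Nat.find hex → 0 < b → ¬ X.dualCurve ⊆ zeroLocus P := fun {P a b} hP hP0 hab hb h =>
    Nat.find_min hex (m := a) (by omega) ⟨P, hP, hP0, h⟩
  obtain ⟨p⟩ := nonempty_points C hd
  have hnu : ¬ IsUnit G := by
    intro hu
    have h1 := hu.map (eval (X.gaussMap p).rep)
    rw [show eval (X.gaussMap p).rep G = 0 from hdual ⟨p, rfl⟩] at h1
    exact not_isUnit_zero h1
  refine ⟨_, pos_degree_of_not_isUnit hG hG0 hnu, G, hG, ⟨hnu, fun P Q hPQ => ?_⟩, hdual⟩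
  by_contra! hcon
  rw [hPQ] at hG hG0
  obtain ⟨a, b, ha, hb, hab⟩ := IsHomogeneous.exists_of_mul hG hG0
  have hP0 := left_ne_zero_of_mul hG0
  have hQ0 := right_ne_zero_of_mul hG0
  have ha0 := pos_degree_of_not_isUnit ha hP0 hcon.1
  have hb0 := pos_degree_of_not_isUnit hb hQ0 hcon.2
  have hP := hmin ha hP0 hab hb0
  have hQ := hmin hb hQ0 ((add_comm b a).trans hab) ha0
  have hPQv : ∀ q, X.val (fun x v => eval (x ⨯₃ v) P) q = 0 ∨
      X.val (fun x v => eval (x ⨯₃ v) Q) q = 0 := by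
    intro q
    have h1 : X.gaussMap q ∈ zeroLocus G := hdual ⟨q, rfl⟩
    rw [← gaussMap_mem_zeroLocus_iff ha, ← gaussMap_mem_zeroLocus_iff hb]
    change eval _ G = 0 at h1
    rw [hPQ, map_mul, mul_eq_zero] at h1
    exact h1
  have hsub : ∀ {P : MvPolynomial (Fin 3) ℂ} {a : ℕ}, P.IsHomogeneous a →
      ¬ X.dualCurve ⊆ zeroLocus P → {q | X.val (fun x v => eval (x ⨯₃ v) P) q = 0}.Finite := by
    intro P a ha hP
    by_contra hinf
    apply hP
    rintro _ ⟨q, rfl⟩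
    exact (gaussMap_mem_zeroLocus_iff ha).2
      (val_eq_zero_of_infinite hd (IsSection.dualForm ha) hinf (fun q hq => hq) q)
  have := X.infinite_points hd
  refine Set.infinite_univ (α := C.Points) (((hsub ha hP).union (hsub hb hQ)).subset fun q _ => ?_)
  exact hPQv q

/-- An upper bound for the fibres of the Gauss map. -/
theorem HasDualDegree.mul_le (hm : X.HasDualDegree m) (hd : 0 < d)
    (hX : ∃ p : C.Points, (X.line p : Set (TangentP2 p.1)) ≠ C.tangentSet p)
    (hG : G.IsHomogeneous e) (he : 0 < e) (hirr : Irreducible G) (hdual : X.dualCurve ⊆ zeroLocus G)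
    {B : Set P2} {c : ℕ} (hB : B.Infinite) (hc : ∀ b ∈ B, c ≤ (X.gaussMap ⁻¹' {b}).ncard) :
    c * e ≤ m := by
  by_contra! hlt
  -- With `n = e m + c + 1` and `c e ≥ m + 1`, the `n e - 1` points have at least `n (m + 1) - c = n
  -- m + e m + 1` preimages. This exceeds the `(n + e) m` zeros of a form of degree `n + e`, so `H`
  -- vanishes on the dual curve, although its common zeros with `G` are finite in number.
  obtain ⟨B', hB', hcard⟩ := hB.exists_subset_card_eq ((e * m + c + 1) * e - 1)
  have hpos : 0 < (e * m + c + 1) * e := by positivity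
  obtain ⟨H, hH, hHB, hdvd⟩ := exists_form_through hG hirr.ne_zero (n := e * m + c + 1) B' (by omega)
  have hsub := hm.subset_zeroLocus hd hX hH (c := c) B'
    (fun b hb => ⟨hHB b hb, hc b (hB' hb)⟩) (by
      rw [hcard]
      obtain ⟨k, hk⟩ : ∃ k, (e * m + c + 1) * e = k + 1 := ⟨_, (Nat.succ_pred_eq_of_pos hpos).symm⟩
      rw [hk, Nat.add_sub_cancel]
      have h1 : (k + 1) * c = (e * m + c + 1) * (c * e) := by
        rw [← hk]
        ring
      have h2 : (e * m + c + 1) * (m + 1) ≤ (e * m + c + 1) * (c * e) :=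
        Nat.mul_le_mul_left _ hlt
      nlinarith)
  exact infinite_dualCurve hd hX ((finite_common_zeros hG hH hirr hdvd).subset fun b hb =>
    ⟨hdual hb, hsub hb⟩)

/-- On a general line of a pencil, all points of the zero locus lie on the dual curve and have the same
number of preimages. -/
theorem HasDualDegree.exists_fibres (hm : X.HasDualDegree m) (hd : 0 < d)
    (hX : ∃ p : C.Points, (X.line p : Set (TangentP2 p.1)) ≠ C.tangentSet p)
    (hG : G.IsHomogeneous e) (he : 0 < e) (hirr : Irreducible G) (hdual : X.dualCurve ⊆ zeroLocus G)
    (hM : eval (M.1 0) G ≠ 0) :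
    ∃ A : Set ℂ, A.Finite ∧ ∀ s ∉ A, ∀ T, finitePt M T s ∈ zeroLocus G →
      finitePt M T s ∈ X.dualCurve ∧ (X.gaussMap ⁻¹' {finitePt M T s}).ncard = m / e := by
  obtain ⟨A, hA, h1⟩ := hm.exists_count hd hX hG he hirr.squarefree hdual hM
  set B : Set P2 := {b ∈ X.dualCurve | m / e + 1 ≤ (X.gaussMap ⁻¹' {b}).ncard}
  have hB : B.Finite := by
    by_contra hinf
    have h2 := hm.mul_le hd hX hG he hirr hdual hinf fun b hb => hb.2
    have h3 := Nat.lt_div_mul_add (a := m) he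
    rw [add_mul, one_mul] at h2
    omega
  have hA' := finite_lines_meeting hG he hM hB fun b hb => hdual hb.1
  have hgood : ∀ s ∉ A ∪ {s | ∃ b ∈ B, b.rep ⬝ᵥ pencil M s = 0}, ∀ b ∈ zeroLocus G,
      b.rep ⬝ᵥ pencil M s = 0 → (X.gaussMap ⁻¹' {b}).ncard = m / e := by
    intro s hs
    rw [Set.mem_union, not_or] at hs
    obtain ⟨E, hE, hEs, hsum⟩ := h1 s hs.1
    have hle : ∀ b ∈ E, (X.gaussMap ⁻¹' {b}).ncard ≤ m / e := by
      intro b hb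
      have hb' : b ∈ {p ∈ zeroLocus G | p.rep ⬝ᵥ pencil M s = 0} := by
        rw [← hEs]
        exact hb
      by_contra! hlt
      refine hs.2 ⟨b, ⟨?_, hlt⟩, hb'.2⟩
      obtain ⟨p, hp⟩ := Set.nonempty_of_ncard_ne_zero (s := X.gaussMap ⁻¹' {b})
        ((Nat.zero_le _).trans_lt hlt).ne'
      exact ⟨p, hp⟩
    -- The `e` fibres have at most `⌊m / e⌋` points each and `m ≥ e ⌊m / e⌋` altogether, so equality
    -- holds throughout.
    have hsum' : ∑ b ∈ E, (X.gaussMap ⁻¹' {b}).ncard = ∑ _b ∈ E, m / e := by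
      refine le_antisymm (Finset.sum_le_sum hle) ?_
      rw [hsum, Finset.sum_const, hE, smul_eq_mul]
      exact Nat.mul_div_le m e
    have h2 := (Finset.sum_eq_sum_iff_of_le hle).1 hsum'
    intro b hb hbs
    refine h2 b ?_
    rw [← Finset.mem_coe, hEs]
    exact ⟨hb, hbs⟩
  -- The infinite dual curve has a point on a good line, and its fibre is not empty.
  have hpos : 0 < m / e := by
    have hfin := finite_points_on_lines M hG hM (hA.union hA')
    obtain ⟨b, hb, hb'⟩ : ∃ b ∈ X.dualCurve, b ∉ {p ∈ zeroLocus G | ∀ T s, p = finitePt M T s →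
        s ∈ A ∪ {s | ∃ b ∈ B, b.rep ⬝ᵥ pencil M s = 0}} := by
      by_contra! hcon
      exact infinite_dualCurve hd hX (hfin.subset hcon)
    have hbG := hdual hb
    rw [Set.mem_ofPred_eq, not_and] at hb'
    have hb2 := hb' hbG
    push Not at hb2
    obtain ⟨T, s, hbT, hs⟩ := hb2
    rw [← hgood s hs b hbG ((rep_dot_pencil_iff hG he hM hbG s).2 ⟨T, hbT⟩)]
    exact one_le_ncard_fibre hd hX hb
  refine ⟨_, hA.union hA', fun s hs T hT => ?_⟩
  have h3 := hgood s hs _ hT ((rep_dot_pencil_iff hG he hM hT s).2 ⟨T, rfl⟩)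
  refine ⟨?_, h3⟩
  obtain ⟨p, hp⟩ := Set.nonempty_of_ncard_ne_zero (s := X.gaussMap ⁻¹' {finitePt M T s}) (by omega)
  exact ⟨p, hp⟩

/-- All zeros of `G` on general lines of a pencil are on the dual curve. A given zero `b` is a limit
of such points, since roots depend continuously on the line, and the dual curve is closed as the
image of a compact space. -/
theorem zeroLocus_subset_dualCurve (hd : 0 < d)
    (hX : ∃ p : C.Points, (X.line p : Set (TangentP2 p.1)) ≠ C.tangentSet p)
    (hG : G.IsHomogeneous e) (he : 0 < e) (hirr : Irreducible G)
    (hdual : X.dualCurve ⊆ zeroLocus G) : zeroLocus G ⊆ X.dualCurve := by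
  obtain ⟨m, hm⟩ := X.exists_hasDualDegree hd
  intro b hb
  obtain ⟨N, hN⟩ := exists_GL_eval_ne_zero hirr.ne_zero
  have hli : LinearIndependent ℂ ![N.1 0, b.rep] := by
    rw [LinearIndependent.pair_symm_iff, LinearIndependent.pair_iff' b.rep_nonzero]
    intro c hc
    apply hN
    rw [← hc, eval_smul_of_isHomogeneous hG, show eval b.rep G = 0 from hb, mul_zero]
  -- Coordinates in which `b` is the point with `T = s = 0`, while the centre stays off the zero
  -- locus.
  obtain ⟨M, hM0, hM2⟩ := exists_GL_rows hli
  rw [← hM0] at hN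
  obtain ⟨A, hA, h1⟩ := hm.exists_fibres hd hX hG he hirr hdual hN
  by_contra hbd
  have hopen := X.isClosed_dualCurve.isOpen_compl.mem_nhds hbd
  have hlim : Tendsto (fun z : ℂ × ℂ => finitePt M z.1 z.2) (𝓝 (0, 0)) (𝓝 b) := by
    have hcont : Continuous fun z : ℂ × ℂ => ![z.1, z.2, 1] ᵥ* M.1 := by
      simp only [cons_vecMul]
      fun_prop
    have h2 : Tendsto (fun z : ℂ × ℂ => ![z.1, z.2, 1] ᵥ* M.1) (𝓝 (0, 0)) (𝓝 b.rep) := by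
      refine hcont.tendsto' _ _ ?_
      rw [cons_vecMul, hM2]
      simp
    have h3 := tendsto_mk (g := fun z : ℂ × ℂ => finitePt M z.1 z.2) b.rep_nonzero h2
      (Eventually.of_forall fun z => ⟨vecMul_ne_zero M (cons_one_ne_zero z.1 z.2), rfl⟩)
    rwa [Projectivization.mk_rep] at h3
  obtain ⟨ε, hε, hball⟩ := Metric.mem_nhds_iff.1 (hlim hopen)
  have hroot := eventually_exists_root hG hN
    (by rw [hM2]; exact hb) hε
  have hs : ∀ᶠ s in 𝓝[≠] (0 : ℂ), s ∉ A := by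
    have h4 : (A \ {0})ᶜ ∈ 𝓝 (0 : ℂ) :=
      (hA.subset Set.sdiff_subset).isClosed.isOpen_compl.mem_nhds fun h => h.2 rfl
    filter_upwards [nhdsWithin_le_nhds h4, self_mem_nhdsWithin] with s h5 h6 h7
    exact h5 ⟨h7, h6⟩
  obtain ⟨s, ⟨hsA, T, hT, hTs⟩, hsε⟩ := ((hs.and (hroot.filter_mono nhdsWithin_le_nhds)).and
    (nhdsWithin_le_nhds (Metric.ball_mem_nhds (0 : ℂ) hε))).exists
  refine hball (show (T, s) ∈ Metric.ball ((0 : ℂ), (0 : ℂ)) ε from ?_) (h1 s hsA T ?_).1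
  · rw [← ball_prod_same]
    exact ⟨by simpa using hT, hsε⟩
  · rw [finitePt, mk_mem_zeroLocus hG]
    exact hTs

theorem exists_isPlaneCurveOfDegree (X : LineField C) (hd : 0 < d)
    (hX : ∃ p : C.Points, (X.line p : Set (TangentP2 p.1)) ≠ C.tangentSet p) :
    ∃ e, IsPlaneCurveOfDegree X.dualCurve e := by
  obtain ⟨e, he, G, hG, hirr, hdual⟩ := X.exists_irreducible_form hd hX
  exact ⟨e, he, G, hG, hirr.squarefree,
    hdual.antisymm (zeroLocus_subset_dualCurve hd hX hG he hirr hdual)⟩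

theorem exists_hasDegreeOntoImage (X : LineField C) (hd : 0 < d)
    (hX : ∃ p : C.Points, (X.line p : Set (TangentP2 p.1)) ≠ C.tangentSet p) :
    ∃ l, HasDegreeOntoImage X.gaussMap l := by
  obtain ⟨m, hm⟩ := X.exists_hasDualDegree hd
  obtain ⟨e, he, G, hG, hirr, hdual⟩ := X.exists_irreducible_form hd hX
  obtain ⟨M, hM⟩ := exists_GL_eval_ne_zero hirr.ne_zero
  obtain ⟨A, hA, h1⟩ := hm.exists_fibres hd hX hG he hirr hdual hM
  refine ⟨m / e, (finite_points_on_lines M hG hM hA).subset fun b hb => ⟨hdual hb.1, ?_⟩⟩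
  rintro T s rfl
  by_contra hs
  refine hb.2 ?_
  rw [← (h1 s hs T (hdual hb.1)).2, (finite_fibre hd hX _).cast_ncard_eq]

end LineField

end PlaneCurves

end

open PlaneCurves in
theorem mainTheorem6 (d : ℕ) (hd : 0 < d) (C : SmoothPlaneCurve d) (X : LineField C)
    (hX : ∃ p : C.Points, (X.line p : Set (TangentP2 p.1)) ≠ C.tangentSet p) :
    {p : C.Points | X.tangOrder p ≠ 0}.Finite ∧
    (∃ e : ℕ, IsPlaneCurveOfDegree X.dualCurve e) ∧
    (∃ l : ℕ, HasDegreeOntoImage X.gaussMap l) ∧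
    ∀ e l : ℕ, IsPlaneCurveOfDegree X.dualCurve e → HasDegreeOntoImage X.gaussMap l →
      ∃ n : ℕ, X.tang = n ∧ (n : ℤ) = (l : ℤ) * e + (d : ℤ) ^ 2 - 2 * d := by
  refine ⟨LineField.finite_tangOrder_ne_zero hd hX, X.exists_isPlaneCurveOfDegree hd hX,
    X.exists_hasDegreeOntoImage hd hX, fun e l he hl => ⟨_, LineField.tang_eq hd hX, ?_⟩⟩
  obtain ⟨m, hm⟩ := X.exists_hasDualDegree hd
  have h := hm.secDeg_dF hd hX
  rw [hm.eq_mul hd hX he hl] at h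
  zify at h
  linear_combination h
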